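/- **Setting.** A *one-dimensional kinetically constrained lattice gas* is given by rates $c_{x,y}(\eta)\ge 0$, for neighbours $x\sim y$ in $\mathbb Z$ and $\eta\in\{0,1\}^{\mathbb Z}$ ($0$ = empty, $1$ = occupied), such that: (1) $c_{x,y}(\eta)\in\{0\}\cup[1,c_{\max}]$ for some $c_{\max}\ge1$; (2) $c_{x,y}$ depends only on the configuration outside $\{x,y\}$; (3) for every edge there are $\eta$ with $c_{x,y}(\eta)\ge 1$ and $\eta'$ with $c_{x,y}(\eta')=0$; (4) $c_{x,y}$ is a decreasing function of $\eta$; (5) the rates are translation invariant; (6) there is $R$ such that $c_{x,y}$ depends only on the occupation in $x+[-R,R]$. An exchange of the occupations of $x\sim y$ is *allowed* in $\eta$ if $c_{x,y}(\eta)\ge1$; the result is denoted $\eta^{x,y}$. A finite set $A\subset\mathbb Z$ is a *mobile cluster* if there is an integer $l>0$ such that for every $e\in\{1,-1\}$ and $x\in\mathbb Z$ there are two fixed finite sequences of exchanges of neighbouring sites, each of which is allowed (step by step) from every configuration in which $x+A$ is empty, with the following properties. The first (translation) uses only sites of $x+[-l,l]$, and the product of its transpositions sends $x+y$ to $x+y+e$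 for every $y\in A$. The second (exchange) uses only sites of $(x+[-l,l])\cup\{x+(l+1)e\}$, and the product of its transpositions is the transposition of $x+le$ and $x+(l+1)e$. The model is *noncooperative* if it has a mobile cluster. Let $\Lambda=[L]=\{1,\dots,L\}$ with *occupied boundary conditions*: for $\eta\in\{0,1\}^\Lambda$, $c_{x,y}(\eta)$ ($x\sim y$ in $\Lambda$) is computed by regarding all sites outside $\Lambda$ as occupied. Given a finite nonempty family $\mathcal A=\{A_1,\dots,A_m\}$ of mobile clusters, let $\Omega_k=\Omega_k^{L}$ be the set of $\eta\in\{0,1\}^\Lambda$ with exactly $k$ vacancies from which finitely many allowed exchanges in $\Lambda$ lead to a configuration in which some translate $x+A_i\subset\Lambda$ ($x\in\mathbb Z$) is empty. Let $\mu_k$ be the uniform measure on $\Omega_k$, and $$\mathcal D f=\mu_k\Big[\sum_{x,y\in\Lambda,\ x\sim y}c_{x,y}(\eta)\,\big(f(\eta^{x,y})-f(\eta)\big)^2\Big].$$ **Theorem (relaxation time in a closed system).** Consider a one-dimensional noncooperative kinetically constrained lattice gas. There is a constant $C>0$, depending only on the model, such that the following holds for every finite nonempty family $\mathcal A=\{A_1,\dots,A_m\}$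 of mobile clusters satisfying (H1) for all $L$ and $k$, $\Omega_k$ is exactly the set of configurations with $k$ vacancies in which some translate $x+A_i\subset\Lambda$ is empty; (H2) clusters are not trapped at the ends of the box: for every $r\in\mathbb N$ there is $L_0$ such that, for all $L\ge L_0$, from every configuration on $[L]$ in which some translate $x+A_i\subset\Lambda$ is empty, finitely many allowed exchanges in $\Lambda$ lead to a configuration in which some translate $x'+A_j\subset\Lambda\cap[r,L+1-r]$ is empty. Let $q\in(0,1)$ and $k=\lfloor qL\rfloor$. Then for all $L$ large enough (depending on $q$ and $\mathcal A$), $\Omega_k$ is nonempty and, for every $f:\Omega_k\to\mathbb R$, $$\operatorname{Var}_{\mu_k} f\ \le\ C\,q^{-C}\,L^2\,\mathcal D f .$$ -/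

import Mathlib

open MeasureTheory ProbabilityTheory

/-- Configurations on the infinite lattice `ℤ`: `true` is an occupied site (the value 1) and
`false` is an empty site (the value 0). The pointwise order is the usual order of configurations. -/
abbrev LatticeConfig : Type := ℤ → Bool

/-- Nearest neighbours in `ℤ`. -/
abbrev Nbr (x y : ℤ) : Prop := |x - y| = 1

/-- The configuration `η` after exchanging the occupation values of `x` and `y`. -/
def exchange {S : Type*} [DecidableEq S] (x y : S) (η : S → Bool) : S → Bool :=
  fun z => η (Equiv.swap x y z)

/-- The configuration `η` translated by `z`. -/
def translateConfig (z : ℤ) (η : LatticeConfig) : LatticeConfig := fun u => η (u - z)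

/-- A kinetically constrained lattice gas on `ℤ`, given by the rates `c_{x,y}` of its edges. The
values of `rate x y` for sites that are not neighbours play no role. -/
structure KCLatticeGas where
  /-- `rate x y η` is `c_{x,y}(η)`. -/
  rate : ℤ → ℤ → LatticeConfig → ℝ
  /-- The rates take their values in `{0} ∪ [1, cmax]`. -/
  rate_values : ∃ cmax : ℝ, 1 ≤ cmax ∧ ∀ x y : ℤ, Nbr x y → ∀ η : LatticeConfig,
    rate x y η = 0 ∨ (1 ≤ rate x y η ∧ rate x y η ≤ cmax)
  /-- `c_{x,y}` depends only on the configuration outside `x` and `y`. -/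
  rate_outside : ∀ x y : ℤ, Nbr x y → ∀ η η' : LatticeConfig,
    (∀ z : ℤ, z ≠ x → z ≠ y → η z = η' z) → rate x y η = rate x y η'
  /-- The rates are nondegenerate. -/
  nondegenerate : ∀ x y : ℤ, Nbr x y →
    (∃ η : LatticeConfig, 1 ≤ rate x y η) ∧ (∃ η : LatticeConfig, rate x y η = 0)
  /-- Emptying sites can only increase the rates. -/
  rate_antitone : ∀ x y : ℤ, Nbr x y → Antitone (rate x y)
  /-- The model is translation invariant. -/
  homogeneous : ∀ x y z : ℤ, Nbr x y → ∀ η : LatticeConfig,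
    rate (x + z) (y + z) (translateConfig z η) = rate x y η
  /-- The rates have finite range. -/
  finite_range : ∃ R : ℕ, ∀ x y : ℤ, Nbr x y → ∀ η η' : LatticeConfig,
    (∀ z ∈ Set.Icc (x - R) (x + R), η z = η' z) → rate x y η = rate x y η'

namespace KCLatticeGas

/-- The deterministic sequence of exchanges `(x₀, e₀), (x₁, e₁), …`, where `(x, e)` stands for
exchanging `x` and `x + e`, is allowed on `ℤ` when started from `η`: every `e` is `1` or `-1` and
at each step the constraint of the exchanged edge is satisfied. -/
def AllowedFrom (M : KCLatticeGas) : List (ℤ × ℤ) → LatticeConfig → Prop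
  | [], _ => True
  | (x, e) :: s, η =>
      (e = 1 ∨ e = -1) ∧ 1 ≤ M.rate x (x + e) η ∧ M.AllowedFrom s (exchange x (x + e) η)

end KCLatticeGas

/-- The permutation of the sites associated with a sequence of exchanges: the product of the
transpositions, the last one being the leftmost factor. -/
def assocPerm : List (ℤ × ℤ) → Equiv.Perm ℤ
  | [] => 1
  | (x, e) :: s => assocPerm s * Equiv.swap x (x + e)

namespace KCLatticeGas

/-- `s` is a translation move in `[-l, l]` of the cluster `x + A` in the direction `e`: it is a
deterministic move, allowed from every configuration in which `x + A` is empty. -/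
def IsTranslationMove (M : KCLatticeGas) (A : Finset ℤ) (l : ℕ) (e x : ℤ)
    (s : List (ℤ × ℤ)) : Prop :=
  (∀ η : LatticeConfig, (∀ y ∈ A, η (x + y) = false) → M.AllowedFrom s η) ∧
  (∀ y ∈ A, assocPerm s (x + y) = x + y + e) ∧
  (∀ p ∈ s, p.1 ∈ Set.Icc (x - l) (x + l) ∧ p.1 + p.2 ∈ Set.Icc (x - l) (x + l))

/-- `s` is an exchange move in `[-l, l]` using the cluster `x + A` in the direction `e`: it is a
deterministic move, allowed from every configuration in which `x + A` is empty, whose net effect is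
to exchange `x + l e` and `x + (l + 1) e`. -/
def IsExchangeMove (M : KCLatticeGas) (A : Finset ℤ) (l : ℕ) (e x : ℤ)
    (s : List (ℤ × ℤ)) : Prop :=
  (∀ η : LatticeConfig, (∀ y ∈ A, η (x + y) = false) → M.AllowedFrom s η) ∧
  assocPerm s = Equiv.swap (x + l * e) (x + l * e + e) ∧
  (∀ p ∈ s, p.1 ∈ Set.Icc (x - l) (x + l) ∪ {x + (l + 1) * e} ∧
    p.1 + p.2 ∈ Set.Icc (x - l) (x + l) ∪ {x + (l + 1) * e})

/-- Mobile clusters. -/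
def IsMobileCluster (M : KCLatticeGas) (A : Finset ℤ) : Prop :=
  ∃ l : ℕ, 0 < l ∧ ∀ e : ℤ, e = 1 ∨ e = -1 → ∀ x : ℤ,
    (∃ s, M.IsTranslationMove A l e x s) ∧ (∃ s, M.IsExchangeMove A l e x s)

/-- The model is noncooperative: it has a mobile cluster. -/
def IsNoncooperative (M : KCLatticeGas) : Prop := ∃ A : Finset ℤ, M.IsMobileCluster A

end KCLatticeGas

/-- The sites of the box `[L] = {1, …, L}`. -/
abbrev Box (L : ℕ) : Type := ↥(Finset.Icc (1 : ℤ) (L : ℤ))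

/-- Configurations on the box `[L]`. -/
abbrev BoxConfig (L : ℕ) : Type := Box L → Bool

/-- Occupied boundary conditions: all sites outside the box are considered as occupied. -/
noncomputable def extendOccupied {L : ℕ} (η : BoxConfig L) : LatticeConfig :=
  fun z => if h : z ∈ Finset.Icc (1 : ℤ) (L : ℤ) then η ⟨z, h⟩ else true

/-- The number of vacancies. -/
noncomputable def numVacancies {L : ℕ} (η : BoxConfig L) : ℕ :=
  (Finset.univ.filter fun x : Box L => η x = false).card

/-- The translate `x + A` is contained in the box and empty. -/
def EmptyAt {L : ℕ} (A : Finset ℤ) (x : ℤ) (η : BoxConfig L) : Prop :=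
  ∀ y ∈ A, ∃ h : x + y ∈ Finset.Icc (1 : ℤ) (L : ℤ), η ⟨x + y, h⟩ = false

/-- `η` contains an empty translate of one of the clusters of the family `F`. -/
def ContainsCluster {L : ℕ} (F : Finset (Finset ℤ)) (η : BoxConfig L) : Prop :=
  ∃ A ∈ F, ∃ x : ℤ, EmptyAt A x η

namespace KCLatticeGas

/-- One allowed transition of the model on the box `[L]` with occupied boundary conditions. -/
def BoxStep (M : KCLatticeGas) {L : ℕ} (η η' : BoxConfig L) : Prop :=
  ∃ x y : Box L, Nbr x y ∧ 1 ≤ M.rate x y (extendOccupied η) ∧ η' = exchange x y η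

/-- `η'` can be reached from `η` by finitely many allowed transitions in the box. -/
def Reaches (M : KCLatticeGas) {L : ℕ} : BoxConfig L → BoxConfig L → Prop :=
  Relation.ReflTransGen M.BoxStep

/-- The set `Ω_k` of ergodic configurations of the box `[L]` with `k` vacancies. -/
def ergodicConfigs (M : KCLatticeGas) (F : Finset (Finset ℤ)) (L k : ℕ) : Set (BoxConfig L) :=
  {η | numVacancies η = k ∧ ∃ η', M.Reaches η η' ∧ ContainsCluster F η'}

/-- The ergodic configurations are those that contain an empty translate of a cluster of `F`. -/
def ErgodicIffContains (M : KCLatticeGas) (F : Finset (Finset ℤ)) : Prop :=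
  ∀ L k : ℕ, M.ergodicConfigs F L k = {η | numVacancies η = k ∧ ContainsCluster F η}

/-- Clusters of `F` are not trapped at the ends of the box: in large boxes, from any configuration
with an empty translate of a cluster of `F` one can reach a configuration with an empty translate
of a cluster of `F` at distance at least `r` from the complement of the box. -/
def ClustersNotTrapped (M : KCLatticeGas) (F : Finset (Finset ℤ)) : Prop :=
  ∀ r : ℕ, ∃ L₀ : ℕ, ∀ L : ℕ, L₀ ≤ L → ∀ η : BoxConfig L, ContainsCluster F η →
    ∃ η' : BoxConfig L, M.Reaches η η' ∧ ∃ A ∈ F, ∃ x : ℤ, EmptyAt A x η' ∧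
      ∀ y ∈ A, (r : ℤ) ≤ x + y ∧ x + y ≤ (L : ℤ) + 1 - r

/-- The equilibrium measure `μ_k`: the uniform measure on `Ω_k`. -/
noncomputable def equilibrium (M : KCLatticeGas) (F : Finset (Finset ℤ)) (L k : ℕ) :
    Measure (BoxConfig L) :=
  uniformOn (M.ergodicConfigs F L k)

/-- The Dirichlet form `μ[∑_{x ∼ y} c_{x,y} (∇_{x,y} f)²]`. For `μ = μ_k` it only involves the
values of `f` on `Ω_k`, because an exchange of positive rate does not leave `Ω_k`. -/
noncomputable def dirichletForm (M : KCLatticeGas) {L : ℕ} (μ : Measure (BoxConfig L))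
    (f : BoxConfig L → ℝ) : ℝ :=
  ∫ η, ∑ p : Box L × Box L with Nbr p.1 p.2,
    M.rate p.1 p.2 (extendOccupied η) * (f (exchange p.1 p.2 η) - f η) ^ 2 ∂μ

end KCLatticeGas

/-! Let E be the Dirichlet form without normalisation and Θ (`totalNorm`) the sum, over the oriented
edges of the box, of the square roots of their contributions to E. Cauchy–Schwarz gives Θ² ≤ 2LE.
The cost of a permutation σ of the sites on a set Z of configurations is the L²(Z) norm of f∘σ − f
(`disp`). It is subadditive along products, and an allowed exchange costs at most the square root of
the contribution of its edge. A cluster walking through the box repeats one fixed list of exchanges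
at distinct positions, so it uses every edge a bounded number of times and the whole walk costs O(Θ)
(`MoveSystem.sum_cost_le`). This is the source of the diffusive factor L².

Many empty windows. If a window around x is empty, a cluster fits in it and can exchange any two
sites away from x at cost O(Θ) (`disp_swap_le`). Comparison with the mean-field exchange dynamics,
whose gap is `reflections_gap`, places f within squared distance O(LΘ²) of a constant on these
configurations (`exists_const_near`). Distant windows are simultaneously empty in a proportion of
cases bounded below by a power of q, so the constant can be chosen independently of x
(`exists_uniform_const_near`). Summing over the positions x counts each configuration once per empty
window. Where there are at least order L windows this multiplicity compensates the number of
positions, and the total is O(LΘ²) = O(L²E).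

Few empty windows. A cluster at y sweeps one side of the box and rearranges successive blocks at
random, again at cost O(Θ). If that side has enough vacancies, the result has few windows only with
probability exponentially small in L. Hence the sum of f² over configurations with a cluster at y
and few windows is O(Θ²) plus an exponentially small fraction of the total (`MoveSystem.sum_sq_le`).
Clusters near the boundary are first brought inward by (H2), applied in a box of bounded size
(`sum_localConfigs_le`). The sum over the positions gives O(LΘ²) = O(L²E), and the exponentially
small term is absorbed on the left.

These constants depend on the family of clusters. However, two families of mobile clusters
satisfying (H1) have the same ergodic configurations (`ergodicConfigs_eq`), because by (H1) every
mobile cluster contains a translate of a member of the family. One admissible family therefore fixes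
the constant for all of them. -/

/-! ### Spectral gap of a mean-field family of reflections -/

open scoped InnerProductSpace in
/-- A nonnegative symmetric operator without spectrum in `(0, κ)` controls the distance to its
kernel. -/
theorem LinearMap.IsSymmetric.exists_ker_near {E : Type*} [NormedAddCommGroup E]
    [InnerProductSpace ℝ E] [FiniteDimensional ℝ E] {X : E →ₗ[ℝ] E} (hX : X.IsSymmetric)
    {κ : ℝ} (hpos : ∀ u, 0 ≤ ⟪X u, u⟫_ℝ)
    (hgap : ∀ u, κ * ⟪X u, u⟫_ℝ ≤ ⟪X u, X u⟫_ℝ) (u : E) :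
    ∃ g, X g = 0 ∧ κ * ⟪u - g, u - g⟫_ℝ ≤ ⟪X u, u⟫_ℝ := by
  classical
  set n := Module.finrank ℝ E with hn
  let b := hX.eigenvectorBasis hn.symm
  let μ := hX.eigenvalues hn.symm
  have hb : ∀ i, X (b i) = μ i • b i := fun i => hX.apply_eigenvectorBasis hn.symm i
  have hbb : ∀ i, ⟪b i, b i⟫_ℝ = 1 := fun i => by
    rw [real_inner_self_eq_norm_sq, b.orthonormal.1 i]; norm_num
  have hμ0 : ∀ i, 0 ≤ μ i := fun i => by
    have := hpos (b i)
    rwa [hb, real_inner_smul_left, hbb, mul_one] at this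
  have hμκ : ∀ i, μ i = 0 ∨ κ ≤ μ i := fun i => by
    have := hgap (b i)
    rw [hb, real_inner_smul_left, real_inner_smul_right, real_inner_smul_left, hbb] at this
    rcases (hμ0 i).eq_or_lt with h | h
    · exact Or.inl h.symm
    · right
      nlinarith
  have hXr : ∀ v i, ⟪b i, X v⟫_ℝ = μ i * ⟪b i, v⟫_ℝ := fun v i => by
    rw [← hX, hb, real_inner_smul_left]
  let g : E := ∑ i, (if μ i = 0 then ⟪b i, u⟫_ℝ else 0) • b i
  have hg : ∀ i, ⟪b i, g⟫_ℝ = if μ i = 0 then ⟪b i, u⟫_ℝ else 0 := fun i => by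
    simp only [g, inner_sum, real_inner_smul_right]
    rw [Finset.sum_eq_single i]
    · rw [hbb, mul_one]
    · intro j _ hj
      rw [b.orthonormal.2 hj.symm, mul_zero]
    · simp
  refine ⟨g, ?_, ?_⟩
  · simp only [g, map_sum, map_smul, hb]
    refine Finset.sum_eq_zero fun i _ => ?_
    by_cases h : μ i = 0 <;> simp [h]
  · rw [← b.sum_inner_mul_inner (u - g) (u - g), ← b.sum_inner_mul_inner (X u) u, Finset.mul_sum]
    refine Finset.sum_le_sum fun i _ => ?_
    rw [real_inner_comm (b i) (u - g), real_inner_comm (b i) (X u), hXr, inner_sub_right, hg]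
    rcases hμκ i with h | h
    · simp [h]
    · by_cases h0 : μ i = 0
      · simp [h0]
      · simp only [h0, if_false, sub_zero]
        nlinarith [mul_self_nonneg ⟪b i, u⟫_ℝ]

open scoped InnerProductSpace in
/-- The spectral gap of a mean-field family of reflections. -/
theorem reflections_gap {E : Type*} [NormedAddCommGroup E] [InnerProductSpace ℝ E]
    {α : Type*} [DecidableEq α] (V : Finset α) (U : α → α → E →ₗ[ℝ] E)
    (hs : ∀ i j u v, ⟪U i j u, v⟫_ℝ = ⟪u, U i j v⟫_ℝ) (hi : ∀ i j u, U i j (U i j u) = u)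
    (hc : ∀ i j, U i j = U j i) (h1 : ∀ i u, U i i u = u)
    (hd : ∀ i j k l u, i ≠ k → i ≠ l → j ≠ k → j ≠ l → U i j (U k l u) = U k l (U i j u))
    (h3 : ∀ i j l u, i ≠ l →
      u + U i j (U j l u) + U j l (U i j u) = U i j u + U j l u + U i l u) (u : E) :
    ((V.card : ℝ) - 2) * ∑ i ∈ V, ∑ j ∈ V, ⟪u - U i j u, u - U i j u⟫_ℝ ≤
      ⟪∑ i ∈ V, ∑ j ∈ V, (u - U i j u), ∑ i ∈ V, ∑ j ∈ V, (u - U i j u)⟫_ℝ := by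
  set a : α → α → E := fun i j => u - U i j u with ha
  have hUa : ∀ i j, U i j (a i j) = - a i j := fun i j => by
    simp only [ha, map_sub, hi]; abel
  have hac : ∀ i j, a i j = a j i := fun i j => by simp only [ha]; rw [hc]
  have ha0 : ∀ i, a i i = 0 := fun i => by simp only [ha]; rw [h1, sub_self]
  have hA : ∀ i j, ⟪a i j, a i j⟫_ℝ = 2 * ⟪u, u⟫_ℝ - 2 * ⟪u, U i j u⟫_ℝ := fun i j => by
    simp only [ha, inner_sub_left, inner_sub_right, hs, hi]; ring
  have hdisj : ∀ i j k l, i ≠ k → i ≠ l → j ≠ k → j ≠ l → 0 ≤ ⟪a i j, a k l⟫_ℝ := by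
    intro i j k l h h' h'' h'''
    -- `b` is `(1 - U i j) (1 - U k l) u`. The two factors commute and each is twice a projection,
    -- so the squared norm of `b` is four times the inner product in question.
    set b := a k l - U i j (a k l) with hb
    have hb2 : b = a i j - U k l (a i j) := by
      simp only [hb, ha, map_sub, hd i j k l u h h' h'' h''']; abel
    have e1 : ⟪U i j (a i j), a k l⟫_ℝ = ⟪a i j, U i j (a k l)⟫_ℝ := hs _ _ _ _
    have e2 : ⟪a i j, b⟫_ℝ = 2 * ⟪a i j, a k l⟫_ℝ := by
      rw [hb, inner_sub_right, ← e1, hUa, inner_neg_left]; ring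
    have e3 : U k l b = - b := by
      rw [hb2, map_sub, hi]; abel
    have e4 : ⟪b, b⟫_ℝ = 2 * ⟪a i j, b⟫_ℝ := by
      nth_rewrite 1 [hb2]
      rw [inner_sub_left, hs, e3, inner_neg_right]; ring
    have : 0 ≤ ⟪b, b⟫_ℝ := real_inner_self_nonneg
    linarith
  have htri : ∀ i j l, (⟪a i j, a i j⟫_ℝ + ⟪a j l, a j l⟫_ℝ - ⟪a i l, a i l⟫_ℝ) / 4 ≤
      ⟪a i j, a j l⟫_ℝ := by
    intro i j l
    by_cases h : i = l
    · subst h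
      rw [ha0 i, hac j i]
      have : 0 ≤ ⟪a i j, a i j⟫_ℝ := real_inner_self_nonneg
      simp only [inner_zero_left]
      linarith
    -- Here the bound is an equality: `h3` eliminates the products of two reflections, whose inner
    -- products with `u` agree by symmetry.
    · have e := congrArg (fun w => ⟪u, w⟫_ℝ) (h3 i j l u h)
      simp only [inner_add_right] at e
      have e' : ⟪u, U i j (U j l u)⟫_ℝ = ⟪u, U j l (U i j u)⟫_ℝ := by
        rw [← hs, ← hs, real_inner_comm]
      have e'' : ⟪a i j, a j l⟫_ℝ =
          ⟪u, u⟫_ℝ - ⟪u, U i j u⟫_ℝ - ⟪u, U j l u⟫_ℝ + ⟪u, U i j (U j l u)⟫_ℝ := by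
        simp only [ha, inner_sub_left, inner_sub_right, hs]; ring
      rw [hA, hA, hA, e'']
      linarith
  -- Pairs with a common index are listed by the index they share. When both indices are common the
  -- term is listed twice, hence the subtraction. Disjoint pairs contribute a nonnegative amount,
  -- which is dropped.
  have hpt : ∀ i j k l, ((if j = k then ⟪a i j, a j l⟫_ℝ else 0) +
      (if j = l then ⟪a i j, a j k⟫_ℝ else 0) + (if i = k then ⟪a i j, a i l⟫_ℝ else 0) +
      (if i = l then ⟪a i j, a i k⟫_ℝ else 0)) -
      ((if i = k then (if j = l then ⟪a i j, a i j⟫_ℝ else 0) else 0) +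
        (if i = l then (if j = k then ⟪a i j, a i j⟫_ℝ else 0) else 0)) ≤ ⟪a i j, a k l⟫_ℝ := by
    intro i j k l
    by_cases hij : i = j
    · subst hij; simp [ha0]
    by_cases hjk : j = k
    · subst hjk
      by_cases hil : i = l
      · subst hil
        simp [hij, Ne.symm hij, hac j i]
      · by_cases hjl : j = l
        · subst hjl; simp [hij, ha0]
        · simp [hij, hil, hjl]
    by_cases hjl : j = l
    · subst hjl
      by_cases hik : i = k
      · subst hik
        simp [hij, Ne.symm hij, hac j i]
      · simp [hij, hik, hjk, hac k j]
    by_cases hik : i = k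
    · subst hik
      by_cases hil : i = l
      · subst hil; simp [ha0, hjk]
      · simp [hjk, hjl, hil]
    by_cases hil : i = l
    · subst hil
      simp [hjk, hjl, hik, hac k i]
    simpa [hjk, hjl, hik, hil] using hdisj i j k l hik hil hjk hjl
  set A := ∑ i ∈ V, ∑ j ∈ V, ⟪a i j, a i j⟫_ℝ with hAdef
  set S := ∑ i ∈ V, ∑ j ∈ V, ∑ l ∈ V, ⟪a i j, a j l⟫_ℝ with hSdef
  have hS : (V.card : ℝ) * A / 4 ≤ S := by
    have : ∑ i ∈ V, ∑ j ∈ V, ∑ l ∈ V,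
        (⟪a i j, a i j⟫_ℝ + ⟪a j l, a j l⟫_ℝ - ⟪a i l, a i l⟫_ℝ) / 4 ≤ S :=
      Finset.sum_le_sum fun i _ => Finset.sum_le_sum fun j _ => Finset.sum_le_sum fun l _ =>
        htri i j l
    refine le_trans (le_of_eq ?_) this
    simp only [← Finset.sum_div, Finset.sum_add_distrib, Finset.sum_sub_distrib,
      Finset.sum_const, nsmul_eq_mul, ← Finset.mul_sum]
    rw [← hAdef]; ring
  have hS' : ∑ i ∈ V, ∑ j ∈ V, ∑ l ∈ V, ⟪a i j, a i l⟫_ℝ = S := by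
    rw [Finset.sum_comm, hSdef]
    refine Finset.sum_congr rfl fun i _ => Finset.sum_congr rfl fun j _ =>
      Finset.sum_congr rfl fun l _ => ?_
    rw [hac j i]
  have hexp : ⟪∑ i ∈ V, ∑ j ∈ V, a i j, ∑ i ∈ V, ∑ j ∈ V, a i j⟫_ℝ =
      ∑ i ∈ V, ∑ j ∈ V, ∑ k ∈ V, ∑ l ∈ V, ⟪a i j, a k l⟫_ℝ := by
    simp only [sum_inner]
    simp only [inner_sum]
  have hsum := Finset.sum_le_sum fun i (hi : i ∈ V) => Finset.sum_le_sum fun j (hj : j ∈ V) =>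
    Finset.sum_le_sum fun k (hk : k ∈ V) => Finset.sum_le_sum fun l (hl : l ∈ V) => hpt i j k l
  rw [hexp]
  refine le_trans ?_ hsum
  have key : ∀ i ∈ V, ∀ j ∈ V, ∑ k ∈ V, ∑ l ∈ V, (((if j = k then ⟪a i j, a j l⟫_ℝ else 0) +
      (if j = l then ⟪a i j, a j k⟫_ℝ else 0) + (if i = k then ⟪a i j, a i l⟫_ℝ else 0) +
      (if i = l then ⟪a i j, a i k⟫_ℝ else 0)) -
      ((if i = k then (if j = l then ⟪a i j, a i j⟫_ℝ else 0) else 0) +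
        (if i = l then (if j = k then ⟪a i j, a i j⟫_ℝ else 0) else 0))) =
      2 * ∑ l ∈ V, ⟪a i j, a j l⟫_ℝ + 2 * ∑ l ∈ V, ⟪a i j, a i l⟫_ℝ - 2 * ⟪a i j, a i j⟫_ℝ := by
    intro i hi j hj
    have r1 : ∀ (b : α) (φ : α → ℝ), b ∈ V →
        ∑ k ∈ V, ∑ l ∈ V, (if b = k then φ l else 0) = ∑ l ∈ V, φ l := by
      intro b φ hb
      rw [Finset.sum_comm]
      refine Finset.sum_congr rfl fun l _ => ?_
      simp [hb]
    have r2 : ∀ (b : α) (φ : α → ℝ), b ∈ V →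
        ∑ k ∈ V, ∑ l ∈ V, (if b = l then φ k else 0) = ∑ l ∈ V, φ l := by
      intro b φ hb
      refine Finset.sum_congr rfl fun l _ => ?_
      simp [hb]
    simp only [Finset.sum_add_distrib, Finset.sum_sub_distrib]
    rw [r1 j (fun l => ⟪a i j, a j l⟫_ℝ) hj, r2 j (fun l => ⟪a i j, a j l⟫_ℝ) hj,
      r1 i (fun l => ⟪a i j, a i l⟫_ℝ) hi, r2 i (fun l => ⟪a i j, a i l⟫_ℝ) hi,
      r1 i (fun l => if j = l then ⟪a i j, a i j⟫_ℝ else 0) hi,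
      r2 i (fun l => if j = l then ⟪a i j, a i j⟫_ℝ else 0) hi]
    simp only [Finset.sum_ite_eq, hj, if_true]
    ring
  rw [Finset.sum_congr rfl fun i hi => Finset.sum_congr rfl fun j hj => key i hi j hj]
  simp only [Finset.sum_add_distrib, Finset.sum_sub_distrib, ← Finset.mul_sum]
  rw [hS', ← hSdef, ← hAdef]
  linarith

/-! ### Exchanges acting on two-valued configurations -/

theorem exchange_exchange {S : Type*} [DecidableEq S] (i j : S) (η : S → Bool) :
    exchange i j (exchange i j η) = η := by
  funext z; simp [exchange]

theorem exchange_comm {S : Type*} [DecidableEq S] (i j : S) (η : S → Bool) :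
    exchange i j η = exchange j i η := by
  funext z; rw [exchange, exchange, Equiv.swap_comm]

theorem exchange_eq_self {S : Type*} [DecidableEq S] {i j : S} {η : S → Bool} (h : η i = η j) :
    exchange i j η = η := by
  funext z
  simp only [exchange, Equiv.swap_apply_def]
  split_ifs <;> simp_all

theorem exchange_conj {S : Type*} [DecidableEq S] {i j l : S} (hi : l ≠ i) (hj : l ≠ j)
    (η : S → Bool) : exchange i j (exchange j l (exchange i j η)) = exchange i l η := by
  funext z
  have := Equiv.swap_apply_apply (Equiv.swap i j) j l
  rw [Equiv.swap_apply_right, Equiv.swap_apply_of_ne_of_ne hi hj, Equiv.swap_inv] at this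
  simp only [exchange, this, Equiv.Perm.mul_apply]

theorem exchange_exchange_comm {S : Type*} [DecidableEq S] {i j k l : S} (h : i ≠ k) (h' : i ≠ l)
    (h'' : j ≠ k) (h''' : j ≠ l) (η : S → Bool) :
    exchange i j (exchange k l η) = exchange k l (exchange i j η) := by
  funext z
  simp only [exchange, Equiv.swap_apply_def]
  split_ifs <;> simp_all

open scoped InnerProductSpace in
/-- The spectral gap inequality for the exchanges of arbitrary pairs of sites of `V`. -/
theorem exists_exchange_invariant_near {α : Type*} [Fintype α] [DecidableEq α] (V : Finset α)
    (f : (α → Bool) → ℝ) :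
    ∃ g : (α → Bool) → ℝ, (∀ i ∈ V, ∀ j ∈ V, ∀ η, g (exchange i j η) = g η) ∧
      4 * ((V.card : ℝ) - 2) * ∑ η, (f η - g η) ^ 2 ≤
        ∑ i ∈ V, ∑ j ∈ V, ∑ η, (f (exchange i j η) - f η) ^ 2 := by
  let U : α → α → EuclideanSpace ℝ (α → Bool) →ₗ[ℝ] EuclideanSpace ℝ (α → Bool) := fun i j =>
    { toFun := fun u => WithLp.toLp 2 fun η => u (exchange i j η)
      map_add' := fun u v => by ext η; simp
      map_smul' := fun c u => by ext η; simp }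
  have hU : ∀ i j (u : EuclideanSpace ℝ (α → Bool)) η, U i j u η = u (exchange i j η) := fun _ _ _ _ => rfl
  have hin : ∀ u v : EuclideanSpace ℝ (α → Bool), ⟪u, v⟫_ℝ = ∑ η, u η * v η := fun u v => by
    simp [PiLp.inner_apply, mul_comm]
  have hs : ∀ i j (u v : EuclideanSpace ℝ (α → Bool)), ⟪U i j u, v⟫_ℝ = ⟪u, U i j v⟫_ℝ := fun i j u v => by
    rw [hin, hin]
    refine Finset.sum_nbij' (exchange i j) (exchange i j) (by simp) (by simp)
      (fun η _ => exchange_exchange i j η) (fun η _ => exchange_exchange i j η) fun η _ => ?_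
    rw [hU, hU, exchange_exchange]
  have hi : ∀ i j (u : EuclideanSpace ℝ (α → Bool)), U i j (U i j u) = u := fun i j u => by
    ext η; rw [hU, hU, exchange_exchange]
  have hc : ∀ i j, U i j = U j i := fun i j => by
    ext u η; rw [hU, hU, exchange_comm]
  have h1 : ∀ i (u : EuclideanSpace ℝ (α → Bool)), U i i u = u := fun i u => by
    ext η; rw [hU, exchange_eq_self rfl]
  have hd : ∀ i j k l (u : EuclideanSpace ℝ (α → Bool)), i ≠ k → i ≠ l → j ≠ k → j ≠ l →
      U i j (U k l u) = U k l (U i j u) := by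
    intro i j k l u h h' h'' h'''
    ext η
    rw [hU, hU, hU, hU, exchange_exchange_comm h h' h'' h''']
  -- For distinct sites this says that the antisymmetriser of three sites vanishes, since a
  -- two-valued configuration agrees at two of any three sites.
  have h3 : ∀ i j l (u : EuclideanSpace ℝ (α → Bool)), i ≠ l →
      u + U i j (U j l u) + U j l (U i j u) = U i j u + U j l u + U i l u := by
    intro i j l u h
    by_cases hij : i = j
    · subst hij; rw [h1, h1]
    by_cases hjl : j = l
    · subst hjl; rw [h1, h1]; abel
    ext η
    simp only [PiLp.add_apply, hU]
    have h3 : η i = η j ∨ η j = η l ∨ η i = η l := by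
      cases η i <;> cases η j <;> cases η l <;> simp
    rcases h3 with e | e | e
    · have e1 := exchange_conj (Ne.symm h) (Ne.symm hjl) η
      rw [exchange_eq_self e] at e1 ⊢
      rw [e1]
    · have e1 := exchange_conj (i := l) (j := j) (l := i) h hij η
      rw [exchange_comm l j, exchange_comm l j, exchange_eq_self e, exchange_comm j i,
        exchange_comm l i] at e1
      rw [exchange_eq_self e, e1]; ring
    · rw [exchange_eq_self e, exchange_eq_self (i := j) (j := l),
        exchange_eq_self (i := i) (j := j) (η := exchange j l η)]
      · ring
      · simp [exchange, Equiv.swap_apply_of_ne_of_ne hij h, e]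
      · simp [exchange, Equiv.swap_apply_of_ne_of_ne (Ne.symm h) (Ne.symm hjl), e]
  let X : EuclideanSpace ℝ (α → Bool) →ₗ[ℝ] EuclideanSpace ℝ (α → Bool) := ∑ i ∈ V, ∑ j ∈ V, (LinearMap.id - U i j)
  have hX : ∀ u : EuclideanSpace ℝ (α → Bool), X u = ∑ i ∈ V, ∑ j ∈ V, (u - U i j u) := fun u => by
    simp [X, LinearMap.sum_apply]
  have hXs : X.IsSymmetric := fun u v => by
    rw [hX, hX]
    simp only [sum_inner, inner_sum, inner_sub_left, inner_sub_right, hs]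
  have hXq : ∀ u : EuclideanSpace ℝ (α → Bool), ⟪X u, u⟫_ℝ =
      (∑ i ∈ V, ∑ j ∈ V, ⟪u - U i j u, u - U i j u⟫_ℝ) / 2 := fun u => by
    rw [hX]
    simp only [sum_inner, Finset.sum_div]
    refine Finset.sum_congr rfl fun i _ => Finset.sum_congr rfl fun j _ => ?_
    simp only [inner_sub_left, inner_sub_right, hs, hi]; ring
  have hpos : ∀ u : EuclideanSpace ℝ (α → Bool), 0 ≤ ⟪X u, u⟫_ℝ := fun u => by
    rw [hXq]
    exact div_nonneg (Finset.sum_nonneg fun i _ => Finset.sum_nonneg fun j _ =>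
      real_inner_self_nonneg) (by norm_num)
  -- `⟪X u, u⟫` is half the sum of the squared differences, so `reflections_gap` becomes a gap of `2
  -- (card - 2)` for `X`.
  obtain ⟨g, hg, hfg⟩ := hXs.exists_ker_near (κ := 2 * ((V.card : ℝ) - 2)) hpos
    (fun u => by
      have := reflections_gap V U hs hi hc h1 hd h3 u
      rw [hXq, hX]; linarith) (WithLp.toLp 2 f : EuclideanSpace ℝ (α → Bool))
  refine ⟨g, ?_, ?_⟩
  · have h0 := hXq g
    rw [hg, inner_zero_left] at h0
    have h0' : ∑ i ∈ V, ∑ j ∈ V, ⟪g - U i j g, g - U i j g⟫_ℝ = 0 := by linarith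
    intro i hi' j hj η
    rw [Finset.sum_eq_zero_iff_of_nonneg
      (fun i _ => Finset.sum_nonneg fun j _ => real_inner_self_nonneg)] at h0'
    have h2 := h0' i hi'
    rw [Finset.sum_eq_zero_iff_of_nonneg (fun j _ => real_inner_self_nonneg)] at h2
    have h4 := inner_self_eq_zero.1 (h2 j hj)
    have h5 := congrArg (fun w : EuclideanSpace ℝ (α → Bool) => w η) h4
    simp only [PiLp.sub_apply, hU, PiLp.zero_apply] at h5
    linarith
  · rw [hXq] at hfg
    simp only [hin, PiLp.sub_apply, hU] at hfg
    have e1 : ∀ x : ℝ, x ^ 2 = x * x := fun x => sq x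
    simp only [e1]
    have e2 : ∑ i ∈ V, ∑ j ∈ V, ∑ η, (f (exchange i j η) - f η) * (f (exchange i j η) - f η) =
        ∑ i ∈ V, ∑ j ∈ V, ∑ η, (f η - f (exchange i j η)) * (f η - f (exchange i j η)) := by
      refine Finset.sum_congr rfl fun i _ => Finset.sum_congr rfl fun j _ =>
        Finset.sum_congr rfl fun η _ => ?_
      ring
    rw [e2]
    linarith

/-- A function that is invariant under the exchanges in `V` depends only on the configuration
outside `V` and on the number of vacancies. -/
theorem eq_of_exchange_invariant {α : Type*} [Fintype α] [DecidableEq α] (V : Finset α)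
    {β : Type*} (g : (α → Bool) → β) (Z : (α → Bool) → Prop)
    (hZ : ∀ i ∈ V, ∀ j ∈ V, ∀ η, Z η → Z (exchange i j η))
    (hg : ∀ i ∈ V, ∀ j ∈ V, ∀ η, Z η → g (exchange i j η) = g η) (η η' : α → Bool) (hη : Z η)
    (hoff : ∀ z ∉ V, η z = η' z)
    (hcard : (Finset.univ.filter fun x => η x = false).card =
      (Finset.univ.filter fun x => η' x = false).card) : g η = g η' := by
  induction hn : (Finset.univ.filter fun x => η x ≠ η' x).card using Nat.strong_induction_on
    generalizing η with
  | _ n ih =>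
    by_cases he : η = η'
    · rw [he]
    have hne : ¬ (Finset.univ.filter fun x => η x = false) ⊆
        (Finset.univ.filter fun x => η' x = false) := by
      intro hsub
      have := Finset.eq_of_subset_of_card_le hsub hcard.ge
      apply he
      funext z
      have hz := Finset.ext_iff.1 this z
      simp only [Finset.mem_filter, Finset.mem_univ, true_and] at hz
      cases h1 : η z <;> cases h2 : η' z <;> simp_all
    have hne' : ¬ (Finset.univ.filter fun x => η' x = false) ⊆
        (Finset.univ.filter fun x => η x = false) := by
      intro hsub
      have := Finset.eq_of_subset_of_card_le hsub hcard.le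
      exact hne this.ge
    obtain ⟨i, hi, hi'⟩ := Finset.not_subset.1 hne
    obtain ⟨j, hj, hj'⟩ := Finset.not_subset.1 hne'
    simp only [Finset.mem_filter, Finset.mem_univ, true_and, Bool.not_eq_false] at hi hi' hj hj'
    have hij : i ≠ j := by rintro rfl; simp_all
    have hiV : i ∈ V := by by_contra h; have := hoff i h; simp_all
    have hjV : j ∈ V := by by_contra h; have := hoff j h; simp_all
    -- Exchanging a superfluous vacancy `i` with a missing one `j` lowers the number of sites where
    -- the two configurations differ.
    rw [← hg i hiV j hjV η hη]
    refine ih _ ?_ (exchange i j η) (hZ i hiV j hjV η hη) ?_ ?_ rfl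
    · rw [← hn]
      apply Finset.card_lt_card
      refine Finset.ssubset_iff_subset_ne.2 ⟨?_, ?_⟩
      · intro z
        simp only [Finset.mem_filter, Finset.mem_univ, true_and]
        simp only [exchange, Equiv.swap_apply_def]
        split_ifs <;> simp_all
      · intro h
        have := Finset.ext_iff.1 h i
        simp only [Finset.mem_filter, Finset.mem_univ, true_and] at this
        simp [exchange, hi, hi', hj'] at this
    · intro z hz
      rw [← hoff z hz]
      simp only [exchange, Equiv.swap_apply_def]
      rw [if_neg (by rintro rfl; exact hz hiV), if_neg (by rintro rfl; exact hz hjV)]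
    · rw [← hcard]
      refine Finset.card_bij (fun z _ => Equiv.swap i j z) ?_ ?_ ?_
      · intro z hz
        simp only [Finset.mem_filter, Finset.mem_univ, true_and] at hz ⊢
        exact hz
      · intro z _ z' _ h
        exact (Equiv.swap i j).injective h
      · intro z hz
        simp only [Finset.mem_filter, Finset.mem_univ, true_and] at hz
        refine ⟨Equiv.swap i j z, ?_, by simp⟩
        simp only [Finset.mem_filter, Finset.mem_univ, true_and]
        simp [exchange, hz]


/-! ### Permutations of sites acting on configurations of the box -/

/-- `σ` moves only sites of `V`. -/
def SupportedIn (V : Set ℤ) (σ : Equiv.Perm ℤ) : Prop := ∀ z ∉ V, σ z = z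

namespace SupportedIn

variable {V W : Set ℤ} {σ τ : Equiv.Perm ℤ}

theorem mono (h : SupportedIn V σ) (hVW : V ⊆ W) : SupportedIn W σ :=
  fun _ hz => h _ fun hz' => hz (hVW hz')

theorem one : SupportedIn V (1 : Equiv.Perm ℤ) := fun _ _ => rfl

theorem mul (hσ : SupportedIn V σ) (hτ : SupportedIn V τ) : SupportedIn V (σ * τ) :=
  fun z hz => by rw [Equiv.Perm.mul_apply, hτ z hz, hσ z hz]

theorem inv (hσ : SupportedIn V σ) : SupportedIn V σ⁻¹ :=
  fun _ hz => by rw [Equiv.Perm.inv_eq_iff_eq, hσ _ hz]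

theorem swap {x y : ℤ} (hx : x ∈ V) (hy : y ∈ V) : SupportedIn V (Equiv.swap x y) :=
  fun _ hz => Equiv.swap_apply_of_ne_of_ne (fun h => hz (h ▸ hx)) (fun h => hz (h ▸ hy))

theorem apply_mem (hσ : SupportedIn V σ) {z : ℤ} (hz : z ∈ V) : σ z ∈ V := by
  by_contra h
  have := σ.injective (hσ _ h)
  exact h (this.symm ▸ hz)

theorem mul_comm (hσ : SupportedIn V σ) (hτ : SupportedIn W τ) (h : Disjoint V W) :
    σ * τ = τ * σ := by
  ext z
  simp only [Equiv.Perm.mul_apply]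
  by_cases hz : z ∈ V
  · rw [hτ z (Set.disjoint_left.1 h hz), hτ _ (Set.disjoint_left.1 h (hσ.apply_mem hz))]
  · rw [hσ z hz]
    by_cases hz' : z ∈ W
    · rw [hσ _ (Set.disjoint_right.1 h (hτ.apply_mem hz'))]
    · rw [hτ z hz', hσ z hz]

end SupportedIn

/-- The action of a permutation of the sites on the configurations of the box. -/
noncomputable def permute {L : ℕ} (σ : Equiv.Perm ℤ) (η : BoxConfig L) : BoxConfig L :=
  fun z => extendOccupied η (σ⁻¹ z)

section permute

variable {L : ℕ} {σ τ : Equiv.Perm ℤ}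

theorem extendOccupied_coe (η : BoxConfig L) (z : Box L) : extendOccupied η z = η z := by
  simp only [extendOccupied, z.2, dif_pos]

theorem extendOccupied_of_notMem (η : BoxConfig L) {z : ℤ} (hz : z ∉ Finset.Icc (1 : ℤ) L) :
    extendOccupied η z = true := by
  simp only [extendOccupied, hz, dif_neg, not_false_eq_true]

theorem mem_box_of_extendOccupied {η : BoxConfig L} {z : ℤ} (hz : extendOccupied η z = false) :
    z ∈ Finset.Icc (1 : ℤ) L := by
  by_contra h
  rw [extendOccupied_of_notMem η h] at hz
  exact absurd hz (by simp)

/-- The support condition keeps the fictitious occupied sites outside the box. It is what makes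
`permute` behave as a group action. -/
theorem extendOccupied_permute (hσ : SupportedIn (Set.Icc 1 (L : ℤ)) σ) (η : BoxConfig L)
    (z : ℤ) : extendOccupied (permute σ η) z = extendOccupied η (σ⁻¹ z) := by
  by_cases hz : z ∈ Finset.Icc (1 : ℤ) L
  · exact extendOccupied_coe (permute σ η) ⟨z, hz⟩
  · rw [extendOccupied_of_notMem _ hz, hσ.inv z (by simpa using hz),
      extendOccupied_of_notMem _ hz]

theorem permute_mul (hτ : SupportedIn (Set.Icc 1 (L : ℤ)) τ) (η : BoxConfig L) :
    permute (σ * τ) η = permute σ (permute τ η) := by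
  funext z
  simp only [permute, mul_inv_rev, Equiv.Perm.mul_apply]
  exact (extendOccupied_permute hτ η _).symm

theorem permute_one (η : BoxConfig L) : permute 1 η = η := by
  funext z
  exact extendOccupied_coe η z

theorem permute_inv_permute (hσ : SupportedIn (Set.Icc 1 (L : ℤ)) σ) (η : BoxConfig L) :
    permute σ⁻¹ (permute σ η) = η := by
  rw [← permute_mul hσ, inv_mul_cancel, permute_one]

theorem permute_permute_inv (hσ : SupportedIn (Set.Icc 1 (L : ℤ)) σ) (η : BoxConfig L) :
    permute σ (permute σ⁻¹ η) = η := by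
  rw [← permute_mul hσ.inv, mul_inv_cancel, permute_one]

theorem permute_injective (hσ : SupportedIn (Set.Icc 1 (L : ℤ)) σ) :
    Function.Injective (permute (L := L) σ) :=
  Function.LeftInverse.injective (permute_inv_permute hσ)

theorem exchange_eq_permute (x y : Box L) (η : BoxConfig L) :
    exchange x y η = permute (Equiv.swap (x : ℤ) y) η := by
  funext z
  have : Equiv.swap (x : ℤ) y z = ((Equiv.swap x y z : Box L) : ℤ) := by
    simp only [Equiv.swap_apply_def, Subtype.ext_iff]
    split_ifs <;> rfl
  rw [permute, Equiv.swap_inv, this, extendOccupied_coe, exchange]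

theorem numVacancies_eq (η : BoxConfig L) :
    numVacancies η = ((Finset.Icc (1 : ℤ) L).filter fun z => extendOccupied η z = false).card := by
  rw [numVacancies]
  refine Finset.card_bij (fun z _ => (z : ℤ)) ?_ (fun _ _ _ _ h => Subtype.ext h) ?_
  · intro z hz
    simp only [Finset.mem_filter, Finset.mem_univ, true_and] at hz
    exact Finset.mem_filter.2 ⟨z.2, by rw [extendOccupied_coe, hz]⟩
  · intro z hz
    obtain ⟨hz, hz'⟩ := Finset.mem_filter.1 hz
    refine ⟨⟨z, hz⟩, ?_, rfl⟩
    simp only [Finset.mem_filter, Finset.mem_univ, true_and]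
    rw [← hz', ← extendOccupied_coe η ⟨z, hz⟩]

theorem numVacancies_permute (hσ : SupportedIn (Set.Icc 1 (L : ℤ)) σ) (η : BoxConfig L) :
    numVacancies (permute σ η) = numVacancies η := by
  rw [numVacancies_eq, numVacancies_eq]
  refine Finset.card_bij (fun z _ => σ⁻¹ z) ?_ (fun _ _ _ _ h => σ⁻¹.injective h) ?_
  · intro z hz
    obtain ⟨hz, hz'⟩ := Finset.mem_filter.1 hz
    rw [extendOccupied_permute hσ] at hz'
    exact Finset.mem_filter.2 ⟨mem_box_of_extendOccupied hz', hz'⟩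
  · intro z hz
    obtain ⟨hz, hz'⟩ := Finset.mem_filter.1 hz
    refine ⟨σ z, ?_, by simp⟩
    have : extendOccupied (permute σ η) (σ z) = false := by
      rw [extendOccupied_permute hσ, Equiv.Perm.inv_def, Equiv.symm_apply_apply, hz']
    exact Finset.mem_filter.2 ⟨mem_box_of_extendOccupied this, this⟩

theorem emptyAt_iff (A : Finset ℤ) (x : ℤ) (η : BoxConfig L) :
    EmptyAt A x η ↔ ∀ y ∈ A, extendOccupied η (x + y) = false := by
  refine forall₂_congr fun y _ => ⟨?_, ?_⟩
  · rintro ⟨h, h'⟩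
    exact (extendOccupied_coe η ⟨x + y, h⟩).trans h'
  · intro h
    exact ⟨mem_box_of_extendOccupied h,
      (extendOccupied_coe η ⟨x + y, mem_box_of_extendOccupied h⟩).symm.trans h⟩

end permute

/-! ### The `L²` norm on a finite set of configurations -/

/-- The `L²` norm with respect to the counting measure on `Z`. -/
noncomputable def nrm {β : Type*} (Z : Finset β) (g : β → ℝ) : ℝ := √(∑ η ∈ Z, g η ^ 2)

section nrm

variable {β γ : Type*} {Z Z' : Finset β}

theorem nrm_nonneg (Z : Finset β) (g : β → ℝ) : 0 ≤ nrm Z g := Real.sqrt_nonneg _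

theorem nrm_sq (Z : Finset β) (g : β → ℝ) : nrm Z g ^ 2 = ∑ η ∈ Z, g η ^ 2 :=
  Real.sq_sqrt (Finset.sum_nonneg fun _ _ => sq_nonneg _)

theorem nrm_le_of_sum_le {g : β → ℝ} {b : ℝ} (hb : 0 ≤ b) (h : ∑ η ∈ Z, g η ^ 2 ≤ b ^ 2) :
    nrm Z g ≤ b := Real.sqrt_le_iff.2 ⟨hb, h⟩

theorem nrm_add_le (g h : β → ℝ) : nrm Z (fun η => g η + h η) ≤ nrm Z g + nrm Z h := by
  refine nrm_le_of_sum_le (add_nonneg (nrm_nonneg _ _) (nrm_nonneg _ _)) ?_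
  have hcs : ∑ η ∈ Z, g η * h η ≤ nrm Z g * nrm Z h := Real.sum_mul_le_sqrt_mul_sqrt _ _ _
  have e : ∑ η ∈ Z, (g η + h η) ^ 2 =
      ∑ η ∈ Z, g η ^ 2 + 2 * ∑ η ∈ Z, g η * h η + ∑ η ∈ Z, h η ^ 2 := by
    rw [Finset.mul_sum, ← Finset.sum_add_distrib, ← Finset.sum_add_distrib]
    exact Finset.sum_congr rfl fun _ _ => by ring
  rw [e, ← nrm_sq, ← nrm_sq]
  nlinarith

theorem nrm_mono (h : Z ⊆ Z') (g : β → ℝ) : nrm Z g ≤ nrm Z' g :=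
  Real.sqrt_le_sqrt (Finset.sum_le_sum_of_subset_of_nonneg h fun _ _ _ => sq_nonneg _)

theorem nrm_comp_le [DecidableEq γ] {Y : Finset γ} (φ : β → γ) (hφ : Function.Injective φ)
    (hm : ∀ η ∈ Z, φ η ∈ Y) (g : γ → ℝ) : nrm Z (fun η => g (φ η)) ≤ nrm Y g := by
  refine Real.sqrt_le_sqrt ?_
  rw [← Finset.sum_image (f := fun ξ => g ξ ^ 2) (fun _ _ _ _ h => hφ h)]
  exact Finset.sum_le_sum_of_subset_of_nonneg
    (fun ξ hξ => by obtain ⟨η, hη, rfl⟩ := Finset.mem_image.1 hξ; exact hm η hη)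
    fun _ _ _ => sq_nonneg _

theorem nrm_neg (g : β → ℝ) : nrm Z (fun η => - g η) = nrm Z g := by
  simp [nrm]

end nrm

/-! ### The displacement of a function by a permutation -/

/-- How much `f` changes on `Z` under the permutation `σ` of the sites. -/
noncomputable def disp {L : ℕ} (f : BoxConfig L → ℝ) (Z : Finset (BoxConfig L))
    (σ : Equiv.Perm ℤ) : ℝ := nrm Z fun η => f (permute σ η) - f η

section disp

variable {L : ℕ} {f : BoxConfig L → ℝ} {Z Z' : Finset (BoxConfig L)} {σ τ : Equiv.Perm ℤ}

theorem disp_nonneg : 0 ≤ disp f Z σ := nrm_nonneg _ _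

theorem disp_one : disp f Z 1 = 0 := by simp [disp, nrm, permute_one]

theorem disp_mono (h : Z ⊆ Z') : disp f Z σ ≤ disp f Z' σ := nrm_mono h _

theorem disp_sq : disp f Z σ ^ 2 = ∑ η ∈ Z, (f (permute σ η) - f η) ^ 2 := nrm_sq _ _

/-- Telescope and apply Minkowski. The injective change of variables `η ↦ permute τ η` moves the
term for `σ` onto `Z'`, so the cost of `σ` is measured where the cluster is after `τ`. -/
theorem disp_mul_le_of_mapsTo (hτ : SupportedIn (Set.Icc 1 (L : ℤ)) τ)
    (hm : ∀ η ∈ Z, permute τ η ∈ Z') : disp f Z (σ * τ) ≤ disp f Z' σ + disp f Z τ := by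
  have e : (fun η => f (permute (σ * τ) η) - f η) = fun η =>
      (f (permute σ (permute τ η)) - f (permute τ η)) + (f (permute τ η) - f η) := by
    funext η; rw [permute_mul hτ]; ring
  rw [disp, e]
  exact (nrm_add_le _ _).trans (add_le_add_left
    (nrm_comp_le (permute τ) (permute_injective hτ) hm (fun η => f (permute σ η) - f η)) _)

theorem disp_inv_le (hσ : SupportedIn (Set.Icc 1 (L : ℤ)) σ)
    (hm : ∀ η ∈ Z, permute σ⁻¹ η ∈ Z') : disp f Z σ⁻¹ ≤ disp f Z' σ := by
  have e : (fun η => f (permute σ⁻¹ η) - f η) = fun η =>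
      - (f (permute σ (permute σ⁻¹ η)) - f (permute σ⁻¹ η)) := by
    funext η; rw [permute_permute_inv hσ]; ring
  rw [disp, e, nrm_neg]
  exact nrm_comp_le (permute σ⁻¹) (permute_injective hσ.inv) hm
    (fun η => f (permute σ η) - f η)

/-- Perform `τ`, then `ρ'`, and undo `τ`. The preparation is paid twice, and `ρ'` is paid on `Z'`,
where it may be easier to carry out than `ρ` on `Z`. -/
theorem disp_le_of_semiconj {ρ ρ' : Equiv.Perm ℤ} (hτ : SupportedIn (Set.Icc 1 (L : ℤ)) τ)
    (hρ : SupportedIn (Set.Icc 1 (L : ℤ)) ρ) (hm : ∀ η ∈ Z, permute τ η ∈ Z')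
    (hmρ : ∀ η ∈ Z, permute ρ η ∈ Z) (h : τ * ρ = ρ' * τ) :
    disp f Z ρ ≤ 2 * disp f Z τ + disp f Z' ρ' := by
  have e : (fun η => f (permute ρ η) - f η) = fun η =>
      (- (f (permute τ (permute ρ η)) - f (permute ρ η))) + (f (permute (ρ' * τ) η) - f η) := by
    funext η; rw [← permute_mul hρ, h]; ring
  have h1 : nrm Z (fun η => f (permute τ (permute ρ η)) - f (permute ρ η)) ≤ disp f Z τ :=
    nrm_comp_le (permute ρ) (permute_injective hρ) hmρ (fun η => f (permute τ η) - f η)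
  have h2 : disp f Z (ρ' * τ) ≤ disp f Z' ρ' + disp f Z τ := disp_mul_le_of_mapsTo hτ hm
  rw [disp, e]
  refine (nrm_add_le _ _).trans ?_
  rw [nrm_neg]
  change nrm Z (fun η => f (permute τ (permute ρ η)) - f (permute ρ η)) + disp f Z (ρ' * τ) ≤ _
  linarith

end disp

/-- The configurations in which `x + A` is empty. -/
noncomputable def clusterConfigs (L : ℕ) (A : Finset ℤ) (x : ℤ) : Finset (BoxConfig L) :=
  Finset.univ.filter fun η => ∀ y ∈ A, extendOccupied η (x + y) = false

theorem mem_clusterConfigs {L : ℕ} {A : Finset ℤ} {x : ℤ} {η : BoxConfig L} :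
    η ∈ clusterConfigs L A x ↔ ∀ y ∈ A, extendOccupied η (x + y) = false := by
  simp [clusterConfigs]

theorem permute_mem_clusterConfigs {L : ℕ} {A : Finset ℤ} {x x' : ℤ} {σ : Equiv.Perm ℤ}
    (hσ : SupportedIn (Set.Icc 1 (L : ℤ)) σ) (h : ∀ y ∈ A, σ (x + y) = x' + y)
    {η : BoxConfig L} (hη : η ∈ clusterConfigs L A x) : permute σ η ∈ clusterConfigs L A x' := by
  rw [mem_clusterConfigs] at hη ⊢
  intro y hy
  rw [extendOccupied_permute hσ, ← h y hy, Equiv.Perm.inv_def, Equiv.symm_apply_apply, hη y hy]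

/-! ### The energy of the edges -/

namespace KCLatticeGas

variable (M : KCLatticeGas) {L : ℕ} (f : BoxConfig L → ℝ)

theorem rate_nonneg {x y : ℤ} (h : Nbr x y) (η : LatticeConfig) : 0 ≤ M.rate x y η := by
  obtain ⟨c, -, hc⟩ := M.rate_values
  rcases hc x y h η with h | h <;> linarith [h]

/-- The unnormalized Dirichlet form, summed over all configurations of the box. -/
noncomputable def energy : ℝ := ∑ η : BoxConfig L, ∑ p : Box L × Box L with Nbr p.1 p.2,
  M.rate p.1 p.2 (extendOccupied η) * (f (exchange p.1 p.2 η) - f η) ^ 2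

/-- The contribution of a pair of sites to the energy. -/
noncomputable def pairEnergy (x y : ℤ) : ℝ := ∑ η : BoxConfig L,
  M.rate x y (extendOccupied η) * (f (permute (Equiv.swap x y) η) - f η) ^ 2

theorem pairEnergy_nonneg {x y : ℤ} (h : Nbr x y) : 0 ≤ M.pairEnergy f x y :=
  Finset.sum_nonneg fun _ _ => mul_nonneg (M.rate_nonneg h _) (sq_nonneg _)

open Classical in
/-- The square root of the contribution to the energy of the edge from `z` to `z + e`. -/
noncomputable def edgeNorm (z e : ℤ) : ℝ :=
  if (e = 1 ∨ e = -1) ∧ z ∈ Set.Icc 1 (L : ℤ) ∧ z + e ∈ Set.Icc 1 (L : ℤ) then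
    √(M.pairEnergy f z (z + e)) else 0

theorem edgeNorm_nonneg (z e : ℤ) : 0 ≤ M.edgeNorm f z e := by
  rw [edgeNorm]; split_ifs
  · exact Real.sqrt_nonneg _
  · exact le_rfl

/-- The sum of the edge norms over all oriented edges of the box. -/
noncomputable def totalNorm : ℝ :=
  ∑ z ∈ Finset.Icc (1 : ℤ) L, (M.edgeNorm f z 1 + M.edgeNorm f z (-1))

theorem totalNorm_nonneg : 0 ≤ M.totalNorm f :=
  Finset.sum_nonneg fun _ _ => add_nonneg (M.edgeNorm_nonneg f _ _) (M.edgeNorm_nonneg f _ _)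

theorem nbr_add {z e : ℤ} (he : e = 1 ∨ e = -1) : Nbr z (z + e) := by
  rcases he with rfl | rfl <;> simp [Nbr]

theorem energy_eq : M.energy f = ∑ z ∈ Finset.Icc (1 : ℤ) L, ∑ w ∈ Finset.Icc (1 : ℤ) L,
    if Nbr z w then M.pairEnergy f z w else 0 := by
  rw [energy, Finset.sum_comm, Finset.sum_filter, Fintype.sum_prod_type,
    ← Finset.sum_coe_sort (Finset.Icc (1 : ℤ) L)]
  refine Finset.sum_congr rfl fun x _ => ?_
  rw [← Finset.sum_coe_sort (Finset.Icc (1 : ℤ) L)]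
  refine Finset.sum_congr rfl fun y _ => ?_
  simp only [pairEnergy, exchange_eq_permute]

/-- Cauchy–Schwarz over the `L` sites. The factor 2 comes from the two orientations at each site. -/
theorem totalNorm_sq_le : M.totalNorm f ^ 2 ≤ 2 * L * M.energy f := by
  have h1 := sq_sum_le_card_mul_sum_sq (s := Finset.Icc (1 : ℤ) L)
    (f := fun z => M.edgeNorm f z 1 + M.edgeNorm f z (-1))
  have h2 : ((Finset.Icc (1 : ℤ) L).card : ℝ) = L := by simp
  rw [h2] at h1
  refine h1.trans ?_
  rw [energy_eq, mul_assoc, mul_left_comm, Finset.mul_sum (a := (2 : ℝ))]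
  refine mul_le_mul_of_nonneg_left (Finset.sum_le_sum fun z hz => ?_) (Nat.cast_nonneg _)
  have h3 : ∀ e : ℤ, e = 1 ∨ e = -1 → M.edgeNorm f z e ^ 2 =
      ∑ w ∈ Finset.Icc (1 : ℤ) L, if w = z + e then M.pairEnergy f z w else 0 := by
    intro e he
    rw [Finset.sum_ite_eq', edgeNorm]
    simp only [he, true_and, Set.mem_Icc, Finset.mem_Icc.1 hz, Finset.mem_Icc]
    split_ifs with h
    · exact Real.sq_sqrt (M.pairEnergy_nonneg f (nbr_add he))
    · norm_num
  have h4 : (M.edgeNorm f z 1 + M.edgeNorm f z (-1)) ^ 2 ≤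
      2 * (M.edgeNorm f z 1 ^ 2 + M.edgeNorm f z (-1) ^ 2) := by
    nlinarith [sq_nonneg (M.edgeNorm f z 1 - M.edgeNorm f z (-1))]
  refine h4.trans ?_
  rw [h3 1 (Or.inl rfl), h3 (-1) (Or.inr rfl), ← Finset.sum_add_distrib]
  refine mul_le_mul_of_nonneg_left (Finset.sum_le_sum fun w _ => ?_) (by norm_num)
  by_cases hw : w = z + 1
  · subst hw
    have : Nbr z (z + 1) := nbr_add (Or.inl rfl)
    rw [if_pos rfl, if_neg (by omega), if_pos this, add_zero]
  · by_cases hw' : w = z + -1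
    · subst hw'
      have : Nbr z (z + -1) := nbr_add (Or.inr rfl)
      rw [if_neg (by omega), if_pos rfl, if_pos this, zero_add]
    · rw [if_neg hw, if_neg hw', add_zero]
      split_ifs with h
      · exact M.pairEnergy_nonneg f h
      · exact le_rfl

/-- The edge norms along distinct edges in a fixed direction add up to at most the total norm. -/
theorem sum_edgeNorm_le (n : ℕ) (φ : ℕ → ℤ) (hφ : Function.Injective φ) (e : ℤ) :
    ∑ t ∈ Finset.range n, M.edgeNorm f (φ t) e ≤ M.totalNorm f := by
  have hz : ∀ z ∉ Finset.Icc (1 : ℤ) L, M.edgeNorm f z e = 0 := by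
    intro z hz
    rw [edgeNorm, if_neg]
    rintro ⟨-, h, -⟩
    exact hz (by simpa using h)
  have h1 : ∑ t ∈ Finset.range n, M.edgeNorm f (φ t) e ≤
      ∑ z ∈ Finset.Icc (1 : ℤ) L, M.edgeNorm f z e := by
    rw [← Finset.sum_image (f := fun z => M.edgeNorm f z e) (fun _ _ _ _ h => hφ h)]
    rw [← Finset.sum_filter_add_sum_filter_not _ (fun z => z ∈ Finset.Icc (1 : ℤ) L)]
    rw [Finset.sum_eq_zero (s := Finset.filter (fun z => ¬ z ∈ Finset.Icc (1 : ℤ) L) _)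
      (fun z hz' => hz z (Finset.mem_filter.1 hz').2), add_zero]
    exact Finset.sum_le_sum_of_subset_of_nonneg
      (fun z hz => (Finset.mem_filter.1 hz).2) fun _ _ _ => M.edgeNorm_nonneg f _ _
  refine h1.trans ?_
  by_cases he : e = 1 ∨ e = -1
  · refine Finset.sum_le_sum fun z _ => ?_
    have := M.edgeNorm_nonneg f z 1
    have := M.edgeNorm_nonneg f z (-1)
    rcases he with rfl | rfl <;> linarith
  · refine le_trans (le_of_eq (Finset.sum_eq_zero fun z _ => ?_)) (M.totalNorm_nonneg f)
    rw [edgeNorm, if_neg]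
    rintro ⟨h, -⟩
    exact he h

theorem edgeNorm_le_totalNorm (z e : ℤ) : M.edgeNorm f z e ≤ M.totalNorm f := by
  have := M.sum_edgeNorm_le f 1 (fun t => z + t) (fun a b h => by simpa using h) e
  simpa using this

/-- The cost of a sequence of exchanges. -/
noncomputable def movesNorm (s : List (ℤ × ℤ)) : ℝ := (s.map fun p => M.edgeNorm f p.1 p.2).sum

theorem movesNorm_nonneg (s : List (ℤ × ℤ)) : 0 ≤ M.movesNorm f s :=
  List.sum_nonneg fun x hx => by
    obtain ⟨p, -, rfl⟩ := List.mem_map.1 hx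
    exact M.edgeNorm_nonneg f _ _

theorem movesNorm_le (s : List (ℤ × ℤ)) : M.movesNorm f s ≤ s.length * M.totalNorm f := by
  induction s with
  | nil => simp [movesNorm]
  | cons p s ih =>
    have := M.edgeNorm_le_totalNorm f p.1 p.2
    simp only [movesNorm, List.map_cons, List.sum_cons, List.length_cons] at ih ⊢
    push_cast
    linarith

end KCLatticeGas

theorem assocPerm_supportedIn {V : Set ℤ} {s : List (ℤ × ℤ)}
    (h : ∀ p ∈ s, p.1 ∈ V ∧ p.1 + p.2 ∈ V) : SupportedIn V (assocPerm s) := by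
  induction s with
  | nil => exact SupportedIn.one
  | cons p s ih =>
    have hp := h p (by simp)
    exact (ih fun p' hp' => h p' (by simp [hp'])).mul (SupportedIn.swap hp.1 hp.2)

namespace KCLatticeGas

/-- Telescope along the exchanges, replacing `Z` by its image at each step. An allowed exchange has
rate at least 1, so its squared cost is bounded by the energy of its edge. -/
theorem disp_assocPerm_le (M : KCLatticeGas) {L : ℕ} (f : BoxConfig L → ℝ) (s : List (ℤ × ℤ))
    (hs : ∀ p ∈ s, p.1 ∈ Set.Icc 1 (L : ℤ) ∧ p.1 + p.2 ∈ Set.Icc 1 (L : ℤ))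
    (Z : Finset (BoxConfig L)) (hZ : ∀ η ∈ Z, M.AllowedFrom s (extendOccupied η)) :
    disp f Z (assocPerm s) ≤ M.movesNorm f s := by
  classical
  induction s generalizing Z with
  | nil => simp [assocPerm, disp_one, movesNorm]
  | cons p s ih =>
    obtain ⟨x, e⟩ := p
    have hp := hs (x, e) (by simp)
    have hsw : SupportedIn (Set.Icc 1 (L : ℤ)) (Equiv.swap x (x + e)) :=
      SupportedIn.swap hp.1 hp.2
    have h1 := ih (fun p' hp' => hs p' (by simp [hp']))
      (Z.image (permute (Equiv.swap x (x + e)))) (by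
        intro ξ hξ
        obtain ⟨η, hη, rfl⟩ := Finset.mem_image.1 hξ
        have : extendOccupied (permute (Equiv.swap x (x + e)) η) =
            exchange x (x + e) (extendOccupied η) := by
          funext z; rw [extendOccupied_permute hsw, Equiv.swap_inv, exchange]
        rw [this]
        exact (hZ η hη).2.2)
    have h2 : disp f Z (Equiv.swap x (x + e)) ≤ M.edgeNorm f x e := by
      rcases Z.eq_empty_or_nonempty with rfl | ⟨η₀, hη₀⟩
      · simpa [disp, nrm] using M.edgeNorm_nonneg f x e
      have he := (hZ η₀ hη₀).1
      rw [edgeNorm, if_pos ⟨he, hp.1, hp.2⟩]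
      refine Real.sqrt_le_sqrt ?_
      refine le_trans (Finset.sum_le_sum fun η hη => ?_)
        (Finset.sum_le_sum_of_subset_of_nonneg (Finset.subset_univ Z) fun η _ _ =>
          mul_nonneg (M.rate_nonneg (nbr_add he) _) (sq_nonneg _))
      exact le_mul_of_one_le_left (sq_nonneg _) (hZ η hη).2.1
    have h3 : disp f Z (assocPerm s * Equiv.swap x (x + e)) ≤ _ :=
      disp_mul_le_of_mapsTo hsw (fun η hη => Finset.mem_image_of_mem _ hη)
    simp only [movesNorm, List.map_cons, List.sum_cons] at h1 ⊢
    rw [assocPerm]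
    linarith

end KCLatticeGas

/-! ### Translation invariance -/

/-- The sequence of exchanges `s` translated by `x`. -/
def shiftMoves (x : ℤ) (s : List (ℤ × ℤ)) : List (ℤ × ℤ) := s.map fun p => (p.1 + x, p.2)

theorem swap_add_right (a b x z : ℤ) :
    Equiv.swap (a + x) (b + x) (z + x) = Equiv.swap a b z + x := by
  simp only [Equiv.swap_apply_def, add_left_inj]
  split_ifs <;> rfl

theorem assocPerm_shiftMoves (x : ℤ) (s : List (ℤ × ℤ)) (z : ℤ) :
    assocPerm (shiftMoves x s) (z + x) = assocPerm s z + x := by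
  induction s generalizing z with
  | nil => rfl
  | cons p s ih =>
    obtain ⟨y, e⟩ := p
    change assocPerm (shiftMoves x s) (Equiv.swap (y + x) (y + x + e) (z + x)) = _
    rw [show y + x + e = y + e + x by ring, swap_add_right, ih]
    rfl

theorem KCLatticeGas.AllowedFrom.shiftMoves {M : KCLatticeGas} {s : List (ℤ × ℤ)} (x : ℤ)
    {η : LatticeConfig} (h : M.AllowedFrom s η) :
    M.AllowedFrom (shiftMoves x s) (translateConfig x η) := by
  induction s generalizing η with
  | nil => trivial
  | cons p s ih =>
    obtain ⟨y, e⟩ := p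
    obtain ⟨h1, h2, h3⟩ := h
    refine ⟨h1, ?_, ?_⟩
    · have := M.homogeneous y (y + e) x (KCLatticeGas.nbr_add h1) η
      rw [show y + x + e = y + e + x by ring, this]
      exact h2
    · have hx : exchange (y + x) (y + x + e) (translateConfig x η) =
          translateConfig x (exchange y (y + e) η) := by
        funext z
        simp only [exchange, translateConfig]
        have := swap_add_right y (y + e) x (z - x)
        rw [sub_add_cancel] at this
        rw [show y + x + e = y + e + x by ring, this, add_sub_cancel_right]
      have := ih h3
      rw [← hx] at this
      exact this

theorem translateConfig_neg (x : ℤ) (η : LatticeConfig) :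
    translateConfig x (translateConfig (-x) η) = η := by
  funext z; simp [translateConfig]

/-- Exchanges preserve the order of configurations and the rates decrease in it. In particular, a
sequence allowed with occupied boundary conditions in a small box remains allowed in a larger one.
-/
theorem KCLatticeGas.AllowedFrom.anti {M : KCLatticeGas} {s : List (ℤ × ℤ)}
    {η η' : LatticeConfig} (hle : η' ≤ η) (h : M.AllowedFrom s η) : M.AllowedFrom s η' := by
  induction s generalizing η η' with
  | nil => trivial
  | cons p s ih =>
    obtain ⟨y, e⟩ := p
    obtain ⟨h1, h2, h3⟩ := h
    exact ⟨h1, h2.trans (M.rate_antitone _ _ (KCLatticeGas.nbr_add h1) hle),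
      ih (fun z => hle _) h3⟩

/-! ### Moves of a cluster, chosen equivariantly under translations -/

/-- Translation and exchange moves of the cluster `A` in direction `e`, at every position. -/
structure MoveSystem (M : KCLatticeGas) (A : Finset ℤ) (l : ℕ) (e : ℤ) where
  /-- The translation move at the origin. -/
  sT : List (ℤ × ℤ)
  /-- The exchange move at the origin. -/
  sX : List (ℤ × ℤ)
  isUnit : e = 1 ∨ e = -1
  trans : ∀ x, M.IsTranslationMove A l e x (shiftMoves x sT)
  exch : ∀ x, M.IsExchangeMove A l e x (shiftMoves x sX)
  abs_mem_lt : ∀ y ∈ A, |y| < (l : ℤ)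

theorem mem_shiftMoves {x : ℤ} {s : List (ℤ × ℤ)} {p : ℤ × ℤ} (hp : p ∈ shiftMoves x s) :
    ∃ p' ∈ s, p = (p'.1 + x, p'.2) := by
  obtain ⟨p', h, rfl⟩ := List.mem_map.1 hp
  exact ⟨p', h, rfl⟩

/-- Moves are chosen only at the origin and shifted by homogeneity. Having one list for all
positions is what later limits how often each edge is used. -/
theorem KCLatticeGas.IsMobileCluster.exists_moveSystem {M : KCLatticeGas} {A : Finset ℤ}
    (h : M.IsMobileCluster A) :
    ∃ l : ℕ, 0 < l ∧ ∀ e : ℤ, e = 1 ∨ e = -1 → Nonempty (MoveSystem M A l e) := by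
  obtain ⟨l, hl, h⟩ := h
  have hallow : ∀ (s : List (ℤ × ℤ)) (x : ℤ),
      (∀ η : LatticeConfig, (∀ y ∈ A, η (0 + y) = false) → M.AllowedFrom s η) →
      ∀ η : LatticeConfig, (∀ y ∈ A, η (x + y) = false) → M.AllowedFrom (shiftMoves x s) η := by
    intro s x hs η hη
    rw [← translateConfig_neg x η]
    refine (hs _ fun y hy => ?_).shiftMoves x
    rw [← hη y hy, translateConfig]
    congr 1; ring
  -- The translation displaces `y`, so `y` lies in its support `[-l, l]`, which it preserves. The
  -- two directions together give the strict bound on `|y|`.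
  have hsupp : ∀ e, e = 1 ∨ e = -1 → ∀ y ∈ A, y + e ∈ Set.Icc (-(l : ℤ)) l := by
    intro e he y hy
    obtain ⟨⟨s, hs1, hs2, hs3⟩, -⟩ := h e he 0
    have hσ : SupportedIn (Set.Icc (0 - (l : ℤ)) (0 + l)) (assocPerm s) :=
      assocPerm_supportedIn hs3
    have h1 := hs2 y hy
    have h2 : (0 + y : ℤ) ∈ Set.Icc (0 - (l : ℤ)) (0 + l) := by
      by_contra hcon
      have := hσ _ hcon
      rcases he with rfl | rfl <;> omega
    have h3 := hσ.apply_mem h2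
    rw [h1] at h3
    simpa using h3
  refine ⟨l, hl, fun e he => ?_⟩
  obtain ⟨⟨s, hs1, hs2, hs3⟩, s', hs1', hs2', hs3'⟩ := h e he 0
  refine ⟨⟨s, s', he, fun x => ⟨hallow s x hs1, ?_, ?_⟩, fun x => ⟨hallow s' x hs1', ?_, ?_⟩, ?_⟩⟩
  · intro y hy
    have := assocPerm_shiftMoves x s y
    have h2 := hs2 y hy
    rw [zero_add] at h2
    rw [add_comm x y, this, h2]; ring
  · intro p hp
    obtain ⟨p', hp', rfl⟩ := mem_shiftMoves hp
    have := hs3 p' hp'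
    simp only [Set.mem_Icc] at this ⊢
    omega
  · ext z
    have := assocPerm_shiftMoves x s' (z - x)
    rw [sub_add_cancel] at this
    rw [this, hs2', ← swap_add_right]
    congr 2 <;> ring_nf
  · intro p hp
    obtain ⟨p', hp', rfl⟩ := mem_shiftMoves hp
    have := hs3' p' hp'
    simp only [Set.mem_Icc, Set.mem_union, Set.mem_singleton_iff] at this ⊢
    generalize (l + 1 : ℤ) * e = c at *
    omega
  · intro y hy
    have h1 := hsupp 1 (Or.inl rfl) y hy
    have h2 := hsupp (-1) (Or.inr rfl) y hy
    simp only [Set.mem_Icc] at h1 h2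
    rw [abs_lt]; omega


/-! ### Walks of a cluster -/

/-- For distinct sites (a c) = (a b)(b c)(a b). None of the three sites belongs to the cluster, so
it stays in place throughout. -/
theorem disp_swap_triangle {L : ℕ} {f : BoxConfig L → ℝ} {A : Finset ℤ} {x a b c : ℤ}
    (ha : a ∈ Set.Icc 1 (L : ℤ)) (hb : b ∈ Set.Icc 1 (L : ℤ)) (hc : c ∈ Set.Icc 1 (L : ℤ))
    (haA : ∀ y ∈ A, x + y ≠ a) (hbA : ∀ y ∈ A, x + y ≠ b) (hcA : ∀ y ∈ A, x + y ≠ c) :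
    disp f (clusterConfigs L A x) (Equiv.swap a c) ≤
      2 * disp f (clusterConfigs L A x) (Equiv.swap a b) +
        disp f (clusterConfigs L A x) (Equiv.swap b c) := by
  have hab : SupportedIn (Set.Icc 1 (L : ℤ)) (Equiv.swap a b) := SupportedIn.swap ha hb
  have hbc : SupportedIn (Set.Icc 1 (L : ℤ)) (Equiv.swap b c) := SupportedIn.swap hb hc
  have n1 : 0 ≤ disp f (clusterConfigs L A x) (Equiv.swap a b) := disp_nonneg
  have n2 : 0 ≤ disp f (clusterConfigs L A x) (Equiv.swap b c) := disp_nonneg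
  by_cases h1 : a = b
  · subst h1; linarith
  by_cases h2 : b = c
  · subst h2; linarith
  by_cases h3 : a = c
  · subst h3
    rw [Equiv.swap_self, show (Equiv.refl ℤ) = 1 from rfl, disp_one]
    linarith
  have e : Equiv.swap a c = Equiv.swap a b * (Equiv.swap b c * Equiv.swap a b) := by
    have := Equiv.swap_apply_apply (Equiv.swap a b) b c
    rw [Equiv.swap_apply_right, Equiv.swap_apply_of_ne_of_ne (Ne.symm h3) (Ne.symm h2),
      Equiv.swap_inv] at this
    rw [this, mul_assoc]
  have m1 : ∀ η ∈ clusterConfigs L A x, permute (Equiv.swap a b) η ∈ clusterConfigs L A x :=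
    fun η hη => permute_mem_clusterConfigs hab
      (fun y hy => Equiv.swap_apply_of_ne_of_ne (haA y hy) (hbA y hy)) hη
  have m2 : ∀ η ∈ clusterConfigs L A x,
      permute (Equiv.swap b c * Equiv.swap a b) η ∈ clusterConfigs L A x := by
    refine fun η hη => permute_mem_clusterConfigs (hbc.mul hab) (fun y hy => ?_) hη
    rw [Equiv.Perm.mul_apply, Equiv.swap_apply_of_ne_of_ne (haA y hy) (hbA y hy),
      Equiv.swap_apply_of_ne_of_ne (hbA y hy) (hcA y hy)]
  rw [e]
  have h4 := disp_mul_le_of_mapsTo (f := f) (σ := Equiv.swap a b) (hbc.mul hab) m2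
  have h5 := disp_mul_le_of_mapsTo (f := f) (σ := Equiv.swap b c) hab m1
  linarith

namespace MoveSystem

variable {M : KCLatticeGas} {A : Finset ℤ} {l : ℕ} {e : ℤ} (w : MoveSystem M A l e)
  {L : ℕ} (f : BoxConfig L → ℝ)

/-- The cost of the translation and the exchange at position `y`. -/
noncomputable def cost (y : ℤ) : ℝ :=
  M.movesNorm f (shiftMoves y w.sT) + M.movesNorm f (shiftMoves y w.sX)

/-- The number of elementary exchanges in both moves. -/
def size : ℕ := w.sT.length + w.sX.length

/-- The permutation of the translation move at `y`. -/
def perm (y : ℤ) : Equiv.Perm ℤ := assocPerm (shiftMoves y w.sT)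

include w in
-- Each entry of the two lists visits pairwise distinct edges as the position varies, so it
-- contributes at most one total norm. The bound is uniform in the length `n` of the walk.
theorem sum_cost_le (x : ℤ) (n : ℕ) :
    ∑ t ∈ Finset.range n, w.cost f (x + e * t) ≤ w.size * M.totalNorm f := by
  have key : ∀ s : List (ℤ × ℤ), ∑ t ∈ Finset.range n, M.movesNorm f (shiftMoves (x + e * t) s) ≤
      s.length * M.totalNorm f := by
    intro s
    induction s with
    | nil => simp [KCLatticeGas.movesNorm, shiftMoves]
    | cons p s ih =>
      have h := M.sum_edgeNorm_le f n (fun t => p.1 + (x + e * t)) (fun a b hab => by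
        rcases w.isUnit with h | h <;> subst h <;> simpa using hab) p.2
      simp only [KCLatticeGas.movesNorm, shiftMoves, List.map_cons, List.sum_cons,
        List.length_cons, Finset.sum_add_distrib] at ih ⊢
      push_cast
      linarith
  simp only [cost, size, Finset.sum_add_distrib]
  push_cast
  linarith [key w.sT, key w.sX]

theorem cost_nonneg (y : ℤ) : 0 ≤ w.cost f y :=
  add_nonneg (M.movesNorm_nonneg f _) (M.movesNorm_nonneg f _)

theorem perm_supportedIn (y : ℤ) : SupportedIn (Set.Icc (y - l) (y + l)) (w.perm y) :=
  assocPerm_supportedIn (w.trans y).2.2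

theorem perm_apply (y : ℤ) {a : ℤ} (ha : a ∈ A) : w.perm y (y + a) = y + e + a := by
  rw [perm, (w.trans y).2.1 a ha]; ring

theorem allowed_of_mem {y : ℤ} {s : List (ℤ × ℤ)}
    (h : ∀ η : LatticeConfig, (∀ a ∈ A, η (y + a) = false) → M.AllowedFrom s η) :
    ∀ η ∈ clusterConfigs L A y, M.AllowedFrom s (extendOccupied η) :=
  fun _ hη => h _ (mem_clusterConfigs.1 hη)

variable {y : ℤ} (hy : 1 ≤ y - l) (hy' : y + l ≤ L)

include hy hy'

theorem perm_supportedIn_box : SupportedIn (Set.Icc 1 (L : ℤ)) (w.perm y) :=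
  (w.perm_supportedIn y).mono (Set.Icc_subset_Icc hy hy')

theorem permute_perm_mem {η : BoxConfig L} (hη : η ∈ clusterConfigs L A y) :
    permute (w.perm y) η ∈ clusterConfigs L A (y + e) :=
  permute_mem_clusterConfigs (w.perm_supportedIn_box hy hy') (fun _ ha => w.perm_apply y ha) hη

theorem disp_perm_le : disp f (clusterConfigs L A y) (w.perm y) ≤ w.cost f y := by
  refine (M.disp_assocPerm_le f _ (fun p hp => ?_) _ (allowed_of_mem (w.trans y).1)).trans
    (le_add_of_nonneg_right (M.movesNorm_nonneg f _))
  have := (w.trans y).2.2 p hp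
  exact ⟨Set.Icc_subset_Icc hy hy' this.1, Set.Icc_subset_Icc hy hy' this.2⟩

theorem disp_swap_adjacent_le (hv : y + e * (l + 1) ∈ Set.Icc 1 (L : ℤ)) :
    disp f (clusterConfigs L A y) (Equiv.swap (y + e * l) (y + e * (l + 1))) ≤ w.cost f y := by
  have h := w.exch y
  have e1 : Equiv.swap (y + e * l) (y + e * (l + 1)) = assocPerm (shiftMoves y w.sX) := by
    rw [h.2.1]; congr 1 <;> ring
  rw [e1]
  refine (M.disp_assocPerm_le f _ (fun p hp => ?_) _ (allowed_of_mem h.1)).trans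
    (le_add_of_nonneg_left (M.movesNorm_nonneg f _))
  have h2 := h.2.2 p hp
  have h3 : Set.Icc (y - (l : ℤ)) (y + l) ∪ {y + (l + 1) * e} ⊆ Set.Icc 1 (L : ℤ) := by
    refine Set.union_subset (Set.Icc_subset_Icc hy hy') ?_
    rw [Set.singleton_subset_iff, mul_comm]
    exact hv
  exact ⟨h3 h2.1, h3 h2.2⟩

omit hy hy' in
include w in
theorem permute_mem_of_beyond {ρ : Equiv.Perm ℤ} (hρ : SupportedIn (Set.Icc 1 (L : ℤ)) ρ)
    (hρ' : SupportedIn {z | (l : ℤ) ≤ e * (z - y)} ρ) {η : BoxConfig L}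
    (hη : η ∈ clusterConfigs L A y) : permute ρ η ∈ clusterConfigs L A y := by
  refine permute_mem_clusterConfigs hρ (fun a ha => hρ' _ ?_) hη
  have := abs_lt.1 (w.abs_mem_lt a ha)
  rcases w.isUnit with rfl | rfl <;> simp only [Set.mem_ofPred_eq] <;> omega

/-- A rearrangement supported beyond the range of the translation commutes with it. The cluster may
therefore step closer, rearrange, and step back. -/
theorem disp_le_of_beyond {ρ : Equiv.Perm ℤ} (hρ : SupportedIn (Set.Icc 1 (L : ℤ)) ρ)
    (hρ' : SupportedIn {z | (l : ℤ) < e * (z - y)} ρ) :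
    disp f (clusterConfigs L A y) ρ ≤
      2 * w.cost f y + disp f (clusterConfigs L A (y + e)) ρ := by
  have hc : w.perm y * ρ = ρ * w.perm y := by
    refine (w.perm_supportedIn y).mul_comm hρ' (Set.disjoint_left.2 fun z hz hz' => ?_)
    simp only [Set.mem_Icc, Set.mem_ofPred_eq] at hz hz'
    rcases w.isUnit with rfl | rfl <;> omega
  have := disp_le_of_semiconj (f := f) (w.perm_supportedIn_box hy hy') hρ
    (fun η hη => w.permute_perm_mem hy hy' hη)
    (fun η hη => w.permute_mem_of_beyond hρ (hρ'.mono fun z hz => by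
      simp only [Set.mem_ofPred_eq] at hz ⊢; exact hz.le) hη) hc
  have := w.disp_perm_le f hy hy'
  linarith

omit hy hy' in
theorem disp_walk_le {ρ : Equiv.Perm ℤ} (hρ : SupportedIn (Set.Icc 1 (L : ℤ)) ρ) (n : ℕ) (y : ℤ)
    (hy : ∀ t < n, 1 ≤ y + e * (t : ℕ) - l ∧ y + e * (t : ℕ) + l ≤ L)
    (hρ' : SupportedIn {z | (l : ℤ) + n ≤ e * (z - y)} ρ) :
    disp f (clusterConfigs L A y) ρ ≤ 2 * ∑ t ∈ Finset.range n, w.cost f (y + e * t) +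
      disp f (clusterConfigs L A (y + e * n)) ρ := by
  induction n with
  | zero => simp
  | succ n ih =>
    have h1 := ih (fun t ht => hy t (by omega)) (hρ'.mono fun z hz => by
      simp only [Set.mem_ofPred_eq] at hz ⊢; push_cast at hz; linarith)
    have h2 := hy n (by omega)
    have h3 := w.disp_le_of_beyond f h2.1 h2.2 hρ (hρ'.mono fun z hz => by
      have he : e * e = 1 := by rcases w.isUnit with rfl | rfl <;> rfl
      simp only [Set.mem_ofPred_eq] at hz ⊢; push_cast at hz
      have : e * (z - (y + e * n)) = e * (z - y) - n := by linear_combination (-(n : ℤ)) * he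
      rw [this]; linarith)
    rw [Finset.sum_range_succ]
    have h4 : y + e * ((n + 1 : ℕ) : ℤ) = y + e * n + e := by push_cast; ring
    rw [h4]
    linarith

omit hy hy' in
-- Induction on `j`, with the cluster advancing one site at a time. Each position pays 2 for
-- stepping forward and back, and 2 more if an adjacent exchange is performed there and undone.
theorem disp_swap_le_sum (hy : 1 ≤ y - l) (hy' : y + l ≤ L) (i j : ℕ) (hij : i < j)
    (hv : y + e * (l + j) ∈ Set.Icc 1 (L : ℤ)) :
    disp f (clusterConfigs L A y) (Equiv.swap (y + e * (l + i)) (y + e * (l + j))) ≤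
      4 * ∑ t ∈ Finset.range j, w.cost f (y + e * t) := by
  have he : e * e = 1 := by rcases w.isUnit with rfl | rfl <;> rfl
  induction j generalizing i y with
  | zero => omega
  | succ j ih =>
    have hbetween : ∀ k : ℕ, k ≤ j + 1 → y + e * (l + k) ∈ Set.Icc 1 (L : ℤ) := by
      intro k hk
      simp only [Set.mem_Icc] at hv ⊢
      push_cast at hv
      rcases w.isUnit with rfl | rfl <;> omega
    have hsum : ∑ t ∈ Finset.range (j + 1), w.cost f (y + e * t) =
        w.cost f y + ∑ t ∈ Finset.range j, w.cost f (y + e + e * t) := by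
      rw [Finset.sum_range_succ', add_comm]
      congr 1
      · simp
      · refine Finset.sum_congr rfl fun t _ => ?_
        congr 1; push_cast; ring
    have h0 := w.cost_nonneg f y
    have hnn : 0 ≤ ∑ t ∈ Finset.range j, w.cost f (y + e + e * t) :=
      Finset.sum_nonneg fun _ _ => w.cost_nonneg f _
    have hnext : 1 ≤ y + e - l ∧ y + e + l ≤ L := by
      have := hbetween 1 (by omega)
      simp only [Set.mem_Icc] at this
      rcases w.isUnit with rfl | rfl <;> omega
    have hv' : ∀ k : ℕ, y + e * (l + (k + 1 : ℕ)) = y + e + e * (l + k) := fun k => by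
      push_cast; ring
    have hstep : ∀ i' : ℕ, i' < j →
        disp f (clusterConfigs L A y)
          (Equiv.swap (y + e * (l + (i' + 1 : ℕ))) (y + e * (l + (j + 1 : ℕ)))) ≤
        2 * w.cost f y + 4 * ∑ t ∈ Finset.range j, w.cost f (y + e + e * t) := by
      intro i' hi'
      have h1 := ih hnext.1 hnext.2 i' hi' (by rw [← hv']; exact hv)
      rw [← hv', ← hv'] at h1
      have h2 := w.disp_le_of_beyond f hy hy'
        (ρ := Equiv.swap (y + e * (l + (i' + 1 : ℕ))) (y + e * (l + (j + 1 : ℕ))))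
        (SupportedIn.swap (hbetween _ (by omega)) hv) (by
          have : ∀ k : ℕ, e * (y + e * (l + (k + 1 : ℕ)) - y) = l + k + 1 := fun k => by
            push_cast; linear_combination ((l : ℤ) + k + 1) * he
          refine SupportedIn.swap ?_ ?_ <;> simp only [Set.mem_ofPred_eq, this] <;> omega)
      linarith
    rw [hsum]
    -- For `i = 0` the nearer site is within reach of the exchange move, which carries its content
    -- one site ahead. For positive `i` the cluster only has to step.
    rcases i with _ | i
    · have hadj := w.disp_swap_adjacent_le f hy hy' (by simpa using hbetween 1 (by omega))
      rcases j with _ | j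
      · simp only [Nat.cast_zero, add_zero, zero_add, Nat.cast_one]
        simp only [Finset.range_zero, Finset.sum_empty, add_zero]
        linarith
      · have h1 := hstep 0 (by omega)
        have hne : ∀ k : ℕ, ∀ a ∈ A, y + a ≠ y + e * (l + k) := by
          intro k a ha
          have := abs_lt.1 (w.abs_mem_lt a ha)
          rcases w.isUnit with rfl | rfl <;> omega
        have h2 := disp_swap_triangle (f := f) (hbetween 0 (by omega)) (hbetween 1 (by omega)) hv
          (hne 0) (hne 1) (hne _)
        simp only [Nat.cast_zero, add_zero, zero_add, Nat.cast_one] at h1 h2 ⊢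
        linarith
    · have h1 := hstep i (by omega)
      linarith

/-- Exchanging two sites on the same side of the cluster has a cost of order one total norm. -/
theorem disp_swap_same_side_le {a b : ℤ} (ha : a ∈ Set.Icc 1 (L : ℤ)) (hb : b ∈ Set.Icc 1 (L : ℤ))
    (ha' : (l : ℤ) ≤ e * (a - y)) (hb' : (l : ℤ) ≤ e * (b - y)) :
    disp f (clusterConfigs L A y) (Equiv.swap a b) ≤ 4 * w.size * M.totalNorm f := by
  have he : e * e = 1 := by rcases w.isUnit with rfl | rfl <;> rfl
  have key : ∀ a b : ℤ, b ∈ Set.Icc 1 (L : ℤ) → (l : ℤ) ≤ e * (a - y) →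
      e * (a - y) < e * (b - y) →
      disp f (clusterConfigs L A y) (Equiv.swap a b) ≤ 4 * w.size * M.totalNorm f := by
    intro a b hb ha' hab
    have e1 : a = y + e * (l + (e * (a - y) - l).toNat) := by
      rw [Int.toNat_of_nonneg (by omega)]
      linear_combination (y - a) * he
    have e2 : b = y + e * (l + (e * (b - y) - l).toNat) := by
      rw [Int.toNat_of_nonneg (by omega)]
      linear_combination (y - b) * he
    have h := w.disp_swap_le_sum f hy hy' (e * (a - y) - l).toNat (e * (b - y) - l).toNat
      (by omega) (by rw [← e2]; exact hb)
    rw [← e1, ← e2] at h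
    have := w.sum_cost_le f y (e * (b - y) - l).toNat
    linarith
  rcases lt_trichotomy (e * (a - y)) (e * (b - y)) with h | h | h
  · exact key a b hb ha' h
  · have : a = b := by rcases w.isUnit with rfl | rfl <;> omega
    subst this
    rw [Equiv.swap_self, show (Equiv.refl ℤ) = 1 from rfl, disp_one]
    have := M.totalNorm_nonneg f
    positivity
  · rw [Equiv.swap_comm]
    exact key b a ha hb' h

omit hy hy'

/-- The permutation of `n` successive translations. -/
def walkPerm (y : ℤ) : ℕ → Equiv.Perm ℤ
  | 0 => 1
  | n + 1 => w.perm (y + e * n) * walkPerm y n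

theorem walkPerm_apply (y : ℤ) (n : ℕ) {a : ℤ} (ha : a ∈ A) :
    w.walkPerm y n (y + a) = y + e * n + a := by
  induction n with
  | zero => simp [walkPerm]
  | succ n ih =>
    rw [walkPerm, Equiv.Perm.mul_apply, ih, w.perm_apply _ ha]; push_cast; ring

theorem walkPerm_supportedIn (y : ℤ) (n : ℕ)
    (hy : ∀ t < n, 1 ≤ y + e * (t : ℕ) - l ∧ y + e * (t : ℕ) + l ≤ L) :
    SupportedIn (Set.Icc 1 (L : ℤ) ∩ {z | -(l : ℤ) ≤ e * (z - y)}) (w.walkPerm y n) := by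
  induction n with
  | zero => exact SupportedIn.one
  | succ n ih =>
    have h := hy n (by omega)
    refine SupportedIn.mul ?_ (ih fun t ht => hy t (by omega))
    refine (w.perm_supportedIn _).mono fun z hz => ?_
    simp only [Set.mem_Icc, Set.mem_inter_iff, Set.mem_ofPred_eq] at hz ⊢
    rcases w.isUnit with rfl | rfl <;> omega

theorem disp_walkPerm_le (y : ℤ) (n : ℕ)
    (hy : ∀ t < n, 1 ≤ y + e * (t : ℕ) - l ∧ y + e * (t : ℕ) + l ≤ L) :
    disp f (clusterConfigs L A y) (w.walkPerm y n) ≤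
      ∑ t ∈ Finset.range n, w.cost f (y + e * t) := by
  induction n with
  | zero => simp [walkPerm, disp_one]
  | succ n ih =>
    have h := hy n (by omega)
    have hs := (w.walkPerm_supportedIn y n (fun t ht => hy t (by omega))).mono
      Set.inter_subset_left
    have h1 := disp_mul_le_of_mapsTo (f := f) (σ := w.perm (y + e * n)) hs
      (fun η hη => permute_mem_clusterConfigs hs (fun a ha => w.walkPerm_apply y n ha) hη)
    have h2 := w.disp_perm_le f h.1 h.2
    have h3 := ih fun t ht => hy t (by omega)
    rw [walkPerm, Finset.sum_range_succ]
    linarith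

end MoveSystem

/-- With a cluster `x + A` in the bulk, any two sites away from it can be exchanged at a cost of
order one total norm. -/
theorem disp_swap_le {M : KCLatticeGas} {A : Finset ℤ} {l : ℕ} (hl : 0 < l) (w : MoveSystem M A l 1)
    (w' : MoveSystem M A l (-1)) {L : ℕ} (f : BoxConfig L → ℝ) {x : ℤ} (hx : (l : ℤ) + 2 ≤ x)
    (hx' : x + 3 * l ≤ L) {a b : ℤ} (ha : a ∈ Set.Icc 1 (L : ℤ)) (hb : b ∈ Set.Icc 1 (L : ℤ))
    (ha' : (l : ℤ) ≤ |a - x|) (hb' : (l : ℤ) ≤ |b - x|) :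
    disp f (clusterConfigs L A x) (Equiv.swap a b) ≤
      16 * (w.size + w'.size) * M.totalNorm f := by
  classical
  have hΘ := M.totalNorm_nonneg f
  have hn1 : 0 ≤ (w.size : ℝ) * M.totalNorm f := mul_nonneg (Nat.cast_nonneg _) hΘ
  have hn2 : 0 ≤ (w'.size : ℝ) * M.totalNorm f := mul_nonneg (Nat.cast_nonneg _) hΘ
  have h1 : 1 ≤ x - l := by omega
  have h2 : x + l ≤ L := by omega
  have hsame : ∀ a b : ℤ, a ∈ Set.Icc 1 (L : ℤ) → b ∈ Set.Icc 1 (L : ℤ) →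
      (l : ℤ) ≤ a - x → (l : ℤ) ≤ b - x →
      disp f (clusterConfigs L A x) (Equiv.swap a b) ≤ 4 * w.size * M.totalNorm f :=
    fun a b ha hb ha' hb' => w.disp_swap_same_side_le f h1 h2 ha hb (by omega) (by omega)
  have hsame' : ∀ a b : ℤ, a ∈ Set.Icc 1 (L : ℤ) → b ∈ Set.Icc 1 (L : ℤ) →
      (l : ℤ) ≤ x - a → (l : ℤ) ≤ x - b →
      disp f (clusterConfigs L A x) (Equiv.swap a b) ≤ 4 * w'.size * M.totalNorm f :=
    fun a b ha hb ha' hb' => w'.disp_swap_same_side_le f h1 h2 ha hb (by omega) (by omega)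
  have hfar : ∀ a : ℤ, (l : ℤ) ≤ |a - x| → ∀ y ∈ A, x + y ≠ a := by
    rintro a ha y hy rfl
    have := w.abs_mem_lt y hy
    rw [add_sub_cancel_left] at ha
    omega
  -- a site on the right that a walk of the cluster brings to the left
  have hwalk : ∀ t < 2 * l, 1 ≤ x + 1 * (t : ℕ) - l ∧ x + 1 * (t : ℕ) + l ≤ L := by
    intro t ht; omega
  set W := w.walkPerm x (2 * l) with hW
  have hWs := w.walkPerm_supportedIn (L := L) x (2 * l) hwalk
  have hWb : SupportedIn (Set.Icc 1 (L : ℤ)) W := hWs.mono Set.inter_subset_left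
  obtain ⟨r, hr1, hr2, hr3⟩ : ∃ r : ℤ, r ∈ Set.Icc 1 (L : ℤ) ∧ (l : ℤ) ≤ r - x ∧
      W r ∈ Set.Icc 1 (x + l) := by
    -- Pigeonhole: the preimage under `W` of the first `x + l` sites cannot fit into the first `x +
    -- l - 1` of them.
    have hcard : (Finset.Icc (1 : ℤ) (x + l - 1)).card < (Finset.Icc (1 : ℤ) (x + l)).card := by
      simp only [Int.card_Icc]; omega
    have hnot : ¬ (Finset.Icc (1 : ℤ) (x + l)).image (⇑W⁻¹) ⊆ Finset.Icc (1 : ℤ) (x + l - 1) := by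
      intro h
      have := Finset.card_le_card h
      rw [Finset.card_image_of_injective _ W⁻¹.injective] at this
      omega
    obtain ⟨r, hr, hr'⟩ := Finset.not_subset.1 hnot
    obtain ⟨z, hz, rfl⟩ := Finset.mem_image.1 hr
    rw [Finset.mem_Icc] at hz
    have hrb := hWb.inv.apply_mem (z := z) ⟨hz.1, by omega⟩
    refine ⟨W⁻¹ z, hrb, ?_, ?_⟩
    · simp only [Set.mem_Icc] at hrb
      simp only [Finset.mem_Icc, not_and, not_le] at hr'
      have := hr' hrb.1
      omega
    · rw [Equiv.Perm.inv_def, Equiv.apply_symm_apply]; exact hz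
  -- The site just left of everything the walk can touch, so `W` fixes it. After the walk both `i`
  -- and `W r` lie on the left of the cluster, and conjugation by `W` exchanges `i` with `r`.
  set i : ℤ := x - l - 1 with hi
  have hib : i ∈ Set.Icc 1 (L : ℤ) := by simp only [Set.mem_Icc]; omega
  have hWi : W i = i := hWs i (by simp only [Set.mem_inter_iff, Set.mem_ofPred_eq]; omega)
  have hcross : disp f (clusterConfigs L A x) (Equiv.swap i r) ≤
      2 * (w.size * M.totalNorm f) + 4 * w'.size * M.totalNorm f := by
    have hconj : W * Equiv.swap i r = Equiv.swap i (W r) * W := by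
      have := Equiv.swap_apply_apply W i r
      rw [hWi] at this
      rw [this, inv_mul_cancel_right]
    have hsup : SupportedIn (Set.Icc 1 (L : ℤ)) (Equiv.swap i r) := SupportedIn.swap hib hr1
    have h3 := disp_le_of_semiconj (f := f) hWb hsup
      (fun η hη => permute_mem_clusterConfigs hWb (fun a ha => w.walkPerm_apply x (2 * l) ha) hη)
      (fun η hη => permute_mem_clusterConfigs hsup (fun a ha =>
        Equiv.swap_apply_of_ne_of_ne
          (hfar i (by rw [abs_of_neg] <;> omega) a ha)
          (hfar r (by rw [abs_of_nonneg] <;> omega) a ha)) hη) hconj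
    have h4 := w.disp_walkPerm_le f x (2 * l) hwalk
    have h5 := w.sum_cost_le f x (2 * l)
    have h6 := w'.disp_swap_same_side_le f (y := x + 1 * (2 * l : ℕ)) (a := i) (b := W r)
      (by omega) (by omega) hib (hWb.apply_mem hr1) (by omega) (by
        have := hr3.2; push_cast; omega)
    linarith
  have hright : ∀ b : ℤ, b ∈ Set.Icc 1 (L : ℤ) → (l : ℤ) ≤ b - x →
      disp f (clusterConfigs L A x) (Equiv.swap i b) ≤
        10 * (w.size * M.totalNorm f) + 8 * (w'.size * M.totalNorm f) := by
    intro b hb hb'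
    have h3 := hsame b r hb hr1 hb' hr2
    have h4 := disp_swap_triangle (f := f) (A := A) (x := x) (a := b) (b := r) (c := i) hb hr1 hib
      (hfar b (by rw [abs_of_nonneg] <;> omega)) (hfar r (by rw [abs_of_nonneg] <;> omega))
      (hfar i (by rw [abs_of_neg] <;> omega))
    rw [Equiv.swap_comm r i, Equiv.swap_comm b i] at h4
    linarith
  have hmixed : ∀ a b : ℤ, a ∈ Set.Icc 1 (L : ℤ) → b ∈ Set.Icc 1 (L : ℤ) → (l : ℤ) ≤ x - a →
      (l : ℤ) ≤ b - x →
      disp f (clusterConfigs L A x) (Equiv.swap a b) ≤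
        16 * (w.size + w'.size) * M.totalNorm f := by
    intro a b ha hb ha' hb'
    have h3 := hsame' a i ha hib ha' (by omega)
    have h4 := disp_swap_triangle (f := f) (A := A) (x := x) (a := a) (b := i) (c := b) ha hib hb
      (hfar a (by rw [abs_of_neg] <;> omega))
      (hfar i (by rw [abs_of_neg] <;> omega)) (hfar b (by rw [abs_of_nonneg] <;> omega))
    have h5 := hright b hb hb'
    linarith
  rcases le_abs.1 ha' with h3 | h3 <;> rcases le_abs.1 hb' with h4 | h4
  · have := hsame a b ha hb h3 h4; linarith
  · rw [Equiv.swap_comm]; exact hmixed b a hb ha (by omega) h3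
  · exact hmixed a b ha hb (by omega) h4
  · have := hsame' a b ha hb (by omega) (by omega); linarith


/-! ### Configurations with prescribed vacancies -/

/-- The configurations with `k` vacancies in which all sites of `S` are empty. -/
noncomputable def vacConfigs (L k : ℕ) (S : Finset ℤ) : Finset (BoxConfig L) :=
  Finset.univ.filter fun η => numVacancies η = k ∧ ∀ z ∈ S, extendOccupied η z = false

theorem mem_vacConfigs {L k : ℕ} {S : Finset ℤ} {η : BoxConfig L} :
    η ∈ vacConfigs L k S ↔ numVacancies η = k ∧ ∀ z ∈ S, extendOccupied η z = false := by
  simp [vacConfigs]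

theorem vacConfigs_inter (L k : ℕ) (S T : Finset ℤ) :
    vacConfigs L k S ∩ vacConfigs L k T = vacConfigs L k (S ∪ T) := by
  ext η
  simp only [Finset.mem_inter, mem_vacConfigs, Finset.mem_union]
  constructor
  · rintro ⟨⟨h1, h2⟩, -, h3⟩
    exact ⟨h1, fun z hz => hz.elim (h2 z) (h3 z)⟩
  · rintro ⟨h1, h2⟩
    exact ⟨⟨h1, fun z hz => h2 z (Or.inl hz)⟩, h1, fun z hz => h2 z (Or.inr hz)⟩

/-- Exchangeability: the transposition of `u` and `v` injects one set into the other. -/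
theorem card_vacConfigs_insert_le {L k : ℕ} {S : Finset ℤ} {u v : ℤ} (hu : u ∈ Set.Icc 1 (L : ℤ))
    (hv : v ∈ Set.Icc 1 (L : ℤ)) (hu' : u ∉ S) (hv' : v ∉ S) :
    (vacConfigs L k (insert v S)).card ≤ (vacConfigs L k (insert u S)).card := by
  have hs : SupportedIn (Set.Icc 1 (L : ℤ)) (Equiv.swap u v) := SupportedIn.swap hu hv
  refine Finset.card_le_card_of_injOn (permute (Equiv.swap u v)) ?_
    (permute_injective hs).injOn
  intro η hη
  rw [Finset.mem_coe, mem_vacConfigs] at hη ⊢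
  refine ⟨by rw [numVacancies_permute hs, hη.1], fun z hz => ?_⟩
  rw [extendOccupied_permute hs, Equiv.swap_inv]
  rcases Finset.mem_insert.1 hz with rfl | hzS
  · rw [Equiv.swap_apply_left]; exact hη.2 v (by simp)
  · rw [Equiv.swap_apply_of_ne_of_ne (by rintro rfl; exact hu' hzS) (by rintro rfl; exact hv' hzS)]
    exact hη.2 z (by simp [hzS])

/-- Double counting of configurations with a distinguished vacancy outside `S`. Each configuration
has at least `k - S.card` of these, and by exchangeability every site can be replaced by `u`. -/
theorem mul_card_vacConfigs_le {L k : ℕ} {S : Finset ℤ} {u : ℤ} (hu : u ∈ Set.Icc 1 (L : ℤ))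
    (hu' : u ∉ S) :
    ((k : ℝ) - S.card) * (vacConfigs L k S).card ≤ L * (vacConfigs L k (insert u S)).card := by
  classical
  have h1 : ∀ η ∈ vacConfigs L k S, (k : ℝ) - S.card ≤
      ∑ v ∈ Finset.Icc (1 : ℤ) L \ S, if extendOccupied η v = false then (1 : ℝ) else 0 := by
    intro η hη
    rw [mem_vacConfigs, numVacancies_eq] at hη
    have h2 : (Finset.Icc (1 : ℤ) L).filter (fun z => extendOccupied η z = false) ⊆
        ((Finset.Icc (1 : ℤ) L \ S).filter fun z => extendOccupied η z = false) ∪ S := by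
      intro z hz
      rw [Finset.mem_filter] at hz
      by_cases h : z ∈ S
      · exact Finset.mem_union_right _ h
      · exact Finset.mem_union_left _ (Finset.mem_filter.2 ⟨Finset.mem_sdiff.2 ⟨hz.1, h⟩, hz.2⟩)
    have h3 := (Finset.card_le_card h2).trans (Finset.card_union_le _ _)
    rw [hη.1] at h3
    rw [Finset.sum_boole]
    have : (k : ℝ) ≤ ((Finset.Icc (1 : ℤ) L \ S).filter
      fun z => extendOccupied η z = false).card + S.card := by exact_mod_cast h3
    linarith
  calc ((k : ℝ) - S.card) * (vacConfigs L k S).card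
      = ∑ η ∈ vacConfigs L k S, ((k : ℝ) - S.card) := by
        rw [Finset.sum_const, nsmul_eq_mul, mul_comm]
    _ ≤ ∑ η ∈ vacConfigs L k S, ∑ v ∈ Finset.Icc (1 : ℤ) L \ S,
          if extendOccupied η v = false then (1 : ℝ) else 0 := Finset.sum_le_sum h1
    _ = ∑ v ∈ Finset.Icc (1 : ℤ) L \ S, ((vacConfigs L k (insert v S)).card : ℝ) := by
        rw [Finset.sum_comm]
        refine Finset.sum_congr rfl fun v _ => ?_
        rw [Finset.sum_boole]
        congr 2
        ext η
        simp only [Finset.mem_filter, mem_vacConfigs, Finset.mem_insert, forall_eq_or_imp]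
        tauto
    _ ≤ ∑ v ∈ Finset.Icc (1 : ℤ) L \ S, ((vacConfigs L k (insert u S)).card : ℝ) := by
        refine Finset.sum_le_sum fun v hv => ?_
        rw [Finset.mem_sdiff, Finset.mem_Icc] at hv
        exact_mod_cast card_vacConfigs_insert_le hu hv.1 hu' hv.2
    _ ≤ L * (vacConfigs L k (insert u S)).card := by
        rw [Finset.sum_const, nsmul_eq_mul]
        refine mul_le_mul_of_nonneg_right ?_ (Nat.cast_nonneg _)
        have := Finset.card_le_card (Finset.sdiff_subset (s := Finset.Icc (1 : ℤ) L) (t := S))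
        rw [Int.card_Icc] at this
        exact_mod_cast this.trans (by omega)

/-- Emptying the sites of `T` costs at most a constant factor per site. -/
theorem pow_mul_card_vacConfigs_le {L k : ℕ} {S : Finset ℤ} {κ : ℝ} (hκ : 0 ≤ κ) (T : Finset ℤ)
    (hT : ∀ z ∈ T, z ∈ Set.Icc 1 (L : ℤ)) (hST : Disjoint S T)
    (hκ' : κ * L ≤ k - S.card - T.card) :
    κ ^ T.card * (vacConfigs L k S).card ≤ (vacConfigs L k (S ∪ T)).card := by
  classical
  induction T using Finset.induction_on with
  | empty => simp
  | insert u T hu ih =>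
    rw [Finset.card_insert_of_notMem hu] at hκ' ⊢
    push_cast at hκ'
    rw [Finset.disjoint_insert_right] at hST
    have h1 := ih (fun z hz => hT z (by simp [hz])) hST.2 (by linarith)
    have h2 := mul_card_vacConfigs_le (k := k) (S := S ∪ T) (hT u (by simp))
      (by simp [hST.1, hu])
    have hL : 0 < (L : ℝ) := by
      have := hT u (by simp)
      simp only [Set.mem_Icc] at this
      have : 0 < L := by omega
      exact_mod_cast this
    have h3 : ((S ∪ T).card : ℝ) ≤ S.card + T.card := by exact_mod_cast Finset.card_union_le S T
    have h4 : κ * L * (vacConfigs L k (S ∪ T)).card ≤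
        L * (vacConfigs L k (insert u (S ∪ T))).card :=
      le_trans (mul_le_mul_of_nonneg_right (by linarith) (Nat.cast_nonneg _)) h2
    have h5 : κ * (vacConfigs L k (S ∪ T)).card ≤ (vacConfigs L k (insert u (S ∪ T))).card := by
      refine le_of_mul_le_mul_left ?_ hL
      linarith
    rw [Finset.union_insert, pow_succ]
    calc κ ^ T.card * κ * (vacConfigs L k S).card
        = κ * (κ ^ T.card * (vacConfigs L k S).card) := by ring
      _ ≤ κ * (vacConfigs L k (S ∪ T)).card := mul_le_mul_of_nonneg_left h1 hκ
      _ ≤ _ := h5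

/-! ### Concentration of a function on the configurations with an empty window -/

/-- The window of radius `l` around `x`. -/
noncomputable def window (l : ℕ) (x : ℤ) : Finset ℤ := Finset.Ioo (x - l) (x + l)

/-- Comparison with mean-field exchanges: all pairs of sites away from the window can be exchanged
at a cost of order one total norm. An exchange-invariant function is constant here, because the
window is frozen and the number of vacancies is fixed. -/
theorem exists_const_near {M : KCLatticeGas} {A : Finset ℤ} {l : ℕ} (hl : 0 < l)
    (w : MoveSystem M A l 1) (w' : MoveSystem M A l (-1)) {L k : ℕ} (f : BoxConfig L → ℝ) {x : ℤ}
    (hx : (l : ℤ) + 2 ≤ x) (hx' : x + 3 * l ≤ L) :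
    ∃ c, ∑ η ∈ vacConfigs L k (window l x), (f η - c) ^ 2 ≤
      L * (16 * (w.size + w'.size) * M.totalNorm f) ^ 2 := by
  classical
  set B := 16 * ((w.size : ℝ) + w'.size) * M.totalNorm f with hB
  set Y := vacConfigs L k (window l x) with hY
  let V : Finset (Box L) := Finset.univ.filter fun z => (l : ℤ) ≤ |(z : ℤ) - x|
  have hVmem : ∀ z : Box L, z ∈ V ↔ (l : ℤ) ≤ |(z : ℤ) - x| := fun z => by simp [V]
  have hYexch : ∀ i ∈ V, ∀ j ∈ V, ∀ η ∈ Y, exchange i j η ∈ Y := by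
    intro i hi j hj η hη
    rw [hVmem] at hi hj
    have hs : SupportedIn (Set.Icc 1 (L : ℤ)) (Equiv.swap (i : ℤ) j) :=
      SupportedIn.swap (Finset.mem_Icc.1 i.2) (Finset.mem_Icc.1 j.2)
    rw [hY, mem_vacConfigs] at hη ⊢
    rw [exchange_eq_permute]
    refine ⟨by rw [numVacancies_permute hs, hη.1], fun z hz => ?_⟩
    rw [extendOccupied_permute hs, Equiv.swap_inv, Equiv.swap_apply_of_ne_of_ne]
    · exact hη.2 z hz
    · rintro rfl
      simp only [window, Finset.mem_Ioo] at hz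
      rcases le_abs.1 hi with h | h <;> omega
    · rintro rfl
      simp only [window, Finset.mem_Ioo] at hz
      rcases le_abs.1 hj with h | h <;> omega
  -- Exchanges within `V` preserve `Y`, so the cutoff creates no extra differences.
  let h : BoxConfig L → ℝ := fun η => if η ∈ Y then f η else 0
  obtain ⟨g, hg, hgap⟩ := exists_exchange_invariant_near V h
  have hYA : Y ⊆ clusterConfigs L A x := by
    intro η hη
    rw [hY, mem_vacConfigs] at hη
    rw [mem_clusterConfigs]
    intro y hy
    refine hη.2 _ ?_
    have := abs_lt.1 (w.abs_mem_lt y hy)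
    simp only [window, Finset.mem_Ioo]
    omega
  have hterm : ∀ i ∈ V, ∀ j ∈ V, ∑ η, (h (exchange i j η) - h η) ^ 2 ≤ B ^ 2 := by
    intro i hi j hj
    have h1 : ∑ η, (h (exchange i j η) - h η) ^ 2 =
        ∑ η ∈ Y, (f (permute (Equiv.swap (i : ℤ) j) η) - f η) ^ 2 := by
      rw [← Finset.sum_subset (Finset.subset_univ Y)]
      · refine Finset.sum_congr rfl fun η hη => ?_
        simp only [h, hη, hYexch i hi j hj η hη, if_true]
        rw [exchange_eq_permute]
      · intro η _ hη
        have : exchange i j η ∉ Y := fun hcon => hη (by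
          have := hYexch i hi j hj _ hcon
          rwa [exchange_exchange] at this)
        simp [h, hη, this]
    rw [h1, ← disp_sq]
    have h2 := disp_swap_le hl w w' f hx hx' (Finset.mem_Icc.1 i.2) (Finset.mem_Icc.1 j.2)
      ((hVmem i).1 hi) ((hVmem j).1 hj)
    exact pow_le_pow_left₀ disp_nonneg ((disp_mono hYA).trans h2) 2
  -- Four sites suffice for `V.card - 2` to be at least half of `V.card`.
  have hV4 : 4 ≤ V.card := by
    have hb : ∀ z ∈ ({x - l - 1, x - l, x + l, x + l + 1} : Finset ℤ),
        z ∈ Finset.Icc (1 : ℤ) L := by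
      intro z hz
      simp only [Finset.mem_insert, Finset.mem_singleton] at hz
      rw [Finset.mem_Icc]; omega
    have h4 : ({x - l - 1, x - l, x + l, x + l + 1} : Finset ℤ).card = 4 := by
      rw [Finset.card_insert_of_notMem, Finset.card_insert_of_notMem, Finset.card_insert_of_notMem,
        Finset.card_singleton] <;> simp only [Finset.mem_insert, Finset.mem_singleton] <;> omega
    rw [← h4]
    refine Finset.card_le_card_of_injOn
      (fun z => if hz : z ∈ Finset.Icc (1 : ℤ) L then (⟨z, hz⟩ : Box L)
        else ⟨x, Finset.mem_Icc.2 ⟨by omega, by omega⟩⟩) ?_ ?_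
    · intro z hz
      have hz' := hb z hz
      simp only [hz', dif_pos, Finset.mem_coe, hVmem]
      simp only [Finset.coe_insert, Finset.coe_singleton, Set.mem_insert_iff,
        Set.mem_singleton_iff] at hz
      rw [le_abs]
      omega
    · intro z hz z' hz' hzz
      simp only [hb z hz, hb z' hz', dif_pos, Subtype.mk.injEq] at hzz
      exact hzz
  have hVL : V.card ≤ L := by
    have := Finset.card_le_univ V
    simpa using this
  have hsum : ∑ i ∈ V, ∑ j ∈ V, ∑ η, (h (exchange i j η) - h η) ^ 2 ≤ V.card * (V.card * B ^ 2) := by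
    refine (Finset.sum_le_sum fun i hi => Finset.sum_le_sum fun j hj => hterm i hi j hj).trans ?_
    simp
  have hYg : ∑ η ∈ Y, (f η - g η) ^ 2 ≤ ∑ η, (h η - g η) ^ 2 := by
    refine le_trans (le_of_eq ?_) (Finset.sum_le_sum_of_subset_of_nonneg (Finset.subset_univ Y)
      fun _ _ _ => sq_nonneg _)
    exact Finset.sum_congr rfl fun η hη => by simp [h, hη]
  rcases Y.eq_empty_or_nonempty with hYe | ⟨η₀, hη₀⟩
  · refine ⟨0, ?_⟩
    rw [hYe, Finset.sum_empty]
    positivity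
  refine ⟨g η₀, ?_⟩
  have hconst : ∀ η ∈ Y, g η = g η₀ := by
    intro η hη
    refine eq_of_exchange_invariant V g (fun _ => True) (fun _ _ _ _ _ _ => trivial)
      (fun i hi j hj η _ => hg i hi j hj η) η η₀ trivial ?_ ?_
    · intro z hz
      rw [hVmem, not_le, abs_lt] at hz
      have hz' : (z : ℤ) ∈ window l x := by
        simp only [window, Finset.mem_Ioo]; omega
      rw [hY, mem_vacConfigs] at hη hη₀
      rw [← extendOccupied_coe η, ← extendOccupied_coe η₀, hη.2 _ hz', hη₀.2 _ hz']
    · rw [hY, mem_vacConfigs] at hη hη₀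
      exact hη.1.trans hη₀.1.symm
  have hYg' : ∑ η ∈ Y, (f η - g η₀) ^ 2 = ∑ η ∈ Y, (f η - g η) ^ 2 :=
    Finset.sum_congr rfl fun η hη => by rw [hconst η hη]
  rw [hYg']
  refine hYg.trans ?_
  have hv : (4 : ℝ) ≤ V.card := by exact_mod_cast hV4
  have hvL : (V.card : ℝ) ≤ L := by exact_mod_cast hVL
  have h5 : (2 * (V.card : ℝ)) * ∑ η, (h η - g η) ^ 2 ≤ V.card * (V.card * B ^ 2) := by
    refine le_trans ?_ (hgap.trans hsum)
    refine mul_le_mul_of_nonneg_right (by linarith) (Finset.sum_nonneg fun _ _ => sq_nonneg _)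
  have h6 : 2 * ∑ η, (h η - g η) ^ 2 ≤ V.card * B ^ 2 := by
    refine le_of_mul_le_mul_left ?_ (by linarith : (0 : ℝ) < V.card)
    linarith
  have h7 : (V.card : ℝ) * B ^ 2 ≤ L * B ^ 2 := mul_le_mul_of_nonneg_right hvL (sq_nonneg _)
  have h8 : 0 ≤ ∑ η, (h η - g η) ^ 2 := Finset.sum_nonneg fun _ _ => sq_nonneg _
  linarith

/-- On the intersection `f` is close to both constants, so the constants are close to each other in
proportion to the size of the overlap. -/
theorem card_mul_sq_le_of_overlap {β : Type*} [DecidableEq β] {P Q : Finset β} {f : β → ℝ}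
    {a b E ρ : ℝ} (hP : ∑ η ∈ P, (f η - a) ^ 2 ≤ E) (hQ : ∑ η ∈ Q, (f η - b) ^ 2 ≤ E)
    (hρ : 0 ≤ ρ) (h : (P.card : ℝ) ≤ ρ * (P ∩ Q).card) :
    (P.card : ℝ) * (a - b) ^ 2 ≤ 4 * ρ * E := by
  have h1 : ((P ∩ Q).card : ℝ) * (a - b) ^ 2 ≤ 4 * E := by
    have h2 : ∑ η ∈ P ∩ Q, (a - b) ^ 2 ≤
        ∑ η ∈ P ∩ Q, (2 * (f η - a) ^ 2 + 2 * (f η - b) ^ 2) :=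
      Finset.sum_le_sum fun η _ => by nlinarith [sq_nonneg (f η - a + (f η - b))]
    rw [Finset.sum_const, nsmul_eq_mul, Finset.sum_add_distrib, ← Finset.mul_sum,
      ← Finset.mul_sum] at h2
    have h3 : ∑ η ∈ P ∩ Q, (f η - a) ^ 2 ≤ E := le_trans
      (Finset.sum_le_sum_of_subset_of_nonneg Finset.inter_subset_left fun _ _ _ => sq_nonneg _) hP
    have h4 : ∑ η ∈ P ∩ Q, (f η - b) ^ 2 ≤ E := le_trans
      (Finset.sum_le_sum_of_subset_of_nonneg Finset.inter_subset_right fun _ _ _ => sq_nonneg _) hQ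
    linarith
  calc (P.card : ℝ) * (a - b) ^ 2 ≤ ρ * (P ∩ Q).card * (a - b) ^ 2 :=
        mul_le_mul_of_nonneg_right h (sq_nonneg _)
    _ = ρ * ((P ∩ Q).card * (a - b) ^ 2) := by ring
    _ ≤ ρ * (4 * E) := mul_le_mul_of_nonneg_left h1 hρ
    _ = _ := by ring

/-- The constant of `exists_const_near` can be chosen independently of the position. -/
theorem exists_uniform_const_near {M : KCLatticeGas} {A : Finset ℤ} {l : ℕ} (hl : 0 < l)
    (w : MoveSystem M A l 1) (w' : MoveSystem M A l (-1)) {L k : ℕ} (f : BoxConfig L → ℝ)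
    {κ : ℝ} (hκ : 0 < κ) (hκ1 : κ ≤ 1) (hL : 8 * l + 2 ≤ L) (hk : κ * L ≤ k - 4 * l) :
    ∃ c, ∀ x : ℤ, (l : ℤ) + 2 ≤ x → x + 3 * l ≤ L →
      ∑ η ∈ vacConfigs L k (window l x), (f η - c) ^ 2 ≤
        34 * (κ⁻¹ ^ (2 * l)) ^ 2 * (L * (16 * (w.size + w'.size) * M.totalNorm f) ^ 2) := by
  classical
  set E := L * (16 * ((w.size : ℝ) + w'.size) * M.totalNorm f) ^ 2 with hE
  set ρ := κ⁻¹ ^ (2 * l) with hρdef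
  have hκinv : 1 ≤ κ⁻¹ := (one_le_inv₀ hκ).2 hκ1
  have hρ1 : 1 ≤ ρ := one_le_pow₀ hκinv
  have hE0 : 0 ≤ E := by positivity
  have hcardw : ∀ x : ℤ, (window l x).card ≤ 2 * l := fun x => by
    simp only [window, Int.card_Ioo]; omega
  have hover : ∀ x x' : ℤ, (l : ℤ) + 2 ≤ x' → x' + 3 * l ≤ L → 2 * (l : ℤ) ≤ |x - x'| →
      ((vacConfigs L k (window l x)).card : ℝ) ≤
        ρ * (vacConfigs L k (window l x) ∩ vacConfigs L k (window l x')).card := by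
    intro x x' h1 h2 h3
    have h4 := pow_mul_card_vacConfigs_le (L := L) (k := k) (S := window l x) hκ.le (window l x')
      (fun z hz => by simp only [window, Finset.mem_Ioo, Set.mem_Icc] at hz ⊢; omega)
      (by
        rw [Finset.disjoint_left]
        intro z hz hz'
        simp only [window, Finset.mem_Ioo] at hz hz'
        rcases le_abs.1 h3 with h | h <;> omega)
      (by
        have a1 : ((window l x).card : ℝ) ≤ 2 * l := by exact_mod_cast hcardw x
        have a2 : ((window l x').card : ℝ) ≤ 2 * l := by exact_mod_cast hcardw x'
        linarith)
    rw [vacConfigs_inter]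
    have h5 : ρ * κ ^ (window l x').card ≥ 1 := by
      have : κ ^ (2 * l) ≤ κ ^ (window l x').card := pow_le_pow_of_le_one hκ.le hκ1 (hcardw x')
      calc (1 : ℝ) = ρ * κ ^ (2 * l) := by
            rw [hρdef, ← mul_pow, inv_mul_cancel₀ hκ.ne', one_pow]
        _ ≤ _ := mul_le_mul_of_nonneg_left this (by linarith)
    calc ((vacConfigs L k (window l x)).card : ℝ)
        ≤ ρ * κ ^ (window l x').card * (vacConfigs L k (window l x)).card :=
          le_mul_of_one_le_left (Nat.cast_nonneg _) h5
      _ = ρ * (κ ^ (window l x').card * (vacConfigs L k (window l x)).card) := by ring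
      _ ≤ _ := mul_le_mul_of_nonneg_left h4 (by linarith)
  choose! c hc using fun (x : ℤ) (hx : (l : ℤ) + 2 ≤ x ∧ x + 3 * l ≤ L) =>
    exists_const_near (k := k) hl w w' f hx.1 hx.2
  -- Windows at distance `2 l` are disjoint and hence can be compared directly. Since `x₁` and `x₂`
  -- are `4 l` apart, every `x` is at distance at least `2 l` from one of them, and `x₂` serves as a
  -- relay when `x` is close to `x₁`.
  set x₁ : ℤ := l + 2 with hx1
  set x₂ : ℤ := 5 * l + 2 with hx2
  have v1 : (l : ℤ) + 2 ≤ x₁ ∧ x₁ + 3 * l ≤ L := by omega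
  have v2 : (l : ℤ) + 2 ≤ x₂ ∧ x₂ + 3 * l ≤ L := by omega
  refine ⟨c x₁, fun x hxa hxb => ?_⟩
  have vx : (l : ℤ) + 2 ≤ x ∧ x + 3 * l ≤ L := ⟨hxa, hxb⟩
  have hcx := hc x vx
  have hρE : ρ * E ≤ ρ ^ 2 * E := mul_le_mul_of_nonneg_right (by nlinarith) hE0
  have hEρ : E ≤ ρ ^ 2 * E := le_mul_of_one_le_left hE0 (one_le_pow₀ hρ1)
  have key : ((vacConfigs L k (window l x)).card : ℝ) * (c x - c x₁) ^ 2 ≤ 16 * ρ ^ 2 * E := by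
    by_cases hfar : 2 * (l : ℤ) ≤ |x - x₁|
    · have := card_mul_sq_le_of_overlap hcx (hc x₁ v1) (by linarith) (hover x x₁ v1.1 v1.2 hfar)
      nlinarith
    · have hfar2 : 2 * (l : ℤ) ≤ |x - x₂| := by
        rw [not_le, abs_lt] at hfar
        rw [le_abs]; omega
      have hfar3 : 2 * (l : ℤ) ≤ |x₂ - x₁| := by rw [le_abs]; omega
      have o1 := hover x x₂ v2.1 v2.2 hfar2
      have a1 := card_mul_sq_le_of_overlap hcx (hc x₂ v2) (by linarith) o1
      have a2 := card_mul_sq_le_of_overlap (hc x₂ v2) (hc x₁ v1) (by linarith)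
        (hover x₂ x₁ v1.1 v1.2 hfar3)
      have o2 : ((vacConfigs L k (window l x)).card : ℝ) ≤
          ρ * (vacConfigs L k (window l x₂)).card := by
        refine o1.trans (mul_le_mul_of_nonneg_left ?_ (by linarith))
        exact_mod_cast Finset.card_le_card Finset.inter_subset_right
      have a3 : ((vacConfigs L k (window l x)).card : ℝ) * (c x₂ - c x₁) ^ 2 ≤ ρ * (4 * ρ * E) := by
        calc _ ≤ ρ * (vacConfigs L k (window l x₂)).card * (c x₂ - c x₁) ^ 2 :=
              mul_le_mul_of_nonneg_right o2 (sq_nonneg _)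
          _ = ρ * ((vacConfigs L k (window l x₂)).card * (c x₂ - c x₁) ^ 2) := by ring
          _ ≤ _ := mul_le_mul_of_nonneg_left a2 (by linarith)
      have a4 : (c x - c x₁) ^ 2 ≤ 2 * (c x - c x₂) ^ 2 + 2 * (c x₂ - c x₁) ^ 2 := by
        nlinarith [sq_nonneg ((c x - c x₂) - (c x₂ - c x₁))]
      have a5 := mul_le_mul_of_nonneg_left a4
        (Nat.cast_nonneg (α := ℝ) (vacConfigs L k (window l x)).card)
      nlinarith
  calc ∑ η ∈ vacConfigs L k (window l x), (f η - c x₁) ^ 2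
      ≤ ∑ η ∈ vacConfigs L k (window l x), (2 * (f η - c x) ^ 2 + 2 * (c x - c x₁) ^ 2) :=
        Finset.sum_le_sum fun η _ => by nlinarith [sq_nonneg ((f η - c x) - (c x - c x₁))]
    _ = 2 * ∑ η ∈ vacConfigs L k (window l x), (f η - c x) ^ 2 +
          2 * ((vacConfigs L k (window l x)).card * (c x - c x₁) ^ 2) := by
        rw [Finset.sum_add_distrib, ← Finset.mul_sum, Finset.sum_const, nsmul_eq_mul]; ring
    _ ≤ _ := by linarith

/-- The number of empty windows in the bulk of the box. -/
noncomputable def numWindows {L : ℕ} (l : ℕ) (η : BoxConfig L) : ℕ :=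
  ((Finset.Icc ((l : ℤ) + 2) (L - 3 * l)).filter
    fun x => ∀ z ∈ window l x, extendOccupied η z = false).card

/-- Concentration on the configurations with many empty windows. -/
theorem exists_const_near_of_windows {M : KCLatticeGas} {A : Finset ℤ} {l : ℕ} (hl : 0 < l)
    (w : MoveSystem M A l 1) (w' : MoveSystem M A l (-1)) {L k : ℕ} (f : BoxConfig L → ℝ)
    {κ : ℝ} (hκ : 0 < κ) (hκ1 : κ ≤ 1) (hL : 8 * l + 2 ≤ L) (hk : κ * L ≤ k - 4 * l) :
    ∃ c, ∀ θ : ℕ,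
      θ * ∑ η : BoxConfig L with numVacancies η = k ∧ θ ≤ numWindows l η, (f η - c) ^ 2 ≤
      34 * (κ⁻¹ ^ (2 * l)) ^ 2 * (16 * (w.size + w'.size)) ^ 2 * (L ^ 2 * M.totalNorm f ^ 2) := by
  classical
  obtain ⟨c, hc⟩ := exists_uniform_const_near hl w w' f hκ hκ1 hL hk
  refine ⟨c, fun θ => ?_⟩
  set I := Finset.Icc ((l : ℤ) + 2) (L - 3 * l) with hI
  set E := 34 * (κ⁻¹ ^ (2 * l)) ^ 2 * (L * (16 * (w.size + w'.size) * M.totalNorm f) ^ 2) with hE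
  have hE0 : 0 ≤ E := by positivity
  have h1 : θ * ∑ η : BoxConfig L with numVacancies η = k ∧ θ ≤ numWindows l η, (f η - c) ^ 2 ≤
      ∑ η : BoxConfig L with numVacancies η = k, (numWindows l η : ℝ) * (f η - c) ^ 2 := by
    rw [Finset.mul_sum]
    refine (Finset.sum_le_sum fun η hη => ?_).trans
      (Finset.sum_le_sum_of_subset_of_nonneg
        (fun η hη => Finset.mem_filter.2 ⟨Finset.mem_univ _, (Finset.mem_filter.1 hη).2.1⟩)
        fun _ _ _ => mul_nonneg (Nat.cast_nonneg _) (sq_nonneg _))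
    refine mul_le_mul_of_nonneg_right ?_ (sq_nonneg _)
    exact_mod_cast (Finset.mem_filter.1 hη).2.2
  -- Exchange of sums: a configuration occurs once for each of its empty windows.
  have h2 : ∑ η : BoxConfig L with numVacancies η = k, (numWindows l η : ℝ) * (f η - c) ^ 2 =
      ∑ x ∈ I, ∑ η ∈ vacConfigs L k (window l x), (f η - c) ^ 2 := by
    have : ∀ η : BoxConfig L, (numWindows l η : ℝ) * (f η - c) ^ 2 =
        ∑ x ∈ I, if ∀ z ∈ window l x, extendOccupied η z = false then (f η - c) ^ 2 else 0 := by
      intro η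
      rw [← Finset.sum_filter, Finset.sum_const, nsmul_eq_mul, numWindows]
    simp only [this]
    rw [Finset.sum_comm]
    refine Finset.sum_congr rfl fun x _ => ?_
    rw [← Finset.sum_filter, Finset.filter_filter]
    rfl
  have h3 : ∑ x ∈ I, ∑ η ∈ vacConfigs L k (window l x), (f η - c) ^ 2 ≤ L * E := by
    refine (Finset.sum_le_sum fun x hx => hc x (Finset.mem_Icc.1 hx).1
      (by have := (Finset.mem_Icc.1 hx).2; omega)).trans ?_
    rw [Finset.sum_const, nsmul_eq_mul]
    refine mul_le_mul_of_nonneg_right ?_ hE0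
    have : I.card ≤ L := by rw [hI, Int.card_Icc]; omega
    exact Nat.cast_le.2 this
  calc _ ≤ _ := h1
    _ = _ := h2
    _ ≤ _ := h3
    _ = _ := by rw [hE]; ring


/-! ### An exponential bound for independent trials -/

open Classical in
-- A Chernoff bound with weight 1/2 per success: the sum of the weights over all `G` factorises over
-- the trials. Every trial in `R` has success probability at least `1 / card Γ`, which lowers its
-- factor to at most `exp (-1 / (2 card Γ))`.
theorem card_few_successes_le {Γ : Type*} [Fintype Γ] [Nonempty Γ] {m : ℕ}
    (P : Fin m → Γ → Prop) (R : Finset (Fin m)) (hR : ∀ b ∈ R, ∃ γ, P b γ) (θ : ℕ) :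
    ((Finset.univ.filter fun G : Fin m → Γ =>
      (Finset.univ.filter fun b => P b (G b)).card < θ).card : ℝ) ≤
      Real.exp (θ - R.card / (2 * Fintype.card Γ)) * Fintype.card (Fin m → Γ) := by
  set H : ℝ := (Fintype.card Γ : ℝ) with hH
  have hH1 : 1 ≤ H := by
    rw [hH]; exact_mod_cast Fintype.card_pos
  have hsum : ∑ G : Fin m → Γ, ∏ b, (if P b (G b) then (1 / 2 : ℝ) else 1) =
      ∏ b, ∑ γ, (if P b γ then (1 / 2 : ℝ) else 1) := by
    rw [Finset.prod_univ_sum, Fintype.piFinset_univ]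
  have hfac : ∀ b, ∑ γ, (if P b γ then (1 / 2 : ℝ) else 1) ≤
      H * (if b ∈ R then Real.exp (-(1 / (2 * H))) else 1) := by
    intro b
    split_ifs with hb
    · obtain ⟨γ₀, hγ₀⟩ := hR b hb
      have h1 : ∑ γ, (if P b γ then (1 / 2 : ℝ) else 1) ≤ H - 1 / 2 := by
        have h2 : ∑ γ, (if P b γ then (1 / 2 : ℝ) else 1) ≤
            ∑ γ : Γ, (1 - if γ = γ₀ then (1 / 2 : ℝ) else 0) := by
          refine Finset.sum_le_sum fun γ _ => ?_
          by_cases h : γ = γ₀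
          · subst h; simp only [hγ₀, if_true]; norm_num
          · simp only [h, if_false]; split_ifs <;> norm_num
        refine h2.trans (le_of_eq ?_)
        rw [Finset.sum_sub_distrib]
        simp [hH]
      have h3 := Real.add_one_le_exp (-(1 / (2 * H)))
      have h4 : H * (-(1 / (2 * H)) + 1) = H - 1 / 2 := by field_simp; ring
      calc _ ≤ H - 1 / 2 := h1
        _ = H * (-(1 / (2 * H)) + 1) := h4.symm
        _ ≤ _ := mul_le_mul_of_nonneg_left h3 (by linarith)
    · rw [mul_one]
      calc _ ≤ ∑ γ : Γ, (1 : ℝ) := Finset.sum_le_sum fun γ _ => by split_ifs <;> norm_num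
        _ = H := by simp [hH]
  have hprod : ∏ b, ∑ γ, (if P b γ then (1 / 2 : ℝ) else 1) ≤
      H ^ m * Real.exp (-(R.card / (2 * H))) := by
    refine (Finset.prod_le_prod (fun b _ => Finset.sum_nonneg fun γ _ => by
      split_ifs <;> norm_num) fun b _ => hfac b).trans (le_of_eq ?_)
    rw [Finset.prod_mul_distrib, Finset.prod_const, Finset.card_univ, Fintype.card_fin,
      Finset.prod_ite_mem, Finset.univ_inter, Finset.prod_const, ← Real.exp_nat_mul]
    congr 2; ring
  have hlow : ∀ G ∈ Finset.univ.filter fun G : Fin m → Γ =>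
      (Finset.univ.filter fun b => P b (G b)).card < θ,
      Real.exp (-θ) ≤ ∏ b, (if P b (G b) then (1 / 2 : ℝ) else 1) := by
    intro G hG
    rw [Finset.mem_filter] at hG
    rw [Finset.prod_ite, Finset.prod_const, Finset.prod_const_one, mul_one]
    have h1 : Real.exp (-1) ≤ 1 / 2 := by
      rw [Real.exp_neg, inv_eq_one_div]
      refine one_div_le_one_div_of_le (by norm_num) ?_
      have := Real.add_one_le_exp (1 : ℝ)
      linarith
    calc Real.exp (-θ) = Real.exp (-1) ^ θ := by rw [← Real.exp_nat_mul]; congr 1; ring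
      _ ≤ (1 / 2) ^ θ := pow_le_pow_left₀ (Real.exp_pos _).le h1 _
      _ ≤ _ := pow_le_pow_of_le_one (by norm_num) (by norm_num) hG.2.le
  have hmain := (Finset.card_nsmul_le_sum _ _ _ hlow).trans
    ((Finset.sum_le_sum_of_subset_of_nonneg (Finset.filter_subset _ _) fun G _ _ =>
      Finset.prod_nonneg fun b _ => by split_ifs <;> norm_num).trans (hsum.le.trans hprod))
  rw [nsmul_eq_mul] at hmain
  have hc : (Fintype.card (Fin m → Γ) : ℝ) = H ^ m := by simp [hH]
  rw [hc, sub_eq_add_neg, Real.exp_add]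
  have h5 : Real.exp θ * Real.exp (-θ) = 1 := by rw [← Real.exp_add]; simp
  calc ((Finset.univ.filter fun G : Fin m → Γ =>
      (Finset.univ.filter fun b => P b (G b)).card < θ).card : ℝ)
      = Real.exp θ * (((Finset.univ.filter fun G : Fin m → Γ =>
          (Finset.univ.filter fun b => P b (G b)).card < θ).card : ℝ) * Real.exp (-θ)) := by
        rw [mul_left_comm, h5, mul_one]
    _ ≤ Real.exp θ * (H ^ m * Real.exp (-(R.card / (2 * H)))) :=
        mul_le_mul_of_nonneg_left hmain (Real.exp_pos _).le
    _ = _ := by ring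

/-! ### Rearranging the sites of a block -/

/-- The successive transpositions of the sites `v i` and `v (g i)`, for `i < n`. -/
def blockPerm (v : ℕ → ℤ) (g : ℕ → ℕ) : ℕ → Equiv.Perm ℤ
  | 0 => 1
  | n + 1 => Equiv.swap (v n) (v (g n)) * blockPerm v g n

theorem blockPerm_supportedIn (v : ℕ → ℤ) (g : ℕ → ℕ) {K : ℕ} (n : ℕ) (hn : n ≤ K)
    (hg : ∀ i, g i < K) : SupportedIn {z | ∃ i < K, z = v i} (blockPerm v g n) := by
  induction n with
  | zero => exact SupportedIn.one
  | succ n ih =>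
    exact SupportedIn.mul (SupportedIn.swap ⟨n, by omega, rfl⟩ ⟨g n, hg n, rfl⟩) (ih (by omega))

theorem blockPerm_congr (v : ℕ → ℤ) {g g' : ℕ → ℕ} (n : ℕ) (h : ∀ i < n, g i = g' i) :
    blockPerm v g n = blockPerm v g' n := by
  induction n with
  | zero => rfl
  | succ n ih => rw [blockPerm, blockPerm, ih fun i hi => h i (by omega), h n (by omega)]

/-- If a block has at least `n` vacancies then these can be brought to its first `n` sites. -/
theorem exists_blockPerm_vacant {v : ℕ → ℤ} (hv : Function.Injective v) (c : ℤ → Bool) {K : ℕ}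
    (n : ℕ) (hK : 0 < K)
    (hn : n ≤ ((Finset.range K).filter fun i => c (v i) = false).card) :
    ∃ g : ℕ → ℕ, (∀ i, g i < K) ∧ ∀ i < n, c ((blockPerm v g n)⁻¹ (v i)) = false := by
  induction n with
  | zero => exact ⟨fun _ => 0, fun _ => hK, fun i hi => by omega⟩
  | succ n ih =>
    obtain ⟨g, hg, hgc⟩ := ih (by omega)
    have hnK : n + 1 ≤ K := hn.trans ((Finset.card_filter_le _ _).trans (by simp))
    have hsupp := blockPerm_supportedIn v g n (by omega) hg
    -- The rearrangement keeps the vacancies inside the block. There are at least `n + 1` of them,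
    -- so they cannot all be among its first `n` sites.
    obtain ⟨j, hj, hjK, hjc⟩ : ∃ j, n ≤ j ∧ j < K ∧ c ((blockPerm v g n)⁻¹ (v j)) = false := by
      by_contra! hcon
      have : ((Finset.range K).filter fun i => c (v i) = false).card ≤
          ((Finset.range n).image v).card := by
        refine Finset.card_le_card_of_injOn (fun i => blockPerm v g n (v i)) ?_
          (fun i _ i' _ h => hv ((blockPerm v g n).injective h))
        intro i hi
        rw [Finset.mem_coe, Finset.mem_filter, Finset.mem_range] at hi
        obtain ⟨j, hj, hj'⟩ := hsupp.apply_mem (z := v i) ⟨i, hi.1, rfl⟩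
        rw [Finset.mem_coe, Finset.mem_image]
        refine ⟨j, ?_, hj'.symm⟩
        rw [Finset.mem_range]
        by_contra hjn
        refine hcon j (by omega) hj ?_
        rw [← hj', Equiv.Perm.inv_def, Equiv.symm_apply_apply]
        exact hi.2
      rw [Finset.card_image_of_injective _ hv, Finset.card_range] at this
      omega
    refine ⟨Function.update g n j, ?_, ?_⟩
    · intro i
      by_cases h : i = n
      · subst h; simpa using hjK
      · rw [Function.update_of_ne h]; exact hg i
    · intro i hi
      rw [blockPerm, blockPerm_congr v (g' := g) n
        (fun i hi => Function.update_of_ne (by omega) _ _), Function.update_self, mul_inv_rev,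
        Equiv.Perm.mul_apply, Equiv.swap_inv]
      by_cases h : i = n
      · subst h; rw [Equiv.swap_apply_left]; exact hjc
      · rw [Equiv.swap_apply_of_ne_of_ne (fun h' => h (hv h')) (fun h' => by
          have := hv h'; omega)]
        exact hgc i (by omega)

/-- The sites met one after the other by a cluster of radius `l` that moves from `y` in the
direction `e`. -/
def site (e : ℤ) (l : ℕ) (y : ℤ) (t : ℕ) : ℤ := y + e * (l + t)

/-- The rearrangement of `m` successive blocks of length `K`. -/
def sweepPerm (e : ℤ) (l K n : ℕ) : ℕ → (ℕ → ℕ → ℕ) → ℤ → Equiv.Perm ℤ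
  | 0, _, _ => 1
  | m + 1, gs, y => blockPerm (site e l y) (gs 0) n *
      sweepPerm e l K n m (fun b => gs (b + 1)) (y + e * K)

section sweep

variable {e : ℤ} (he : e = 1 ∨ e = -1) {l K n : ℕ}

include he

theorem site_injective (y : ℤ) : Function.Injective (site e l y) := by
  intro a b h
  simp only [site] at h
  rcases he with rfl | rfl <;> omega

theorem mul_site_sub (y : ℤ) (t : ℕ) : e * (site e l y t - y) = l + t := by
  simp only [site]
  rcases he with rfl | rfl <;> ring

omit he in
theorem site_add (y : ℤ) (s t : ℕ) : site e l (y + e * s) t = site e l y (s + t) := by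
  simp only [site]; push_cast; ring

theorem blockPerm_site_supportedIn (y : ℤ) (g : ℕ → ℕ) (hn : n ≤ K) (hg : ∀ i, g i < K) :
    SupportedIn {z | (l : ℤ) ≤ e * (z - y) ∧ e * (z - y) < l + K}
      (blockPerm (site e l y) g n) := by
  refine (blockPerm_supportedIn _ g n hn hg).mono ?_
  rintro z ⟨i, hi, rfl⟩
  simp only [Set.mem_ofPred_eq, mul_site_sub he]
  omega

theorem sweepPerm_supportedIn (hn : n ≤ K) (m : ℕ) (gs : ℕ → ℕ → ℕ) (hgs : ∀ b i, gs b i < K)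
    (y : ℤ) : SupportedIn {z | (l : ℤ) ≤ e * (z - y) ∧ e * (z - y) < l + m * K}
      (sweepPerm e l K n m gs y) := by
  induction m generalizing gs y with
  | zero => exact SupportedIn.one
  | succ m ih =>
    have hK : (0 : ℤ) ≤ m * K := by positivity
    refine SupportedIn.mul ((blockPerm_site_supportedIn he y _ hn (hgs 0)).mono ?_)
      ((ih (fun b => gs (b + 1)) (fun b i => hgs _ i) (y + e * K)).mono ?_)
    · rintro z hz
      simp only [Set.mem_ofPred_eq] at hz ⊢
      push_cast
      rw [add_mul]
      generalize e * (z - y) = u at *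
      generalize (m : ℤ) * K = u' at *
      omega
    · rintro z hz
      simp only [Set.mem_ofPred_eq] at hz ⊢
      have : e * (z - (y + e * K)) = e * (z - y) - K := by rcases he with rfl | rfl <;> ring
      rw [this] at hz
      push_cast
      rw [add_mul]
      generalize e * (z - y) = u at *
      generalize (m : ℤ) * K = u' at *
      omega

/-- The blocks have disjoint supports, so what happens in block `b` depends on `gs b` only. This
gives the independence of the trials. -/
theorem sweepPerm_inv_apply (hn : n ≤ K) (m : ℕ) (gs : ℕ → ℕ → ℕ) (hgs : ∀ b i, gs b i < K)
    (y : ℤ) (b : ℕ) (hb : b < m) (i : ℕ) (hi : i < K) :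
    (sweepPerm e l K n m gs y)⁻¹ (site e l y (b * K + i)) =
      (blockPerm (site e l (y + e * (b * K : ℕ))) (gs b) n)⁻¹ (site e l y (b * K + i)) := by
  induction m generalizing gs y b with
  | zero => omega
  | succ m ih =>
    have hQ := sweepPerm_supportedIn (l := l) he hn m (fun b => gs (b + 1))
      (fun b i => hgs _ i) (y + e * K)
    have hB := blockPerm_site_supportedIn (l := l) he y (gs 0) hn (hgs 0)
    have hsub : ∀ z, e * (z - (y + e * K)) = e * (z - y) - K := fun z => by
      rcases he with rfl | rfl <;> ring
    rw [sweepPerm, mul_inv_rev, Equiv.Perm.mul_apply]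
    rcases b with _ | b
    · simp only [zero_mul, zero_add, Nat.cast_zero, mul_zero, add_zero]
      refine hQ.inv _ ?_
      have := hB.inv.apply_mem (z := site e l y i) (by
        simp only [Set.mem_ofPred_eq, mul_site_sub he]; omega)
      simp only [Set.mem_ofPred_eq] at this ⊢
      rw [hsub]
      omega
    · rw [hB.inv _ (by
        simp only [Set.mem_ofPred_eq, mul_site_sub he]
        push_cast; rw [add_mul]
        have : (0 : ℤ) ≤ b * K := by positivity
        omega)]
      have h := ih (fun b => gs (b + 1)) (fun b i => hgs _ i) (y + e * K) b (by omega)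
      have e1 : site e l (y + e * K) (b * K + i) = site e l y ((b + 1) * K + i) := by
        rw [site_add]; congr 1; ring
      have e2 : y + e * K + e * (b * K : ℕ) = y + e * ((b + 1) * K : ℕ) := by push_cast; ring
      rw [e1, e2] at h
      exact h

end sweep

namespace MoveSystem

variable {M : KCLatticeGas} {A : Finset ℤ} {l : ℕ} {e : ℤ} (w : MoveSystem M A l e)
  {L : ℕ} (f : BoxConfig L → ℝ)

theorem disp_blockPerm_le {y : ℤ} (hy : 1 ≤ y - l) (hy' : y + l ≤ L) {K : ℕ}
    (hbox : ∀ t < K, site e l y t ∈ Set.Icc 1 (L : ℤ)) (g : ℕ → ℕ) (hg : ∀ i, g i < K) (n : ℕ)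
    (hn : n ≤ K) :
    disp f (clusterConfigs L A y) (blockPerm (site e l y) g n) ≤
      4 * n * ∑ t ∈ Finset.range K, w.cost f (y + e * t) := by
  induction n with
  | zero => simp [blockPerm, disp_one]
  | succ n ih =>
    have hsub : ({z | ∃ i < K, z = site e l y i} : Set ℤ) ⊆ Set.Icc 1 (L : ℤ) := by
      rintro z ⟨i, hi, rfl⟩; exact hbox i hi
    have hs := (blockPerm_supportedIn (site e l y) g n (by omega) hg).mono hsub
    have h1 := disp_mul_le_of_mapsTo (f := f) (σ := Equiv.swap (site e l y n) (site e l y (g n)))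
      hs (fun η hη => w.permute_mem_of_beyond hs
        ((blockPerm_site_supportedIn w.isUnit y g (by omega) hg).mono fun z hz => by
          simp only [Set.mem_ofPred_eq] at hz ⊢; exact hz.1) hη)
    have hmono : ∀ j < K, ∑ t ∈ Finset.range j, w.cost f (y + e * t) ≤
        ∑ t ∈ Finset.range K, w.cost f (y + e * t) := fun j hj =>
      Finset.sum_le_sum_of_subset_of_nonneg (Finset.range_mono hj.le)
        fun _ _ _ => w.cost_nonneg f _
    have h2 : disp f (clusterConfigs L A y) (Equiv.swap (site e l y n) (site e l y (g n))) ≤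
        4 * ∑ t ∈ Finset.range K, w.cost f (y + e * t) := by
      rcases lt_trichotomy n (g n) with h | h | h
      · have := w.disp_swap_le_sum f hy hy' n (g n) h (hbox _ (hg n))
        have := hmono _ (hg n)
        simp only [site]
        linarith
      · rw [← h, Equiv.swap_self, show (Equiv.refl ℤ) = 1 from rfl, disp_one]
        exact mul_nonneg (by norm_num) (Finset.sum_nonneg fun _ _ => w.cost_nonneg f _)
      · have := w.disp_swap_le_sum f hy hy' (g n) n h (hbox _ (by omega))
        have := hmono n (by omega)
        rw [Equiv.swap_comm]
        simp only [site]
        linarith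
    have h3 := ih (by omega)
    rw [blockPerm]
    push_cast
    linarith

/-- The cluster treats the first block with `n` swaps (factor `4 n`) and crosses it to reach the
later blocks, there and back (factor 2). Only the positions within that block are charged, so the
bound does not grow with the number of blocks. -/
theorem disp_sweepPerm_le {y : ℤ} (hy : 1 ≤ y - l) (hy' : y + l ≤ L) {K n : ℕ} (hn : n ≤ K)
    (hK : 0 < K) (m : ℕ) (hbox : ∀ t < m * K, site e l y t ∈ Set.Icc 1 (L : ℤ))
    (gs : ℕ → ℕ → ℕ) (hgs : ∀ b i, gs b i < K) :
    disp f (clusterConfigs L A y) (sweepPerm e l K n m gs y) ≤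
      (4 * n + 2) * ∑ t ∈ Finset.range (m * K), w.cost f (y + e * t) := by
  induction m generalizing gs y with
  | zero => simp [sweepPerm, disp_one]
  | succ m ih =>
    have hbox0 : ∀ t < K, site e l y t ∈ Set.Icc 1 (L : ℤ) := fun t ht =>
      hbox t (by rw [Nat.succ_mul]; omega)
    have hbox1 : ∀ t < m * K, site e l (y + e * K) t ∈ Set.Icc 1 (L : ℤ) := fun t ht => by
      rw [site_add]; exact hbox _ (by rw [Nat.succ_mul]; omega)
    set Q := sweepPerm e l K n m (fun b => gs (b + 1)) (y + e * K) with hQ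
    have hQs := sweepPerm_supportedIn (l := l) w.isUnit hn m (fun b => gs (b + 1))
      (fun b i => hgs _ i) (y + e * K)
    have hsub : ∀ z, e * (z - (y + e * K)) = e * (z - y) - K := fun z => by
      rcases w.isUnit with rfl | rfl <;> ring
    have hQb : SupportedIn (Set.Icc 1 (L : ℤ)) Q := by
      refine hQs.mono fun z hz => ?_
      simp only [Set.mem_ofPred_eq, hsub] at hz
      have h1 := hbox1 (e * (z - y) - K - l).toNat (by zify; rw [Int.toNat_of_nonneg] <;> omega)
      have h2 : site e l (y + e * K) (e * (z - y) - K - l).toNat = z := by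
        simp only [site]
        rw [Int.toNat_of_nonneg (by omega)]
        rcases w.isUnit with rfl | rfl <;> ring
      rwa [h2] at h1
    have hQw : SupportedIn {z | (l : ℤ) + K ≤ e * (z - y)} Q := by
      refine hQs.mono fun z hz => ?_
      simp only [Set.mem_ofPred_eq, hsub] at hz ⊢
      omega
    have hwalk : ∀ t < K, 1 ≤ y + e * (t : ℕ) - l ∧ y + e * (t : ℕ) + l ≤ L := by
      intro t ht
      have := hbox0 t ht
      simp only [site, Set.mem_Icc] at this
      rcases w.isUnit with rfl | rfl <;> omega
    have hsum : ∑ t ∈ Finset.range ((m + 1) * K), w.cost f (y + e * t) =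
        ∑ t ∈ Finset.range K, w.cost f (y + e * t) +
          ∑ t ∈ Finset.range (m * K), w.cost f (y + e * K + e * t) := by
      rw [Nat.succ_mul, Nat.add_comm, Finset.sum_range_add]
      congr 1
      refine Finset.sum_congr rfl fun t _ => ?_
      congr 1; push_cast; ring
    have h1 := disp_mul_le_of_mapsTo (f := f) (σ := blockPerm (site e l y) (gs 0) n) hQb
      (fun η hη => w.permute_mem_of_beyond (y := y) hQb (hQw.mono fun z hz => by
        simp only [Set.mem_ofPred_eq] at hz ⊢; omega) hη)
    have h2 := w.disp_blockPerm_le f hy hy' hbox0 (gs 0) (hgs 0) n hn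
    have h3 := w.disp_walk_le f hQb K y hwalk hQw
    have h4 : disp f (clusterConfigs L A (y + e * K)) Q ≤
        (4 * n + 2) * ∑ t ∈ Finset.range (m * K), w.cost f (y + e * K + e * t) := by
      rcases Nat.eq_zero_or_pos m with rfl | hm
      · simp [hQ, sweepPerm, disp_one]
      · have := hbox1 0 (by positivity)
        simp only [site, Set.mem_Icc] at this
        have h0 := hbox0 0 hK
        simp only [site, Set.mem_Icc] at h0
        refine ih ?_ ?_ hbox1 _ (fun b i => hgs _ i)
        · rcases w.isUnit with rfl | rfl <;> omega
        · rcases w.isUnit with rfl | rfl <;> omega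
    rw [sweepPerm, hsum]
    linarith

end MoveSystem


/-! ### Configurations with few empty windows -/

/-- The number of vacancies among the first `N` sites met in the direction `e`. -/
noncomputable def sideVac {L : ℕ} (e : ℤ) (l : ℕ) (y : ℤ) (N : ℕ) (η : BoxConfig L) : ℕ :=
  ((Finset.range N).filter fun t => extendOccupied η (site e l y t) = false).card

/-- Blocks with few marked elements account for few of them. -/
theorem card_filter_range_le (c : ℕ → Bool) (N K n : ℕ) (hK : 0 < K) :
    ((Finset.range N).filter fun t => c t = false).card ≤
      K * (Finset.univ.filter fun b : Fin (N / K) =>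
        n ≤ ((Finset.range K).filter fun i => c (b * K + i) = false).card).card +
      n * (N / K) + K := by
  classical
  set m := N / K with hm
  have hsplit : ∀ m : ℕ, ((Finset.range (m * K)).filter fun t => c t = false).card =
      ∑ b ∈ Finset.range m, ((Finset.range K).filter fun i => c (b * K + i) = false).card := by
    intro m
    induction m with
    | zero => simp
    | succ m ih =>
      rw [Finset.sum_range_succ, ← ih, Nat.succ_mul]
      simp only [Finset.card_filter]
      rw [Finset.sum_range_add]
  have h1 : ((Finset.range N).filter fun t => c t = false).card ≤
      ((Finset.range (m * K)).filter fun t => c t = false).card + K := by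
    have h2 : (Finset.range N).filter (fun t => c t = false) ⊆
        ((Finset.range (m * K)).filter fun t => c t = false) ∪ Finset.Ico (m * K) N := by
      intro t ht
      rw [Finset.mem_filter, Finset.mem_range] at ht
      rw [Finset.mem_union, Finset.mem_filter, Finset.mem_range, Finset.mem_Ico]
      by_cases h : t < m * K
      · exact Or.inl ⟨h, ht.2⟩
      · exact Or.inr ⟨by omega, ht.1⟩
    refine (Finset.card_le_card h2).trans ((Finset.card_union_le _ _).trans ?_)
    rw [Nat.card_Ico]
    have := Nat.lt_div_mul_add (a := N) hK
    rw [← hm] at this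
    omega
  refine h1.trans (Nat.add_le_add_right ?_ K)
  rw [hsplit, ← Fin.sum_univ_eq_sum_range
    (fun b => ((Finset.range K).filter fun i => c (b * K + i) = false).card)]
  have h3 : ∀ b : Fin m, ((Finset.range K).filter fun i => c (b * K + i) = false).card ≤
      K * (if n ≤ ((Finset.range K).filter fun i => c (b * K + i) = false).card then 1 else 0)
        + n := by
    intro b
    split_ifs with h
    · have := Finset.card_filter_le (Finset.range K) fun i => c (b * K + i) = false
      rw [Finset.card_range] at this
      omega
    · omega
  refine (Finset.sum_le_sum fun b _ => h3 b).trans (le_of_eq ?_)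
  rw [Finset.sum_add_distrib, ← Finset.mul_sum, Finset.card_filter, Finset.sum_const,
    Finset.card_univ, Fintype.card_fin, smul_eq_mul, mul_comm m n]

/-- Blocks that start with `n` vacancies produce empty windows. -/
theorem card_good_blocks_le {L : ℕ} {e : ℤ} (he : e = 1 ∨ e = -1) (l : ℕ) (y : ℤ) {l₁ n K m : ℕ}
    (hl₁ : 0 < l₁) (hn : n + 1 = 2 * l₁) (hnK : n ≤ K)
    (hbox : ∀ t < m * K, site e l y t ∈ Set.Icc 1 (L : ℤ)) (ζ : BoxConfig L) :
    (Finset.univ.filter fun b : Fin m =>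
      ∀ i < n, extendOccupied ζ (site e l y (b * K + i)) = false).card ≤
      numWindows l₁ ζ + (4 * l₁ + 1) := by
  classical
  set W := (Finset.Icc ((l₁ : ℤ) + 2) (L - 3 * l₁)).filter
    fun x => ∀ z ∈ window l₁ x, extendOccupied ζ z = false with hW
  -- `numWindows` ignores `l₁ + 1` centres at the left end and `3 * l₁` at the right end.
  have hcard : (W ∪ (Finset.Icc 1 ((l₁ : ℤ) + 1) ∪ Finset.Icc ((L : ℤ) - 3 * l₁ + 1) L)).card ≤
      numWindows l₁ ζ + (4 * l₁ + 1) := by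
    refine (Finset.card_union_le _ _).trans (Nat.add_le_add_left
      ((Finset.card_union_le _ _).trans ?_) _)
    simp only [Int.card_Icc]
    omega
  -- The first `n = 2 * l₁ - 1` sites of a block contain exactly a window of radius `l₁`, centred at
  -- index `l₁ - 1`.
  refine le_trans (Finset.card_le_card_of_injOn
    (fun b : Fin m => site e l y (b * K + (l₁ - 1))) ?_ ?_) hcard
  · intro b hb
    rw [Finset.mem_coe, Finset.mem_filter] at hb
    have hbK : (b : ℕ) * K + K ≤ m * K := by
      have := Nat.mul_le_mul_right K (Nat.succ_le_of_lt b.2)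
      rw [Nat.succ_mul] at this
      exact this
    have hz := hbox (b * K + (l₁ - 1)) (by omega)
    have hempty : ∀ z ∈ window l₁ (site e l y (b * K + (l₁ - 1))), extendOccupied ζ z = false := by
      intro z hz
      simp only [window, Finset.mem_Ioo, site] at hz
      have h1 : ∃ i < n, z = site e l y (b * K + i) := by
        refine ⟨(e * (z - y) - l - (b * K : ℕ)).toNat, ?_, ?_⟩
        · push_cast at hz ⊢
          generalize ((b : ℕ) : ℤ) * K = u at *
          rcases he with rfl | rfl <;> omega
        · simp only [site]
          have h2 : 0 ≤ e * (z - y) - l - (b * K : ℕ) := by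
            push_cast at hz ⊢
            generalize ((b : ℕ) : ℤ) * K = u at *
            rcases he with rfl | rfl <;> omega
          rw [Nat.cast_add, Int.toNat_of_nonneg h2]
          rcases he with rfl | rfl <;> ring
      obtain ⟨i, hi, rfl⟩ := h1
      exact hb.2 i hi
    rw [Finset.mem_coe, Finset.mem_union, Finset.mem_union, hW, Finset.mem_filter, Finset.mem_Icc,
      Finset.mem_Icc, Finset.mem_Icc]
    rw [Set.mem_Icc] at hz
    by_cases h1 : site e l y (b * K + (l₁ - 1)) ≤ l₁ + 1
    · exact Or.inr (Or.inl ⟨hz.1, h1⟩)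
    by_cases h2 : (L : ℤ) - 3 * l₁ + 1 ≤ site e l y (b * K + (l₁ - 1))
    · exact Or.inr (Or.inr ⟨h2, hz.2⟩)
    refine Or.inl ⟨⟨?_, ?_⟩, hempty⟩ <;> beta_reduce <;> omega
  · intro b _ b' _ h
    have h1 := site_injective he y h
    have h2 : (b : ℕ) * K = b' * K := by omega
    exact Fin.ext (Nat.eq_of_mul_eq_mul_right (by omega) h2)

theorem sideVac_permute {L : ℕ} {e : ℤ} {l : ℕ} {y : ℤ} {N : ℕ} (he : e = 1 ∨ e = -1)
    {σ : Equiv.Perm ℤ} (hσ : SupportedIn (Set.Icc 1 (L : ℤ)) σ)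
    (hσ' : SupportedIn {z | ∃ t < N, z = site e l y t} σ) (η : BoxConfig L) :
    sideVac e l y N (permute σ η) = sideVac e l y N η := by
  classical
  have key : ∀ η : BoxConfig L, sideVac e l y N η = (((Finset.range N).image (site e l y)).filter
      fun z => extendOccupied η z = false).card := by
    intro η
    rw [Finset.filter_image, Finset.card_image_of_injective _ (site_injective he y), sideVac]
  have hmem : ∀ z, z ∈ (Finset.range N).image (site e l y) ↔ ∃ t < N, z = site e l y t := by
    intro z; simp only [Finset.mem_image, Finset.mem_range, eq_comm]
  rw [key, key]
  refine Finset.card_bij (fun z _ => σ⁻¹ z) ?_ (fun _ _ _ _ h => σ⁻¹.injective h) ?_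
  · intro z hz
    rw [Finset.mem_filter, hmem, extendOccupied_permute hσ] at hz
    rw [Finset.mem_filter, hmem]
    exact ⟨hσ'.inv.apply_mem (z := z) hz.1, hz.2⟩
  · intro z hz
    rw [Finset.mem_filter, hmem] at hz
    refine ⟨σ z, ?_, by simp⟩
    rw [Finset.mem_filter, hmem, extendOccupied_permute hσ, Equiv.Perm.inv_def,
      Equiv.symm_apply_apply]
    exact ⟨hσ'.apply_mem (z := z) hz.1, hz.2⟩

/-- Summation of squares over configurations that are unlikely after a random rearrangement. -/
theorem sum_sq_le_of_random_perm {L : ℕ} (f : BoxConfig L → ℝ) {Z S : Finset (BoxConfig L)}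
    {ι : Type*} [Fintype ι] [Nonempty ι] (σ : ι → Equiv.Perm ℤ)
    (hσ : ∀ i, SupportedIn (Set.Icc 1 (L : ℤ)) (σ i)) (hSZ : S ⊆ Z)
    (hZ : ∀ i, ∀ η ∈ Z, permute (σ i)⁻¹ η ∈ Z) {B p : ℝ} (hB : ∀ i, disp f Z (σ i) ≤ B)
    (hp : ∀ ζ : BoxConfig L, ((Finset.univ.filter fun i => permute (σ i) ζ ∈ S).card : ℝ) ≤
      p * Fintype.card ι) :
    ∑ η ∈ S, f η ^ 2 ≤ 2 * B ^ 2 + 2 * p * ∑ η, f η ^ 2 := by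
  classical
  have h1 : ∀ i, ∑ η ∈ S, f η ^ 2 ≤
      2 * B ^ 2 + 2 * ∑ ζ, if permute (σ i) ζ ∈ S then f ζ ^ 2 else 0 := by
    intro i
    have h2 : ∑ η ∈ S, f η ^ 2 ≤ ∑ η ∈ S, (2 * (f (permute (σ i)⁻¹ η) - f η) ^ 2 +
        2 * f (permute (σ i)⁻¹ η) ^ 2) :=
      Finset.sum_le_sum fun η _ => by
        nlinarith [sq_nonneg (2 * f (permute (σ i)⁻¹ η) - f η)]
    rw [Finset.sum_add_distrib, ← Finset.mul_sum, ← Finset.mul_sum] at h2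
    have h3 : ∑ η ∈ S, (f (permute (σ i)⁻¹ η) - f η) ^ 2 ≤ B ^ 2 := by
      rw [← disp_sq]
      refine pow_le_pow_left₀ disp_nonneg ?_ 2
      exact (disp_mono hSZ).trans ((disp_inv_le (hσ i) (hZ i)).trans (hB i))
    have h4 : ∑ η ∈ S, f (permute (σ i)⁻¹ η) ^ 2 =
        ∑ ζ, if permute (σ i) ζ ∈ S then f ζ ^ 2 else 0 := by
      rw [← Finset.sum_filter]
      refine Finset.sum_nbij' (permute (σ i)⁻¹) (permute (σ i)) ?_ ?_ ?_ ?_ ?_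
      · intro η hη
        rw [Finset.mem_filter, permute_permute_inv (hσ i)]
        exact ⟨Finset.mem_univ _, hη⟩
      · intro ζ hζ; exact (Finset.mem_filter.1 hζ).2
      · intro η _; exact permute_permute_inv (hσ i) η
      · intro ζ _; exact permute_inv_permute (hσ i) ζ
      · intro η _; rfl
    linarith
  -- Averaging over the rearrangements: after exchanging the sums, `hp` bounds the number of those
  -- that send a given `ζ` into `S`.
  have h5 := Finset.sum_le_sum fun i (_ : i ∈ (Finset.univ : Finset ι)) => h1 i
  rw [Finset.sum_const, Finset.sum_add_distrib, Finset.sum_const, ← Finset.mul_sum,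
    Finset.sum_comm, nsmul_eq_mul, nsmul_eq_mul, Finset.card_univ] at h5
  have h6 : ∑ ζ : BoxConfig L, ∑ i, (if permute (σ i) ζ ∈ S then f ζ ^ 2 else 0) ≤
      ∑ ζ : BoxConfig L, p * Fintype.card ι * f ζ ^ 2 := by
    refine Finset.sum_le_sum fun ζ _ => ?_
    rw [← Finset.sum_filter, Finset.sum_const, nsmul_eq_mul]
    exact mul_le_mul_of_nonneg_right (hp ζ) (sq_nonneg _)
  rw [← Finset.mul_sum] at h6
  have hc : (0 : ℝ) < Fintype.card ι := by exact_mod_cast Fintype.card_pos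
  refine le_of_mul_le_mul_left ?_ hc
  linarith

/-- Configurations with a cluster and few empty windows carry little mass, if there are enough
vacancies on the side `e` of the cluster. -/
theorem MoveSystem.sum_sq_le {M : KCLatticeGas} {A : Finset ℤ} {l : ℕ} {e : ℤ}
    (w : MoveSystem M A l e) {L : ℕ} (f : BoxConfig L → ℝ) {y : ℤ} (hy : 1 ≤ y - l)
    (hy' : y + l ≤ L) {N : ℕ} (hbox : ∀ t < N, site e l y t ∈ Set.Icc 1 (L : ℤ)) {l₁ n K : ℕ}
    (hl₁ : 0 < l₁) (hn : n + 1 = 2 * l₁) (hnK : n ≤ K) (hK : 0 < K) {θ : ℕ} {r : ℝ}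
    {S : Finset (BoxConfig L)} (hSZ : S ⊆ clusterConfigs L A y)
    (hSθ : ∀ η ∈ S, numWindows l₁ η < θ)
    (hSr : ∀ η ∈ S, K * r + n * (N / K : ℕ) + K ≤ sideVac e l y N η) :
    ∑ η ∈ S, f η ^ 2 ≤ 2 * ((4 * n + 2) * (w.size * M.totalNorm f)) ^ 2 +
      2 * Real.exp (θ + 4 * l₁ + 1 - r / (2 * K ^ n)) * ∑ η, f η ^ 2 := by
  classical
  have he := w.isUnit
  set m := N / K with hm
  have hmN : m * K ≤ N := Nat.div_mul_le_self N K
  have hboxm : ∀ t < m * K, site e l y t ∈ Set.Icc 1 (L : ℤ) := fun t ht => hbox t (by omega)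
  have : NeZero K := ⟨hK.ne'⟩
  -- The padding by 0 is immaterial: only the first `n` values of a choice, and the first `m`
  -- choices, enter the rearrangement.
  let lift : (Fin n → Fin K) → ℕ → ℕ := fun γ i => if h : i < n then (γ ⟨i, h⟩ : ℕ) else 0
  have hlift : ∀ γ i, lift γ i < K := by
    intro γ i
    simp only [lift]
    split_ifs
    · exact (γ _).2
    · exact hK
  let gs : (Fin m → Fin n → Fin K) → ℕ → ℕ → ℕ := fun G b =>
    if h : b < m then lift (G ⟨b, h⟩) else fun _ => 0
  have hgs : ∀ G b i, gs G b i < K := by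
    intro G b i
    simp only [gs]
    split_ifs
    · exact hlift _ _
    · exact hK
  let σ : (Fin m → Fin n → Fin K) → Equiv.Perm ℤ := fun G => sweepPerm e l K n m (gs G) y
  have hσsite : ∀ G, SupportedIn {z | ∃ t < N, z = site e l y t} (σ G) := by
    intro G
    refine (sweepPerm_supportedIn he hnK m (gs G) (hgs G) y).mono fun z hz => ?_
    simp only [Set.mem_ofPred_eq] at hz ⊢
    have h0 : 0 ≤ e * (z - y) - l := by linarith [hz.1]
    refine ⟨(e * (z - y) - l).toNat, ?_, ?_⟩
    · have h1 : (m : ℤ) * K ≤ N := by exact_mod_cast hmN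
      zify
      rw [Int.toNat_of_nonneg h0]
      linarith [hz.2]
    · simp only [site]
      rw [Int.toNat_of_nonneg h0]
      rcases he with rfl | rfl <;> ring
  have hσbox : ∀ G, SupportedIn (Set.Icc 1 (L : ℤ)) (σ G) := fun G =>
    (hσsite G).mono (by rintro z ⟨t, ht, rfl⟩; exact hbox t ht)
  have hσbeyond : ∀ G, SupportedIn {z | (l : ℤ) ≤ e * (z - y)} (σ G) := fun G =>
    (hσsite G).mono (by
      rintro z ⟨t, ht, rfl⟩
      simp only [Set.mem_ofPred_eq, mul_site_sub he]
      omega)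
  refine sum_sq_le_of_random_perm f σ hσbox hSZ
    (fun G η hη => w.permute_mem_of_beyond (hσbox G).inv (hσbeyond G).inv hη) (fun G => ?_) ?_
  · have h1 := w.disp_sweepPerm_le f hy hy' hnK hK m hboxm (gs G) (hgs G)
    have h2 := w.sum_cost_le f y (m * K)
    exact h1.trans (mul_le_mul_of_nonneg_left h2 (by positivity))
  · intro ζ
    -- A single rearrangement leading into `S` shows that `ζ` has enough vacancies on this side,
    -- because their number is preserved.
    rcases (Finset.univ.filter fun G => permute (σ G) ζ ∈ S).eq_empty_or_nonempty with h0 | ⟨G₀, hG₀⟩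
    · rw [h0, Finset.card_empty, Nat.cast_zero]
      positivity
    have hζ : K * r + n * m + K ≤ sideVac e l y N ζ := by
      have := hSr _ (Finset.mem_filter.1 hG₀).2
      rwa [sideVac_permute he (hσbox G₀) (hσsite G₀)] at this
    -- Success in block `b`: the choice `γ` empties its first `n` sites. It is possible for the
    -- blocks of `R`, those with at least `n` vacancies.
    let P : Fin m → (Fin n → Fin K) → Prop := fun b γ => ∀ i < n,
      extendOccupied ζ ((blockPerm (site e l (y + e * ((b : ℕ) * K : ℕ))) (lift γ) n)⁻¹
        (site e l y (b * K + i))) = false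
    let R : Finset (Fin m) := Finset.univ.filter fun b => n ≤ ((Finset.range K).filter fun i =>
      extendOccupied ζ (site e l y (b * K + i)) = false).card
    have hR : ∀ b ∈ R, ∃ γ, P b γ := by
      intro b hb
      have hb' := (Finset.mem_filter.1 hb).2
      simp only [← site_add] at hb'
      obtain ⟨g, hg, hgc⟩ := exists_blockPerm_vacant (site_injective he (y + e * ((b : ℕ) * K : ℕ)))
        (extendOccupied ζ) n hK hb'
      refine ⟨fun i => ⟨g i, hg i⟩, fun i hi => ?_⟩
      rw [← site_add, blockPerm_congr _ (g' := g) n (fun i hi => by simp [lift, hi])]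
      exact hgc i hi
    have hRr : r ≤ R.card := by
      have h1 := card_filter_range_le (fun t => extendOccupied ζ (site e l y t)) N K n hK
      have h2 : (sideVac e l y N ζ : ℝ) ≤ K * R.card + n * m + K := by exact_mod_cast h1
      have hK' : (0 : ℝ) < K := by exact_mod_cast hK
      refine le_of_mul_le_mul_left ?_ hK'
      linarith
    have hbad : ∀ G, permute (σ G) ζ ∈ S →
        (Finset.univ.filter fun b => P b (G b)).card < θ + (4 * l₁ + 1) := by
      intro G hG
      have h1 := card_good_blocks_le he l y hl₁ hn hnK hboxm (permute (σ G) ζ)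
      have h2 := hSθ _ hG
      refine lt_of_le_of_lt ?_ (lt_of_le_of_lt h1 (by omega))
      refine Finset.card_le_card fun b hb => ?_
      rw [Finset.mem_filter] at hb ⊢
      refine ⟨Finset.mem_univ _, fun i hi => ?_⟩
      have h3 := hb.2 i hi
      have h4 := sweepPerm_inv_apply (l := l) he hnK m (gs G) (hgs G) y b b.2 i (by omega)
      rw [extendOccupied_permute (hσbox G), h4]
      simp only [gs, b.2, dif_pos]
      exact h3
    have hcount := card_few_successes_le P R hR (θ + (4 * l₁ + 1))
    have hcard : (Fintype.card (Fin n → Fin K) : ℝ) = (K : ℝ) ^ n := by simp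
    rw [hcard] at hcount
    refine le_trans ?_ (hcount.trans ?_)
    · exact_mod_cast Finset.card_le_card fun G hG => by
        rw [Finset.mem_filter] at hG ⊢
        exact ⟨Finset.mem_univ _, by convert hbad G hG.2⟩
    · refine mul_le_mul_of_nonneg_right (Real.exp_le_exp.2 ?_) (Nat.cast_nonneg _)
      push_cast
      have hKn : (0 : ℝ) < 2 * (K : ℝ) ^ n := by positivity
      have := div_le_div_of_nonneg_right hRr hKn.le
      linarith

/-- Configurations with a cluster and few empty windows carry little mass. -/
theorem sum_sq_le_of_few_windows {M : KCLatticeGas} {A : Finset ℤ} {l : ℕ}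
    (w : MoveSystem M A l 1) (w' : MoveSystem M A l (-1)) {L : ℕ} (f : BoxConfig L → ℝ) {y : ℤ}
    (hy : 1 ≤ y - l) (hy' : y + l ≤ L) {l₁ n K : ℕ} (hl₁ : 0 < l₁) (hn : n + 1 = 2 * l₁)
    (hnK : n ≤ K) (hK : 0 < K) {θ k : ℕ} {r : ℝ}
    (hr : 2 * (K * r + n * (L / K) + K) + 2 * l ≤ k) :
    ∑ η ∈ clusterConfigs L A y with numVacancies η = k ∧ numWindows l₁ η < θ, f η ^ 2 ≤
      2 * ((4 * n + 2) * (w.size * M.totalNorm f)) ^ 2 +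
      2 * ((4 * n + 2) * (w'.size * M.totalNorm f)) ^ 2 +
      4 * Real.exp (θ + 4 * l₁ + 1 - r / (2 * K ^ n)) * ∑ η, f η ^ 2 := by
  classical
  -- The numbers of sites at distance at least `l` to the right and to the left of `y`. Fewer than
  -- `2 * l` sites remain, so one of the two sides has enough vacancies.
  set N₁ := (L - y - l + 1).toNat with hN₁
  set N₂ := (y - l).toNat with hN₂
  set S := (clusterConfigs L A y).filter fun η => numVacancies η = k ∧ numWindows l₁ η < θ with hS
  set v : ℕ → ℝ := fun N => K * r + n * (N / K : ℕ) + K with hv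
  set S₁ := S.filter fun η => v N₁ ≤ sideVac 1 l y N₁ η with hS₁
  set S₂ := S.filter fun η => v N₂ ≤ sideVac (-1) l y N₂ η with hS₂
  have hvL : ∀ N ≤ L, v N ≤ K * r + n * (L / K) + K := by
    intro N hN
    have h1 : ((N / K : ℕ) : ℝ) ≤ (L : ℝ) / K :=
      Nat.cast_div_le.trans (div_le_div_of_nonneg_right (by exact_mod_cast hN) (Nat.cast_nonneg _))
    have := mul_le_mul_of_nonneg_left h1 (Nat.cast_nonneg (α := ℝ) n)
    simp only [hv]
    linarith
  have hcover : S ⊆ S₁ ∪ S₂ := by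
    intro η hη
    by_contra hcon
    have h1 : (sideVac 1 l y N₁ η : ℝ) < v N₁ := by
      by_contra h; exact hcon (Finset.mem_union_left _ (Finset.mem_filter.2 ⟨hη, not_lt.1 h⟩))
    have h2 : (sideVac (-1) l y N₂ η : ℝ) < v N₂ := by
      by_contra h; exact hcon (Finset.mem_union_right _ (Finset.mem_filter.2 ⟨hη, not_lt.1 h⟩))
    have h3 : numVacancies η = k := (Finset.mem_filter.1 hη).2.1
    have h4 : numVacancies η ≤ 2 * l + (sideVac 1 l y N₁ η + sideVac (-1) l y N₂ η) := by
      rw [numVacancies_eq]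
      have hsub : (Finset.Icc (1 : ℤ) L).filter (fun z => extendOccupied η z = false) ⊆
          Finset.Ioo (y - l) (y + l) ∪
          ((((Finset.range N₁).filter fun t => extendOccupied η (site 1 l y t) = false).image
            (site 1 l y)) ∪
          (((Finset.range N₂).filter fun t => extendOccupied η (site (-1) l y t) = false).image
            (site (-1) l y))) := by
        intro z hz
        rw [Finset.mem_filter, Finset.mem_Icc] at hz
        simp only [Finset.mem_union, Finset.mem_Ioo, Finset.mem_image, Finset.mem_filter,
          Finset.mem_range]
        by_cases ha : y + l ≤ z
        · right; left
          have e1 : site 1 l y (z - y - l).toNat = z := by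
            simp only [site]; omega
          exact ⟨(z - y - l).toNat, ⟨by omega, by rw [e1]; exact hz.2⟩, e1⟩
        by_cases hb : z ≤ y - l
        · right; right
          have e1 : site (-1) l y (y - l - z).toNat = z := by
            simp only [site]; omega
          exact ⟨(y - l - z).toNat, ⟨by omega, by rw [e1]; exact hz.2⟩, e1⟩
        · left; omega
      refine (Finset.card_le_card hsub).trans ((Finset.card_union_le _ _).trans
        (Nat.add_le_add ?_ ((Finset.card_union_le _ _).trans
          (Nat.add_le_add Finset.card_image_le Finset.card_image_le))))
      rw [Int.card_Ioo]; omega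
    have h5 : (k : ℝ) ≤ 2 * l + (sideVac 1 l y N₁ η + sideVac (-1) l y N₂ η) := by
      rw [h3] at h4; exact_mod_cast h4
    have := hvL N₁ (by omega)
    have := hvL N₂ (by omega)
    linarith
  have b1 := w.sum_sq_le f hy hy' (N := N₁) (S := S₁) (θ := θ) (r := r)
    (fun t ht => by simp only [site, Set.mem_Icc]; omega) hl₁ hn hnK hK
    (fun η hη => (Finset.mem_filter.1 (Finset.mem_filter.1 hη).1).1)
    (fun η hη => (Finset.mem_filter.1 (Finset.mem_filter.1 hη).1).2.2)
    (fun η hη => (Finset.mem_filter.1 hη).2)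
  have b2 := w'.sum_sq_le f hy hy' (N := N₂) (S := S₂) (θ := θ) (r := r)
    (fun t ht => by simp only [site, Set.mem_Icc]; omega) hl₁ hn hnK hK
    (fun η hη => (Finset.mem_filter.1 (Finset.mem_filter.1 hη).1).1)
    (fun η hη => (Finset.mem_filter.1 (Finset.mem_filter.1 hη).1).2.2)
    (fun η hη => (Finset.mem_filter.1 hη).2)
  have b3 : ∑ η ∈ S, f η ^ 2 ≤ ∑ η ∈ S₁, f η ^ 2 + ∑ η ∈ S₂, f η ^ 2 := by
    refine (Finset.sum_le_sum_of_subset_of_nonneg hcover fun _ _ _ => sq_nonneg _).trans ?_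
    rw [← Finset.sum_union_inter]
    exact le_add_of_nonneg_right (Finset.sum_nonneg fun _ _ => sq_nonneg _)
  linarith


/-! ### Moving a cluster away from the boundary -/

theorem extendOccupied_exchange {L : ℕ} (x y : Box L) (η : BoxConfig L) :
    extendOccupied (exchange x y η) = exchange (x : ℤ) y (extendOccupied η) := by
  funext z
  rw [exchange_eq_permute, extendOccupied_permute (SupportedIn.swap (Finset.mem_Icc.1 x.2)
    (Finset.mem_Icc.1 y.2)), Equiv.swap_inv, exchange]

/-- Reachability is witnessed by a sequence of exchanges. -/
theorem KCLatticeGas.Reaches.exists_moves {M : KCLatticeGas} {L : ℕ} {η η' : BoxConfig L}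
    (h : M.Reaches η η') : ∃ s : List (ℤ × ℤ),
      (∀ p ∈ s, p.1 ∈ Set.Icc 1 (L : ℤ) ∧ p.1 + p.2 ∈ Set.Icc 1 (L : ℤ)) ∧
      M.AllowedFrom s (extendOccupied η) ∧ η' = permute (assocPerm s) η := by
  induction h using Relation.ReflTransGen.head_induction_on with
  | refl => exact ⟨[], by simp, trivial, (permute_one _).symm⟩
  | head hstep _ ih =>
    obtain ⟨x, y, hxy, hr, rfl⟩ := hstep
    obtain ⟨s, hs, hall, rfl⟩ := ih
    have hx : (x : ℤ) ∈ Set.Icc 1 (L : ℤ) := Finset.mem_Icc.1 x.2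
    have hy : (y : ℤ) ∈ Set.Icc 1 (L : ℤ) := Finset.mem_Icc.1 y.2
    have hy' : (x : ℤ) + (y - x) = y := by ring
    refine ⟨((x : ℤ), (y : ℤ) - x) :: s, ?_, ⟨?_, ?_, ?_⟩, ?_⟩
    · intro p hp
      rcases List.mem_cons.1 hp with rfl | hp
      · exact ⟨hx, by simpa only [hy'] using hy⟩
      · exact hs p hp
    · rcases (abs_eq zero_le_one).1 hxy with h | h <;> omega
    · rwa [hy']
    · rw [hy', ← extendOccupied_exchange]
      exact hall
    · rw [assocPerm, hy', permute_mul (SupportedIn.swap hx hy), exchange_eq_permute]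

/-- A new empty window must meet the modified stretch, which leaves at most `N + 2 * l` possible
centres. -/
theorem numWindows_le_of_eq_off {L : ℕ} (l N : ℕ) (z : ℤ) {η η' : BoxConfig L}
    (h : ∀ u ∉ Set.Icc (z + 1) (z + N), extendOccupied η' u = extendOccupied η u) :
    numWindows l η' ≤ numWindows l η + (N + 2 * l) := by
  classical
  rw [numWindows, numWindows]
  refine (Finset.card_le_card (t := _ ∪ Finset.Icc (z + 1 - l) (z + N + l - 1)) ?_).trans
    ((Finset.card_union_le _ _).trans (Nat.add_le_add_left ?_ _))
  · intro x hx
    rw [Finset.mem_filter] at hx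
    rw [Finset.mem_union, Finset.mem_filter]
    by_cases hc : z + 1 - l ≤ x ∧ x ≤ z + N + l - 1
    · exact Or.inr (Finset.mem_Icc.2 hc)
    · refine Or.inl ⟨hx.1, fun u hu => ?_⟩
      rw [← h u ?_]
      · exact hx.2 u hu
      · simp only [window, Finset.mem_Ioo] at hu
        simp only [Set.mem_Icc]
        omega
  · rw [Int.card_Icc]; omega

open Classical in
/-- The configurations that look like `ξ` on the box translated by `z`. -/
noncomputable def localConfigs (L : ℕ) {N : ℕ} (ξ : BoxConfig N) (z : ℤ) :
    Finset (BoxConfig L) :=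
  Finset.univ.filter fun η => ∀ i ∈ Set.Icc 1 (N : ℤ), extendOccupied η (i + z) = extendOccupied ξ i

theorem assocPerm_shiftMoves_inv (x : ℤ) (s : List (ℤ × ℤ)) (z : ℤ) :
    (assocPerm (shiftMoves x s))⁻¹ (z + x) = (assocPerm s)⁻¹ z + x := by
  rw [Equiv.Perm.inv_eq_iff_eq, assocPerm_shiftMoves, ← Equiv.Perm.mul_apply, mul_inv_cancel,
    Equiv.Perm.one_apply]

/-- Comparison of the mass of a local pattern with the mass of the configurations with a cluster
that is reachable from the pattern. -/
theorem sum_localConfigs_le (M : KCLatticeGas) {L N : ℕ} (f : BoxConfig L → ℝ) {ξ : BoxConfig N}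
    {s : List (ℤ × ℤ)}
    (hs : ∀ p ∈ s, p.1 ∈ Set.Icc 1 (N : ℤ) ∧ p.1 + p.2 ∈ Set.Icc 1 (N : ℤ))
    (hall : M.AllowedFrom s (extendOccupied ξ)) {A : Finset ℤ} {x : ℤ}
    (hA : EmptyAt A x (permute (assocPerm s) ξ)) {z : ℤ} (hz : 0 ≤ z) (hz' : z + N ≤ L)
    (k l θ : ℕ) :
    ∑ η ∈ localConfigs L ξ z with numVacancies η = k ∧ numWindows l η < θ, f η ^ 2 ≤
      2 * (s.length * M.totalNorm f) ^ 2 + 2 * ∑ η ∈ clusterConfigs L A (x + z) with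
        numVacancies η = k ∧ numWindows l η < θ + (N + 2 * l), f η ^ 2 := by
  classical
  set σ := assocPerm (shiftMoves z s) with hσdef
  have hmoves : ∀ p ∈ shiftMoves z s,
      p.1 ∈ Set.Icc (z + 1) (z + N) ∧ p.1 + p.2 ∈ Set.Icc (z + 1) (z + N) := by
    intro p hp
    obtain ⟨p', hp', rfl⟩ := mem_shiftMoves hp
    have := hs p' hp'
    simp only [Set.mem_Icc] at this ⊢
    omega
  have hsub : Set.Icc (z + 1) (z + N) ⊆ Set.Icc 1 (L : ℤ) :=
    Set.Icc_subset_Icc (by omega) hz'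
  have hloc : SupportedIn (Set.Icc (z + 1) (z + N)) σ := assocPerm_supportedIn hmoves
  have hσ : SupportedIn (Set.Icc 1 (L : ℤ)) σ := hloc.mono hsub
  have hσN : SupportedIn (Set.Icc 1 (N : ℤ)) (assocPerm s) := assocPerm_supportedIn hs
  set S := (localConfigs L ξ z).filter fun η => numVacancies η = k ∧ numWindows l η < θ with hS
  set T := (clusterConfigs L A (x + z)).filter fun η =>
    numVacancies η = k ∧ numWindows l η < θ + (N + 2 * l) with hT
  have hmem : ∀ η ∈ S, ∀ i ∈ Set.Icc 1 (N : ℤ), extendOccupied η (i + z) = extendOccupied ξ i :=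
    fun η hη => (Finset.mem_filter.1 (Finset.mem_filter.1 hη).1).2
  have hdisp : disp f S σ ≤ s.length * M.totalNorm f := by
    have h1 := M.disp_assocPerm_le f (shiftMoves z s)
      (fun p hp => ⟨hsub (hmoves p hp).1, hsub (hmoves p hp).2⟩) S (fun η hη => by
        refine (hall.shiftMoves z).anti fun u => ?_
        rw [translateConfig]
        by_cases hu : u - z ∈ Set.Icc 1 (N : ℤ)
        · rw [← hmem η hη _ hu, sub_add_cancel]
        · rw [extendOccupied_of_notMem ξ (by simpa using hu)]
          exact Bool.le_true _)
    refine h1.trans ((M.movesNorm_le f _).trans (le_of_eq ?_))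
    rw [shiftMoves, List.length_map]
  have hST : ∀ η ∈ S, permute σ η ∈ T := by
    intro η hη
    have hk := (Finset.mem_filter.1 hη).2
    rw [hT, Finset.mem_filter, numVacancies_permute hσ]
    refine ⟨mem_clusterConfigs.2 fun a ha => ?_, hk.1, ?_⟩
    · have h1 := (emptyAt_iff A x _).1 hA a ha
      rw [extendOccupied_permute hσN] at h1
      rw [show x + z + a = x + a + z by ring, extendOccupied_permute hσ, hσdef,
        assocPerm_shiftMoves_inv, hmem η hη, h1]
      have := mem_box_of_extendOccupied h1
      simpa using this
    · have := numWindows_le_of_eq_off l N z (η := η) (η' := permute σ η) (fun u hu => by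
        rw [extendOccupied_permute hσ, hloc.inv u hu])
      omega
  have h2 : ∑ η ∈ S, f η ^ 2 ≤ ∑ η ∈ S, (2 * (f (permute σ η) - f η) ^ 2 +
      2 * f (permute σ η) ^ 2) :=
    Finset.sum_le_sum fun η _ => by nlinarith [sq_nonneg (2 * f (permute σ η) - f η)]
  rw [Finset.sum_add_distrib, ← Finset.mul_sum, ← Finset.mul_sum, ← disp_sq] at h2
  have h3 : ∑ η ∈ S, f (permute σ η) ^ 2 ≤ ∑ η ∈ T, f η ^ 2 := by
    rw [← Finset.sum_image (f := fun ζ => f ζ ^ 2) (fun _ _ _ _ h => permute_injective hσ h)]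
    exact Finset.sum_le_sum_of_subset_of_nonneg
      (fun ζ hζ => by obtain ⟨η, hη, rfl⟩ := Finset.mem_image.1 hζ; exact hST η hη)
      fun _ _ _ => sq_nonneg _
  have h4 := pow_le_pow_left₀ disp_nonneg hdisp 2
  linarith

/-- The empty set is not a mobile cluster, because the rates are nondegenerate. -/
theorem KCLatticeGas.IsMobileCluster.nonempty {M : KCLatticeGas} {A : Finset ℤ}
    (h : M.IsMobileCluster A) : A.Nonempty := by
  by_contra hA
  rw [Finset.not_nonempty_iff_eq_empty] at hA
  subst hA
  obtain ⟨l, hl, h⟩ := h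
  obtain ⟨-, s, hs, hp, -⟩ := h 1 (Or.inl rfl) 0
  cases s with
  | nil =>
    have := congrArg (fun σ : Equiv.Perm ℤ => σ (0 + l * 1)) hp
    simp [assocPerm] at this
  | cons p s =>
    obtain ⟨x, e⟩ := p
    have he := (hs (fun _ => true) (by simp)).1
    obtain ⟨η, hη⟩ := (M.nondegenerate x (x + e) (KCLatticeGas.nbr_add he)).2
    have := (hs η (by simp)).2.1
    rw [hη] at this
    norm_num at this

/-- The configurations with a cluster and few empty windows carry little mass, with uniform
constants for finitely many clusters. -/
theorem exists_sum_sq_le_of_few_windows {M : KCLatticeGas} {F : Finset (Finset ℤ)}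
    (hF : ∀ A ∈ F, M.IsMobileCluster A) : ∃ l : ℕ, (∀ A ∈ F, ∀ a ∈ A, |a| < (l : ℤ)) ∧
      ∃ D : ℝ, 0 ≤ D ∧ ∀ A ∈ F, ∀ (L : ℕ) (f : BoxConfig L → ℝ) (y : ℤ), 1 ≤ y - l → y + l ≤ L →
        ∀ l₁ n K : ℕ, 0 < l₁ → n + 1 = 2 * l₁ → n ≤ K → 0 < K → ∀ (θ k : ℕ) (r : ℝ),
        2 * (K * r + n * (L / K) + K) + 2 * l ≤ k →
        ∑ η ∈ clusterConfigs L A y with numVacancies η = k ∧ numWindows l₁ η < θ, f η ^ 2 ≤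
          D * (4 * n + 2) ^ 2 * M.totalNorm f ^ 2 +
            4 * Real.exp (θ + 4 * l₁ + 1 - r / (2 * K ^ n)) * ∑ η, f η ^ 2 := by
  classical
  have key : ∀ A ∈ F, ∃ l : ℕ, (∀ a ∈ A, |a| < (l : ℤ)) ∧
      ∃ D : ℝ, 0 ≤ D ∧ ∀ (L : ℕ) (f : BoxConfig L → ℝ) (y : ℤ), 1 ≤ y - l → y + l ≤ L →
        ∀ l₁ n K : ℕ, 0 < l₁ → n + 1 = 2 * l₁ → n ≤ K → 0 < K → ∀ (θ k : ℕ) (r : ℝ),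
        2 * (K * r + n * (L / K) + K) + 2 * l ≤ k →
        ∑ η ∈ clusterConfigs L A y with numVacancies η = k ∧ numWindows l₁ η < θ, f η ^ 2 ≤
          D * (4 * n + 2) ^ 2 * M.totalNorm f ^ 2 +
            4 * Real.exp (θ + 4 * l₁ + 1 - r / (2 * K ^ n)) * ∑ η, f η ^ 2 := by
    intro A hA
    obtain ⟨l, -, hl⟩ := (hF A hA).exists_moveSystem
    obtain ⟨w⟩ := hl 1 (Or.inl rfl)
    obtain ⟨w'⟩ := hl (-1) (Or.inr rfl)
    refine ⟨l, w.abs_mem_lt, 2 * w.size ^ 2 + 2 * w'.size ^ 2, by positivity, ?_⟩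
    intro L f y hy hy' l₁ n K hl₁ hn hnK hK θ k r hr
    refine (sum_sq_le_of_few_windows w w' f hy hy' hl₁ hn hnK hK hr).trans (le_of_eq ?_)
    ring
  choose! l hl D hD h using key
  refine ⟨F.sup l, ?_, ∑ A ∈ F, D A, Finset.sum_nonneg hD, ?_⟩
  · intro A hA a ha
    have h1 : l A ≤ F.sup l := Finset.le_sup hA
    have h2 := hl A hA a ha
    omega
  · intro A hA L f y hy hy' l₁ n K hl₁ hn hnK hK θ k r hr
    have h1 : l A ≤ F.sup l := Finset.le_sup hA
    have h1' : (l A : ℝ) ≤ (F.sup l : ℕ) := by exact_mod_cast h1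
    have h2 := h A hA L f y (by omega) (by omega) l₁ n K hl₁ hn hnK hK θ k r (by linarith)
    have h3 : D A ≤ ∑ A ∈ F, D A := Finset.single_le_sum hD hA
    refine h2.trans (add_le_add_left ?_ _)
    gcongr

/-- The configurations with a cluster and few empty windows carry little mass. -/
theorem exists_sum_sq_le_of_containsCluster {M : KCLatticeGas} {F : Finset (Finset ℤ)}
    (hF : ∀ A ∈ F, M.IsMobileCluster A) (htrap : M.ClustersNotTrapped F) {l₁ n : ℕ} (hl₁ : 0 < l₁)
    (hn : n + 1 = 2 * l₁) : ∃ (N l : ℕ) (D : ℝ), 0 ≤ D ∧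
      ∀ L : ℕ, N ≤ L → ∀ (f : BoxConfig L → ℝ) (K : ℕ), n ≤ K → 0 < K → ∀ (θ k : ℕ) (r : ℝ),
        2 * (K * r + n * (L / K) + K) + 2 * l ≤ k →
        ∀ S : Finset (BoxConfig L),
        (∀ η ∈ S, ContainsCluster F η ∧ numVacancies η = k ∧ numWindows l₁ η < θ) →
        ∑ η ∈ S, f η ^ 2 ≤
          L * 2 ^ N * (D * M.totalNorm f ^ 2 +
            8 * Real.exp (θ + N - r / (2 * K ^ n)) * ∑ η, f η ^ 2) := by
  classical
  obtain ⟨l, hl, D, hD, hbound⟩ := exists_sum_sq_le_of_few_windows hF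
  -- One site of the cluster at distance `2 * l` from the outside suffices to place the reference
  -- point `x` with room `l` on both sides, since the cluster is nonempty and its sites satisfy `|a|
  -- < l`.
  obtain ⟨L₀, hL₀⟩ := htrap (2 * l)
  set L₁ := max L₀ (2 * l + 1) with hL₁
  have hpath : ∀ ξ : BoxConfig L₁, ContainsCluster F ξ → ∃ s : List (ℤ × ℤ),
      (∀ p ∈ s, p.1 ∈ Set.Icc 1 (L₁ : ℤ) ∧ p.1 + p.2 ∈ Set.Icc 1 (L₁ : ℤ)) ∧
      M.AllowedFrom s (extendOccupied ξ) ∧ ∃ A ∈ F, ∃ x : ℤ,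
        EmptyAt A x (permute (assocPerm s) ξ) ∧ 1 ≤ x - l ∧ x + l ≤ L₁ := by
    intro ξ hξ
    obtain ⟨ξ', hreach, A, hA, x, hempty, hmargin⟩ := hL₀ L₁ (le_max_left _ _) ξ hξ
    obtain ⟨s, hs, hall, rfl⟩ := hreach.exists_moves
    obtain ⟨a, ha⟩ := (hF A hA).nonempty
    have h1 := hmargin a ha
    have h2 := abs_lt.1 (hl A hA a ha)
    push_cast at h1
    exact ⟨s, hs, hall, A, hA, x, hempty, by omega, by omega⟩
  choose! s hs hall hcl using hpath
  set Λ : ℕ := ∑ ξ : BoxConfig L₁, (s ξ).length with hΛ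
  -- This `N` dominates the local box size, the exponent in the number `2 ^ L₁` of patterns, and the
  -- additive constants in the exponential.
  refine ⟨L₁ + L₁ + 2 * l₁ + 4 * l₁ + 1, l, 2 * Λ ^ 2 + 2 * D * (4 * n + 2) ^ 2, by positivity, ?_⟩
  intro L hL f K hnK hK θ k r hr S hS
  have hL1 : L₁ ≤ L := by omega
  have hΘ := M.totalNorm_nonneg f
  set Q := ∑ η, f η ^ 2 with hQ
  have hQ0 : 0 ≤ Q := Finset.sum_nonneg fun _ _ => sq_nonneg _
  set P := ((Finset.range L) ×ˢ (Finset.univ : Finset (BoxConfig L₁))).filter fun p =>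
    p.1 + L₁ ≤ L ∧ ContainsCluster F p.2 with hP
  set B := 2 * ((Λ : ℝ) * M.totalNorm f) ^ 2 + 2 * (D * (4 * n + 2) ^ 2 * M.totalNorm f ^ 2 +
    4 * Real.exp ((θ + (L₁ + 2 * l₁) : ℕ) + 4 * l₁ + 1 - r / (2 * K ^ n)) * Q) with hB
  have hB0 : 0 ≤ B := by positivity
  have hcover : ∀ η ∈ S, ∃ p ∈ P, η ∈ localConfigs L p.2 (p.1 : ℤ) := by
    intro η hη
    obtain ⟨A, hA, x, hempty⟩ := (hS η hη).1
    rw [emptyAt_iff] at hempty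
    -- The local box is placed around the cluster and clamped so as not to leave `[L]`.
    have hz0 : 0 ≤ max 0 (min (x - l) ((L : ℤ) - L₁)) := le_max_left _ _
    obtain ⟨z, hz⟩ := Int.eq_ofNat_of_zero_le hz0
    have hzL : z + L₁ ≤ L := by omega
    let ξ : BoxConfig L₁ := fun i => extendOccupied η ((i : ℤ) + z)
    have hξ : ∀ i ∈ Set.Icc 1 (L₁ : ℤ), extendOccupied η (i + z) = extendOccupied ξ i := by
      intro i hi
      exact (extendOccupied_coe ξ ⟨i, by simpa using hi⟩).symm
    refine ⟨(z, ξ), Finset.mem_filter.2 ⟨Finset.mem_product.2 ⟨Finset.mem_range.2 (by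
      simp only; omega), Finset.mem_univ _⟩, hzL, A, hA, x - z, ?_⟩,
      Finset.mem_filter.2 ⟨Finset.mem_univ _, hξ⟩⟩
    rw [emptyAt_iff]
    intro a ha
    have h1 := hempty a ha
    have h2 := mem_box_of_extendOccupied h1
    rw [Finset.mem_Icc] at h2
    have h3 := abs_lt.1 (hl A hA a ha)
    rw [← hξ (x - z + a) (by simp only [Set.mem_Icc]; omega), ← h1]
    congr 1; ring
  have hterm : ∀ p ∈ P, ∑ η ∈ localConfigs L p.2 (p.1 : ℤ) with
      numVacancies η = k ∧ numWindows l₁ η < θ, f η ^ 2 ≤ B := by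
    rintro ⟨z, ξ⟩ hp
    obtain ⟨-, hzL, hξ⟩ := Finset.mem_filter.1 hp
    obtain ⟨A, hA, x, hempty, hx, hx'⟩ := hcl ξ hξ
    simp only at hzL
    have h1 := sum_localConfigs_le M f (hs ξ hξ) (hall ξ hξ) hempty (z := (z : ℤ)) (by omega)
      (L := L) (by omega) k l₁ θ
    have h2 := hbound A hA L f (x + z) (by omega) (by omega) l₁ n K hl₁ hn hnK hK
      (θ + (L₁ + 2 * l₁)) k r hr
    have h3 : ((s ξ).length : ℝ) ≤ Λ := by
      exact_mod_cast Finset.single_le_sum (f := fun ξ => (s ξ).length)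
        (fun _ _ => Nat.zero_le _) (Finset.mem_univ ξ)
    have h4 : (((s ξ).length : ℝ) * M.totalNorm f) ^ 2 ≤ (Λ * M.totalNorm f) ^ 2 := by gcongr
    refine h1.trans ?_
    rw [hB]
    linarith
  have hsum : ∑ η ∈ S, f η ^ 2 ≤ ∑ p ∈ P, ∑ η ∈ localConfigs L p.2 (p.1 : ℤ) with
      numVacancies η = k ∧ numWindows l₁ η < θ, f η ^ 2 := by
    have h1 : ∀ η ∈ S, f η ^ 2 ≤ ∑ p ∈ P, if η ∈ localConfigs L p.2 (p.1 : ℤ) then f η ^ 2 else 0 := by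
      intro η hη
      obtain ⟨p, hp, hηp⟩ := hcover η hη
      refine le_trans (le_of_eq (if_pos hηp).symm) (Finset.single_le_sum
        (f := fun p : ℕ × BoxConfig L₁ => if η ∈ localConfigs L p.2 (p.1 : ℤ) then f η ^ 2 else 0)
        (fun p _ => ?_) hp)
      split_ifs
      · exact sq_nonneg _
      · exact le_rfl
    refine (Finset.sum_le_sum h1).trans ?_
    rw [Finset.sum_comm]
    refine Finset.sum_le_sum fun p _ => ?_
    rw [← Finset.sum_filter]
    refine Finset.sum_le_sum_of_subset_of_nonneg (fun η hη => ?_) fun _ _ _ => sq_nonneg _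
    rw [Finset.mem_filter] at hη ⊢
    exact ⟨hη.2, (hS η hη.1).2⟩
  have hcard : (P.card : ℝ) ≤ L * 2 ^ L₁ := by
    have h1 : P.card ≤ L * 2 ^ L₁ := by
      refine (Finset.card_filter_le _ _).trans (le_of_eq ?_)
      rw [Finset.card_product, Finset.card_range, Finset.card_univ, Fintype.card_fun]
      simp
    exact_mod_cast h1
  have h5 := hsum.trans (Finset.sum_le_card_nsmul _ _ _ hterm)
  rw [nsmul_eq_mul] at h5
  refine h5.trans (mul_le_mul ?_ ?_ hB0 (by positivity))
  · refine hcard.trans ?_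
    gcongr
    · norm_num
    · omega
  · rw [hB]
    have h6 : Real.exp ((θ + (L₁ + 2 * l₁) : ℕ) + 4 * l₁ + 1 - r / (2 * K ^ n)) ≤
        Real.exp (θ + (L₁ + L₁ + 2 * l₁ + 4 * l₁ + 1 : ℕ) - r / (2 * K ^ n)) := by
      refine Real.exp_le_exp.2 ?_
      push_cast
      have : (0 : ℝ) ≤ L₁ := Nat.cast_nonneg _
      linarith
    have h7 := mul_le_mul_of_nonneg_right h6 hQ0
    linarith


/-! ### The Poincaré inequality for a fixed family of clusters -/

namespace KCLatticeGas

variable (M : KCLatticeGas) {L : ℕ}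

theorem rate_exchange {x y : Box L} (h : Nbr (x : ℤ) y) (η : BoxConfig L) :
    M.rate x y (extendOccupied (exchange x y η)) = M.rate x y (extendOccupied η) := by
  refine M.rate_outside x y h _ _ fun z hx hy => ?_
  rw [extendOccupied_exchange, exchange, Equiv.swap_apply_of_ne_of_ne hx hy]

theorem exchange_self (x y : Box L) (η : BoxConfig L) : exchange x y (exchange x y η) = η := by
  funext z
  simp [exchange]

/-- The set is closed under allowed exchanges. -/
def IsInvariant (Ω : Set (BoxConfig L)) : Prop :=
  ∀ (η : BoxConfig L) (x y : Box L), Nbr (x : ℤ) y → 1 ≤ M.rate x y (extendOccupied η) →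
    η ∈ Ω → exchange x y η ∈ Ω

theorem isInvariant_ergodicConfigs (F : Finset (Finset ℤ)) (L k : ℕ) :
    M.IsInvariant (M.ergodicConfigs F L k) := by
  rintro η x y h hr ⟨hk, η', hη', hc⟩
  refine ⟨?_, η', Relation.ReflTransGen.head ⟨x, y, h, ?_, (exchange_self x y η).symm⟩ hη', hc⟩
  · rw [exchange_eq_permute, numVacancies_permute
      (SupportedIn.swap (Finset.mem_Icc.1 x.2) (Finset.mem_Icc.1 y.2)), hk]
  · rwa [rate_exchange M h]

open Classical in
/-- The part of the energy that comes from a set of configurations. -/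
noncomputable def energyOn (Ω : Set (BoxConfig L)) (f : BoxConfig L → ℝ) : ℝ :=
  ∑ η with η ∈ Ω, ∑ p : Box L × Box L with Nbr p.1 p.2,
    M.rate p.1 p.2 (extendOccupied η) * (f (exchange p.1 p.2 η) - f η) ^ 2

theorem energyOn_nonneg (Ω : Set (BoxConfig L)) (f : BoxConfig L → ℝ) : 0 ≤ M.energyOn Ω f :=
  Finset.sum_nonneg fun _ _ => Finset.sum_nonneg fun _ hp =>
    mul_nonneg (M.rate_nonneg (Finset.mem_filter.1 hp).2 _) (sq_nonneg _)

variable {M} in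
-- An exchange of positive rate never crosses the boundary of `Ω`, in either direction, because the
-- exchange does not change its own rate. Cutting off to `Ω` thus costs no energy.
theorem IsInvariant.energy_indicator {Ω : Set (BoxConfig L)} (hΩ : M.IsInvariant Ω)
    (f : BoxConfig L → ℝ) (c : ℝ) :
    M.energy (Ω.indicator fun η => f η - c) = M.energyOn Ω f := by
  classical
  rw [energy, energyOn, Finset.sum_filter]
  refine Finset.sum_congr rfl fun η _ => ?_
  have hstep : ∀ p : Box L × Box L, Nbr p.1 p.2 → M.rate p.1 p.2 (extendOccupied η) = 0 ∨
      (η ∈ Ω ↔ exchange p.1 p.2 η ∈ Ω) := by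
    intro p hp
    obtain ⟨c, -, hc⟩ := M.rate_values
    rcases hc p.1 p.2 hp (extendOccupied η) with h | h
    · exact Or.inl h
    · refine Or.inr ⟨hΩ η _ _ hp h.1, fun hη => ?_⟩
      have := hΩ _ p.1 p.2 hp (by rw [rate_exchange M hp]; exact h.1) hη
      rwa [exchange_self] at this
  split_ifs with hη
  · refine Finset.sum_congr rfl fun p hp => ?_
    rcases hstep p (Finset.mem_filter.1 hp).2 with h | h
    · rw [h, zero_mul, zero_mul]
    · rw [Set.indicator_of_mem hη, Set.indicator_of_mem (h.1 hη)]
      ring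
  · refine Finset.sum_eq_zero fun p hp => ?_
    rcases hstep p (Finset.mem_filter.1 hp).2 with h | h
    · rw [h, zero_mul]
    · rw [Set.indicator_of_notMem hη, Set.indicator_of_notMem (fun h' => hη (h.2 h'))]
      ring

variable {M} in
theorem IsInvariant.totalNorm_sq_le {Ω : Set (BoxConfig L)} (hΩ : M.IsInvariant Ω)
    (f : BoxConfig L → ℝ) (c : ℝ) :
    M.totalNorm (Ω.indicator fun η => f η - c) ^ 2 ≤ 2 * L * M.energyOn Ω f := by
  rw [← hΩ.energy_indicator f c]
  exact M.totalNorm_sq_le _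

end KCLatticeGas

/-- Integrals with respect to the uniform measure on a set are proportional to sums. -/
theorem exists_integral_uniformOn {α : Type*} [Fintype α] [MeasurableSpace α]
    [MeasurableSingletonClass α] (s : Finset α) :
    ∃ a : ℝ, 0 ≤ a ∧ ∀ f : α → ℝ, ∫ x, f x ∂uniformOn (s : Set α) = a * ∑ x ∈ s, f x := by
  refine ⟨((Measure.count (s : Set α))⁻¹).toReal, ENNReal.toReal_nonneg, fun f => ?_⟩
  rw [uniformOn, ProbabilityTheory.cond, integral_smul_measure,
    setIntegral_finset _ Integrable.of_finite.integrableOn]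
  simp [Measure.real]

/-- The configuration of the box whose set of vacancies is `T`. -/
def ofVacancies (L : ℕ) (T : Finset ℤ) : BoxConfig L := fun z => decide ((z : ℤ) ∉ T)

theorem extendOccupied_ofVacancies {L : ℕ} {T : Finset ℤ} (hT : T ⊆ Finset.Icc 1 (L : ℤ)) (z : ℤ) :
    extendOccupied (ofVacancies L T) z = false ↔ z ∈ T := by
  by_cases hz : z ∈ Finset.Icc 1 (L : ℤ)
  · rw [extendOccupied, dif_pos hz]; simp [ofVacancies]
  · rw [extendOccupied_of_notMem _ hz]
    simpa using fun h => hz (hT h)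

theorem numVacancies_ofVacancies {L : ℕ} {T : Finset ℤ} (hT : T ⊆ Finset.Icc 1 (L : ℤ)) :
    numVacancies (ofVacancies L T) = T.card := by
  rw [numVacancies_eq]
  congr 1
  ext z
  rw [Finset.mem_filter, extendOccupied_ofVacancies hT]
  exact ⟨fun h => h.2, fun h => ⟨hT h, h⟩⟩

theorem window_subset_of_abs_lt {A : Finset ℤ} {l : ℕ} (hA : ∀ a ∈ A, |a| < (l : ℤ)) (x : ℤ)
    {a : ℤ} (ha : a ∈ A) : x + a ∈ window l x := by
  have := abs_lt.1 (hA a ha)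
  simp only [window, Finset.mem_Ioo]
  omega

open Classical in
/-- The Poincaré inequality from the estimates on the configurations with many and with few empty
windows. -/
theorem sum_sq_le_of_good_bad {L : ℕ} (Ω : Set (BoxConfig L)) {f : BoxConfig L → ℝ} {c : ℝ}
    {good : BoxConfig L → Prop} [DecidablePred good] {θ a b D E ε β : ℝ} (hβ : 0 < β) (hL : 0 < L)
    (hθ : β * L / 2 ≤ θ)
    (hgood : θ * ∑ η with η ∈ Ω ∧ good η, (f η - c) ^ 2 ≤ a * (L ^ 2 * (2 * L * E)))
    (hbad : ∑ η with η ∈ Ω ∧ ¬ good η, (f η - c) ^ 2 ≤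
      L * b * (D * (2 * L * E) + ε * ∑ η with η ∈ Ω, (f η - c) ^ 2))
    (hε : L * b * ε ≤ 1 / 2) :
    ∑ η with η ∈ Ω, (f η - c) ^ 2 ≤ (8 * a / β + 4 * b * D) * L ^ 2 * E := by
  have hL' : (0 : ℝ) < L := by exact_mod_cast hL
  set Q := ∑ η with η ∈ Ω, (f η - c) ^ 2 with hQ
  set Qg := ∑ η with η ∈ Ω ∧ good η, (f η - c) ^ 2 with hQg
  set Qb := ∑ η with η ∈ Ω ∧ ¬ good η, (f η - c) ^ 2 with hQb
  have h1 : Q = Qg + Qb := by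
    rw [hQ, hQg, hQb, ← Finset.sum_filter_add_sum_filter_not _ good, Finset.filter_filter,
      Finset.filter_filter]
  have hg0 : 0 ≤ Qg := Finset.sum_nonneg fun _ _ => sq_nonneg _
  have hQ0 : 0 ≤ Q := Finset.sum_nonneg fun _ _ => sq_nonneg _
  have h2 : β * L / 2 * Qg ≤ a * (L ^ 2 * (2 * L * E)) :=
    (mul_le_mul_of_nonneg_right hθ hg0).trans hgood
  have h3 : Qg ≤ 4 * a / β * L ^ 2 * E := by
    refine le_of_mul_le_mul_left ?_ (show 0 < β * L / 2 by positivity)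
    refine h2.trans (le_of_eq ?_)
    field_simp
    ring
  have h4 : L * b * (ε * Q) ≤ 1 / 2 * Q := by
    rw [← mul_assoc]
    exact mul_le_mul_of_nonneg_right hε hQ0
  have h5 : (8 * a / β + 4 * b * D) * L ^ 2 * E = 2 * (4 * a / β * L ^ 2 * E) +
      2 * (L * b * (D * (2 * L * E))) := by ring
  rw [h5]
  linarith

/-- The choice of the size of the blocks and of the boxes. -/
theorem exists_block_size {q : ℝ} (hq : 0 < q) (hq1 : q < 1) (n l₁ l N : ℕ) :
    ∃ K : ℕ, 0 < K ∧ n ≤ K ∧ (n : ℝ) * 16 ≤ q * K ∧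
      1 / (q / (32 * (K : ℝ) ^ (n + 1))) ≤ 32 * (17 * (n + 1)) ^ (n + 1) * q⁻¹ ^ (n + 2) ∧
      ∃ L₀ : ℕ, ∀ L : ℕ, L₀ ≤ L → 8 * l₁ + 2 ≤ L ∧ N ≤ L ∧ (4 * l₁ + 1) * 2 ≤ q * (L : ℝ) ∧
        (2 * K + 2 * l + 1) * 8 ≤ q * (L : ℝ) ∧ 2 ≤ q / (32 * (K : ℝ) ^ (n + 1)) * L ∧
        L * 2 ^ N * (8 * Real.exp (N - q / (32 * (K : ℝ) ^ (n + 1)) * L)) ≤ (1 : ℝ) / 2 := by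
  -- With blocks this long, those with fewer than `n` vacancies account for at most about `q L / 16`
  -- vacancies in total.
  set K := ⌈16 * (n + 1) / q⌉₊ with hK
  have hKle : 16 * (n + 1) / q ≤ (K : ℝ) := Nat.le_ceil _
  have hKn : (n : ℝ) + 1 ≤ K := by
    refine le_trans ?_ hKle
    rw [le_div_iff₀ hq]
    nlinarith [Nat.cast_nonneg (α := ℝ) n]
  have hK0 : (0 : ℝ) < K := by linarith [Nat.cast_nonneg (α := ℝ) n]
  have hKlt : (K : ℝ) ≤ 17 * (n + 1) * q⁻¹ := by
    have h1 : (K : ℝ) < 16 * (n + 1) / q + 1 := Nat.ceil_lt_add_one (by positivity)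
    have h2 : (1 : ℝ) ≤ (n + 1) * q⁻¹ := by
      rw [← div_eq_mul_inv, le_div_iff₀ hq]
      linarith [Nat.cast_nonneg (α := ℝ) n]
    rw [div_eq_mul_inv] at h1
    linarith
  set β := q / (32 * K ^ (n + 1)) with hβ
  have hβ0 : 0 < β := by positivity
  set X : ℝ := (8 * l₁ + 2) + (N + (4 * l₁ + 1) * 2 / q + (2 * K + 2 * l + 1) * 8 / q + 2 / β +
    32 * 2 ^ N * Real.exp N / β ^ 2) with hX
  have hβinv : 1 / β ≤ 32 * (17 * (n + 1)) ^ (n + 1) * q⁻¹ ^ (n + 2) := by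
    rw [hβ, one_div, inv_div]
    calc 32 * (K : ℝ) ^ (n + 1) / q ≤ 32 * (17 * (n + 1) * q⁻¹) ^ (n + 1) / q := by gcongr
      _ = _ := by rw [mul_pow, div_eq_mul_inv]; ring
  refine ⟨K, by exact_mod_cast hK0, ?_, ?_, hβinv, ⌈X⌉₊, fun L hL => ?_⟩
  · have : (n : ℝ) ≤ K := by linarith
    exact_mod_cast this
  · have := (div_le_iff₀ hq).1 hKle
    linarith
  have hLX : X ≤ L := (Nat.le_ceil X).trans (by exact_mod_cast hL)
  have t1 : (0 : ℝ) ≤ (4 * l₁ + 1) * 2 / q := by positivity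
  have t2 : (0 : ℝ) ≤ (2 * K + 2 * l + 1) * 8 / q := by positivity
  have t3 : (0 : ℝ) ≤ 2 / β := by positivity
  have t4 : (0 : ℝ) ≤ 32 * 2 ^ N * Real.exp N / β ^ 2 := by positivity
  have t5 : (0 : ℝ) ≤ l₁ := Nat.cast_nonneg _
  have t6 : (0 : ℝ) ≤ N := Nat.cast_nonneg _
  have L1 : 8 * l₁ + 2 ≤ L := by
    have : (8 * l₁ + 2 : ℝ) ≤ L := by linarith
    exact_mod_cast this
  have L2 : N ≤ L := by
    have : (N : ℝ) ≤ L := by linarith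
    exact_mod_cast this
  have L3 : (4 * l₁ + 1) * 2 ≤ q * (L : ℝ) := by
    rw [mul_comm q, ← div_le_iff₀ hq]; linarith
  have L4 : (2 * K + 2 * l + 1) * 8 ≤ q * (L : ℝ) := by
    rw [mul_comm q, ← div_le_iff₀ hq]; linarith
  have L5 : 2 ≤ β * (L : ℝ) := by
    rw [mul_comm β, ← div_le_iff₀ hβ0]; linarith
  have L6 : 32 * 2 ^ N * Real.exp N ≤ β ^ 2 * (L : ℝ) := by
    rw [mul_comm (β ^ 2), ← div_le_iff₀ (by positivity)]; linarith
  have hL0 : (0 : ℝ) < L := by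
    have : 0 < L := by omega
    exact_mod_cast this
  refine ⟨L1, L2, L3, L4, L5, ?_⟩
  -- A quadratic lower bound on the exponential is enough to beat the linear prefactor `L`.
  have h1 := Real.quadratic_le_exp_of_nonneg (show 0 ≤ β * (L : ℝ) by positivity)
  have h2 : (β * L) ^ 2 / 2 ≤ Real.exp (β * L) := by
    have : 0 ≤ β * (L : ℝ) := by positivity
    linarith
  rw [Real.exp_sub, ← mul_div_assoc, ← mul_div_assoc, div_le_iff₀ (Real.exp_pos _)]
  have h3 := mul_le_mul_of_nonneg_left L6 hL0.le
  linarith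

open Classical in
/-- The Poincaré inequality for a fixed family of clusters. -/
theorem exists_poincare {M : KCLatticeGas} {F : Finset (Finset ℤ)} (hne : F.Nonempty)
    (hF : ∀ A ∈ F, M.IsMobileCluster A) (herg : M.ErgodicIffContains F)
    (htrap : M.ClustersNotTrapped F) : ∃ (C : ℝ) (p : ℕ), 0 < C ∧
      ∀ q : ℝ, 0 < q → q < 1 → ∃ L₀ : ℕ, ∀ L : ℕ, L₀ ≤ L →
        (M.ergodicConfigs F L ⌊q * L⌋₊).Nonempty ∧ ∀ f : BoxConfig L → ℝ, ∃ c : ℝ,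
          ∑ η with η ∈ M.ergodicConfigs F L ⌊q * L⌋₊, (f η - c) ^ 2 ≤
            C * (q⁻¹) ^ p * L ^ 2 * M.energyOn (M.ergodicConfigs F L ⌊q * L⌋₊) f := by
  obtain ⟨A, hA⟩ := hne
  obtain ⟨l₁, hl₁, hw⟩ := (hF A hA).exists_moveSystem
  obtain ⟨w⟩ := hw 1 (Or.inl rfl)
  obtain ⟨w'⟩ := hw (-1) (Or.inr rfl)
  obtain ⟨n, hn⟩ : ∃ n, n + 1 = 2 * l₁ := ⟨2 * l₁ - 1, by omega⟩
  obtain ⟨N, l, D, hD, hbad⟩ := exists_sum_sq_le_of_containsCluster hF htrap hl₁ hn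
  set a₀ : ℝ := 34 * (2 ^ (2 * l₁)) ^ 2 * (16 * (w.size + w'.size)) ^ 2 with ha₀
  have ha₀0 : 0 ≤ a₀ := by positivity
  refine ⟨8 * a₀ * (32 * (17 * (n + 1)) ^ (n + 1)) + 4 * 2 ^ N * D + 1, 4 * l₁ + (n + 2),
    by positivity, fun q hq hq1 => ?_⟩
  obtain ⟨K, hK, hnK, hK16, hβinv, L₀, hL₀⟩ := exists_block_size hq hq1 n l₁ l N
  have hK0 : (0 : ℝ) < K := by exact_mod_cast hK
  set β := q / (32 * (K : ℝ) ^ (n + 1)) with hβ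
  have hβ0 : 0 < β := by positivity
  refine ⟨L₀, fun L hL => ?_⟩
  obtain ⟨L1, L2, L3, L4, L5, hε⟩ := hL₀ L hL
  have hL0 : (0 : ℝ) < L := by
    have : 0 < L := by omega
    exact_mod_cast this
  set k := ⌊q * (L : ℝ)⌋₊ with hk
  have hk1 : (k : ℝ) ≤ q * L := Nat.floor_le (by positivity)
  have hk2 : q * L - 1 < k := Nat.sub_one_lt_floor _
  have hkL : k ≤ L := by
    have : (k : ℝ) ≤ L := hk1.trans (by nlinarith)
    exact_mod_cast this
  have hkl : 8 * l₁ + 2 ≤ k + 1 := by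
    have : ((8 * l₁ + 2 : ℕ) : ℝ) ≤ (k + 1 : ℕ) := by push_cast; linarith
    exact_mod_cast this
  set Ω := M.ergodicConfigs F L k with hΩ
  have hinv : M.IsInvariant Ω := M.isInvariant_ergodicConfigs F L k
  have hΩmem : ∀ η, η ∈ Ω ↔ numVacancies η = k ∧ ContainsCluster F η := by
    intro η
    rw [hΩ, herg L k]
    rfl
  refine ⟨?_, fun f => ?_⟩
  · obtain ⟨T, hST, hT, hTk⟩ := Finset.exists_subsuperset_card_eq (s := window l₁ l₁)
      (t := Finset.Icc 1 (L : ℤ)) (n := k) (fun z hz => by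
        simp only [window, Finset.mem_Ioo] at hz
        rw [Finset.mem_Icc]; omega)
      (by rw [window, Int.card_Ioo]; omega) (by simpa using hkL)
    refine ⟨ofVacancies L T, (hΩmem _).2 ⟨(numVacancies_ofVacancies hT).trans hTk, A, hA, l₁,
      (emptyAt_iff _ _ _).2 fun a ha => (extendOccupied_ofVacancies hT _).2
        (hST (window_subset_of_abs_lt w.abs_mem_lt l₁ ha))⟩⟩
  -- Chosen so that the decay exponent is twice `β * L`; the threshold `θ`, at most `β * L`, uses up
  -- half of it.
  set r : ℝ := q * L / (8 * K) with hr
  have hrβ : r / (2 * K ^ n) = 2 * (β * L) := by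
    rw [hr, hβ]; field_simp; ring
  set θ := ⌊β * (L : ℝ)⌋₊ with hθ
  have hθ1 : (θ : ℝ) ≤ β * L := Nat.floor_le (by positivity)
  have hθ2 : β * L - 1 < θ := Nat.sub_one_lt_floor _
  -- The constant comes from the configurations with many windows. The density `q / 2` leaves room
  -- for the `4 * l₁` sites of two windows and for the rounding in `k`.
  obtain ⟨c, hc⟩ := exists_const_near_of_windows hl₁ w w' (L := L) (k := k)
    (Ω.indicator fun η => f η - 0) (κ := q / 2) (by positivity) (by linarith) L1 (by linarith)
  refine ⟨c, ?_⟩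
  have hE0 := M.energyOn_nonneg Ω f
  set E := M.energyOn Ω f with hE
  have ha : 34 * ((q / 2)⁻¹ ^ (2 * l₁)) ^ 2 * (16 * (w.size + w'.size)) ^ 2 =
      a₀ * q⁻¹ ^ (4 * l₁) := by
    rw [ha₀, inv_div, div_eq_mul_inv, mul_pow, mul_pow, ← pow_mul q⁻¹]
    ring
  have hgood : (θ : ℝ) * ∑ η with η ∈ Ω ∧ θ ≤ numWindows l₁ η, (f η - c) ^ 2 ≤
      a₀ * q⁻¹ ^ (4 * l₁) * (L ^ 2 * (2 * L * E)) := by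
    rw [← ha]
    refine le_trans (mul_le_mul_of_nonneg_left ?_ (Nat.cast_nonneg _)) ((hc θ).trans
      (mul_le_mul_of_nonneg_left (mul_le_mul_of_nonneg_left (hinv.totalNorm_sq_le f 0)
        (by positivity)) (by positivity)))
    refine le_trans (le_of_eq (Finset.sum_congr rfl fun η hη => ?_))
      (Finset.sum_le_sum_of_subset_of_nonneg (fun η hη => ?_) fun _ _ _ => sq_nonneg _)
    · rw [Set.indicator_of_mem (Finset.mem_filter.1 hη).2.1, sub_zero]
    · rw [Finset.mem_filter] at hη ⊢
      exact ⟨hη.1, ((hΩmem η).1 hη.2.1).1, hη.2.2⟩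
  have hrK : 2 * (K * r + n * (L / K) + K) + 2 * l ≤ (k : ℝ) := by
    have h1 : K * r = q * L / 8 := by rw [hr]; field_simp
    have h2 : n * ((L : ℝ) / K) ≤ q * L / 16 := by
      rw [← mul_div_assoc, div_le_iff₀ hK0]
      nlinarith
    rw [h1]
    linarith
  have hbad' : ∑ η with η ∈ Ω ∧ ¬ θ ≤ numWindows l₁ η, (f η - c) ^ 2 ≤
      L * 2 ^ N * (D * (2 * L * E) + 8 * Real.exp (N - β * L) *
        ∑ η with η ∈ Ω, (f η - c) ^ 2) := by
    -- The cutoff turns the sum over all configurations on the right into a sum over `Ω`, so that it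
    -- can be absorbed.
    have h1 := hbad L L2 (Ω.indicator fun η => f η - c) K
      hnK hK θ k r hrK
      (Finset.univ.filter fun η => η ∈ Ω ∧ ¬ θ ≤ numWindows l₁ η) (fun η hη => by
        have h2 := (Finset.mem_filter.1 hη).2
        have h3 := (hΩmem η).1 h2.1
        exact ⟨h3.2, h3.1, not_le.1 h2.2⟩)
    have h2 : ∑ η, (Ω.indicator (fun η => f η - c) η) ^ 2 = ∑ η with η ∈ Ω, (f η - c) ^ 2 := by
      rw [Finset.sum_filter]
      refine Finset.sum_congr rfl fun η _ => ?_
      rw [Set.indicator_apply]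
      split_ifs <;> ring
    have h3 : ∑ η with η ∈ Ω ∧ ¬ θ ≤ numWindows l₁ η, (Ω.indicator (fun η => f η - c) η) ^ 2 =
        ∑ η with η ∈ Ω ∧ ¬ θ ≤ numWindows l₁ η, (f η - c) ^ 2 :=
      Finset.sum_congr rfl fun η hη => by
        rw [Set.indicator_of_mem (Finset.mem_filter.1 hη).2.1]
    rw [h2, h3] at h1
    have h4 : Real.exp (θ + N - r / (2 * K ^ n)) ≤ Real.exp (N - β * L) := by
      refine Real.exp_le_exp.2 ?_
      rw [hrβ]; linarith
    have h5 : 0 ≤ ∑ η with η ∈ Ω, (f η - c) ^ 2 := Finset.sum_nonneg fun _ _ => sq_nonneg _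
    refine h1.trans (mul_le_mul_of_nonneg_left (add_le_add
      (mul_le_mul_of_nonneg_left (hinv.totalNorm_sq_le f c) hD)
      (mul_le_mul_of_nonneg_right (mul_le_mul_of_nonneg_left h4 (by norm_num)) h5))
      (by positivity))
  have main := sum_sq_le_of_good_bad Ω (good := fun η => θ ≤ numWindows l₁ η) hβ0 (by omega)
    (θ := θ) (by linarith) hgood hbad' hε
  refine main.trans ?_
  have hq1' : 1 ≤ q⁻¹ := (one_le_inv₀ hq).2 hq1.le
  have hpow : (1 : ℝ) ≤ q⁻¹ ^ (4 * l₁ + (n + 2)) := one_le_pow₀ hq1'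
  have hcoef : 8 * (a₀ * q⁻¹ ^ (4 * l₁)) / β + 4 * 2 ^ N * D ≤
      (8 * a₀ * (32 * (17 * (n + 1)) ^ (n + 1)) + 4 * 2 ^ N * D + 1) *
        q⁻¹ ^ (4 * l₁ + (n + 2)) := by
    have h1 : 8 * (a₀ * q⁻¹ ^ (4 * l₁)) / β ≤
        8 * a₀ * (32 * (17 * (n + 1)) ^ (n + 1)) * q⁻¹ ^ (4 * l₁ + (n + 2)) := by
      have := mul_le_mul_of_nonneg_left hβinv
        (show 0 ≤ 8 * (a₀ * q⁻¹ ^ (4 * l₁)) by positivity)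
      rw [mul_one_div] at this
      refine this.trans (le_of_eq ?_)
      rw [pow_add]; ring
    have h2 : 4 * 2 ^ N * D * 1 ≤ 4 * 2 ^ N * D * q⁻¹ ^ (4 * l₁ + (n + 2)) :=
      mul_le_mul_of_nonneg_left hpow (by positivity)
    linarith
  exact mul_le_mul_of_nonneg_right (mul_le_mul_of_nonneg_right hcoef (by positivity)) hE0

/-- The variance is at most the mean square distance to any constant, and the normalisation of the
uniform measure is common to both sides. -/
theorem variance_le_of_sum_sq_le {M : KCLatticeGas} {L : ℕ} {Ω : Set (BoxConfig L)}
    (hΩ : Ω.Nonempty) {f : BoxConfig L → ℝ} {B c : ℝ}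
    (h : ∑ η ∈ (Set.toFinite Ω).toFinset, (f η - c) ^ 2 ≤ B * M.energyOn Ω f) :
    variance f (uniformOn Ω) ≤ B * M.dirichletForm (uniformOn Ω) f := by
  classical
  have hfin := Set.toFinite Ω
  have : IsProbabilityMeasure (uniformOn Ω) := isProbabilityMeasure_uniformOn hfin hΩ
  obtain ⟨a, ha, hint⟩ := exists_integral_uniformOn hfin.toFinset
  rw [hfin.coe_toFinset] at hint
  have hm : AEStronglyMeasurable f (uniformOn Ω) := Integrable.of_finite.aestronglyMeasurable
  have h1 := variance_le_expectation_sq (μ := uniformOn Ω) (X := fun η => f η - c)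
    Integrable.of_finite.aestronglyMeasurable
  rw [variance_sub_const hm] at h1
  refine h1.trans ?_
  have h2 : M.energyOn Ω f = ∑ η ∈ hfin.toFinset, ∑ p : Box L × Box L with Nbr p.1 p.2,
      M.rate p.1 p.2 (extendOccupied η) * (f (exchange p.1 p.2 η) - f η) ^ 2 := by
    rw [KCLatticeGas.energyOn]
    congr 1
    ext η
    simp
  rw [KCLatticeGas.dirichletForm, hint, hint, ← h2]
  simp only [Pi.pow_apply]
  calc a * ∑ η ∈ hfin.toFinset, (f η - c) ^ 2 ≤ a * (B * M.energyOn Ω f) :=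
        mul_le_mul_of_nonneg_left h ha
    _ = B * (a * M.energyOn Ω f) := by ring

/-- The relaxation time for a fixed family of clusters. -/
theorem exists_variance_le {M : KCLatticeGas} {F : Finset (Finset ℤ)} (hne : F.Nonempty)
    (hF : ∀ A ∈ F, M.IsMobileCluster A) (herg : M.ErgodicIffContains F)
    (htrap : M.ClustersNotTrapped F) : ∃ C : ℝ, 0 < C ∧
      ∀ q : ℝ, 0 < q → q < 1 → ∃ L₀ : ℕ, ∀ L : ℕ, L₀ ≤ L →
        (M.ergodicConfigs F L ⌊q * L⌋₊).Nonempty ∧ ∀ f : BoxConfig L → ℝ,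
          variance f (M.equilibrium F L ⌊q * L⌋₊) ≤ C * q ^ (-C) * (L : ℝ) ^ 2 *
            M.dirichletForm (M.equilibrium F L ⌊q * L⌋₊) f := by
  classical
  obtain ⟨C, p, hC, h⟩ := exists_poincare hne hF herg htrap
  -- A single number serves as prefactor and as exponent, since `q < 1` allows the exponent to be
  -- enlarged.
  refine ⟨C + p, by positivity, fun q hq hq1 => ?_⟩
  obtain ⟨L₀, hL₀⟩ := h q hq hq1
  refine ⟨L₀, fun L hL => ⟨(hL₀ L hL).1, fun f => ?_⟩⟩
  obtain ⟨hΩ, hf⟩ := hL₀ L hL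
  obtain ⟨c, hc⟩ := hf f
  refine variance_le_of_sum_sq_le hΩ (c := c) ?_
  have e1 : (Set.toFinite (M.ergodicConfigs F L ⌊q * L⌋₊)).toFinset =
      Finset.univ.filter fun η => η ∈ M.ergodicConfigs F L ⌊q * L⌋₊ := by
    ext η; simp
  rw [e1]
  refine le_trans (le_trans (le_of_eq ?_) hc) ?_
  · exact Finset.sum_congr (by ext η; simp) fun _ _ => rfl
  refine mul_le_mul_of_nonneg_right (mul_le_mul_of_nonneg_right ?_ (by positivity))
    (M.energyOn_nonneg _ f)
  have h1 : q⁻¹ ^ p ≤ q ^ (-(C + p)) := by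
    rw [inv_pow, ← Real.rpow_natCast, ← Real.rpow_neg hq.le]
    exact Real.rpow_le_rpow_of_exponent_ge hq hq1.le (by linarith)
  have h2 : (0 : ℝ) ≤ p := Nat.cast_nonneg _
  exact mul_le_mul (by linarith) h1 (by positivity) (by positivity)


/-! ### Independence of the family of clusters -/

section ChangeOfFamily

variable {M : KCLatticeGas}

theorem KCLatticeGas.isInvariant_reaches {L : ℕ} (η : BoxConfig L) :
    M.IsInvariant {ζ | M.Reaches η ζ} :=
  fun _ x y h hr hζ => Relation.ReflTransGen.tail hζ ⟨x, y, h, hr, rfl⟩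

/-- The indicator of a set closed under allowed exchanges has zero energy. The cost estimates
applied to it become statements about reachability. -/
theorem KCLatticeGas.totalNorm_indicator_reaches {L : ℕ} (η : BoxConfig L) :
    M.totalNorm ({ζ | M.Reaches η ζ}.indicator fun _ => (1 : ℝ) - 0) = 0 := by
  have h := (KCLatticeGas.isInvariant_reaches (M := M) η).totalNorm_sq_le (fun _ => 1) 0
  have h0 : M.energyOn {ζ | M.Reaches η ζ} (fun _ => 1) = 0 := by simp [KCLatticeGas.energyOn]
  rw [h0, mul_zero] at h
  exact pow_eq_zero_iff (two_ne_zero) |>.1 (le_antisymm h (sq_nonneg _))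

/-- A cluster allows to rearrange the vacancies on its right. -/
theorem MoveSystem.reaches {A : Finset ℤ} {l : ℕ} (w : MoveSystem M A l 1) {L : ℕ} {x : ℤ}
    (hx : 1 ≤ x - l) (hx' : x + l ≤ L) {η η' : BoxConfig L} (hη : η ∈ clusterConfigs L A x)
    (hoff : ∀ z < x + l, extendOccupied η z = extendOccupied η' z)
    (hcard : numVacancies η = numVacancies η') : M.Reaches η η' := by
  classical
  set f : BoxConfig L → ℝ := {ζ | M.Reaches η ζ}.indicator fun _ => (1 : ℝ) - 0 with hf
  have hsupp : ∀ a b : ℤ, a ∈ Set.Icc 1 (L : ℤ) → b ∈ Set.Icc 1 (L : ℤ) → x + l ≤ a → x + l ≤ b →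
      ∀ ζ ∈ clusterConfigs L A x, permute (Equiv.swap a b) ζ ∈ clusterConfigs L A x := by
    intro a b ha hb ha' hb' ζ hζ
    refine permute_mem_clusterConfigs (SupportedIn.swap ha hb) (fun y hy => ?_) hζ
    have := abs_lt.1 (w.abs_mem_lt y hy)
    exact Equiv.swap_apply_of_ne_of_ne (by omega) (by omega)
  have hinv : ∀ a b : ℤ, a ∈ Set.Icc 1 (L : ℤ) → b ∈ Set.Icc 1 (L : ℤ) → x + l ≤ a → x + l ≤ b →
      ∀ ζ ∈ clusterConfigs L A x, f (permute (Equiv.swap a b) ζ) = f ζ := by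
    intro a b ha hb ha' hb' ζ hζ
    have h1 := w.disp_swap_same_side_le f hx hx' ha hb (by omega) (by omega)
    rw [hf, KCLatticeGas.totalNorm_indicator_reaches, mul_zero, ← hf] at h1
    have h2 : disp f (clusterConfigs L A x) (Equiv.swap a b) ^ 2 = 0 := by
      rw [le_antisymm h1 disp_nonneg]; norm_num
    rw [disp_sq, Finset.sum_eq_zero_iff_of_nonneg fun _ _ => sq_nonneg _] at h2
    have := pow_eq_zero_iff (two_ne_zero) |>.1 (h2 ζ hζ)
    linarith
  have key := eq_of_exchange_invariant (Finset.univ.filter fun z : Box L => x + l ≤ (z : ℤ)) f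
    (fun ζ => ζ ∈ clusterConfigs L A x)
    (fun i hi j hj ζ hζ => by
      rw [exchange_eq_permute]
      exact hsupp i j (Finset.mem_Icc.1 i.2) (Finset.mem_Icc.1 j.2) (Finset.mem_filter.1 hi).2
        (Finset.mem_filter.1 hj).2 ζ hζ)
    (fun i hi j hj ζ hζ => by
      rw [exchange_eq_permute]
      exact hinv i j (Finset.mem_Icc.1 i.2) (Finset.mem_Icc.1 j.2) (Finset.mem_filter.1 hi).2
        (Finset.mem_filter.1 hj).2 ζ hζ) η η' hη
    (fun z hz => by
      rw [Finset.mem_filter, not_and] at hz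
      rw [← extendOccupied_coe η, ← extendOccupied_coe η']
      exact hoff z (not_le.1 (hz (Finset.mem_univ z)))) hcard
  have h1 : f η = 1 := by
    rw [hf, Set.indicator_of_mem (show η ∈ {ζ | M.Reaches η ζ} from Relation.ReflTransGen.refl)]
    norm_num
  by_contra hcon
  rw [h1, hf, Set.indicator_of_notMem (show η' ∉ {ζ | M.Reaches η ζ} from hcon)] at key
  norm_num at key

/-- If the ergodic configurations are those that contain a cluster of `F`, then every mobile
cluster contains a translate of a cluster of `F`. -/
theorem KCLatticeGas.IsMobileCluster.exists_translate_subset {A : Finset ℤ}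
    (hA : M.IsMobileCluster A) {F : Finset (Finset ℤ)} (hne : F.Nonempty)
    (hF : ∀ B ∈ F, M.IsMobileCluster B) (herg : M.ErgodicIffContains F) :
    ∃ B ∈ F, ∃ t : ℤ, ∀ b ∈ B, b + t ∈ A := by
  classical
  obtain ⟨l, hl, hw⟩ := hA.exists_moveSystem
  obtain ⟨w⟩ := hw 1 (Or.inl rfl)
  obtain ⟨m, hm, -⟩ := exists_sum_sq_le_of_few_windows hF
  obtain ⟨B₀, hB₀⟩ := hne
  set n := B₀.card with hn
  set L : ℕ := 2 * l + 1 + (n + 1) * (2 * m + 1) with hL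
  set x : ℤ := l + 1 with hx
  -- Isolated vacancies, farther from each other and from `A` than the diameter of any cluster of
  -- `F`. There are as many as sites of `B₀`, so the cluster `A` can assemble them into a translate
  -- of `B₀`.
  set p : ℕ → ℤ := fun j => x + l + (j + 1 : ℕ) * (2 * m + 1 : ℕ) with hp
  have hpinj : Function.Injective p := by
    intro i j hij
    simp only [hp, add_right_inj] at hij
    have : ((2 * m + 1 : ℕ) : ℤ) ≠ 0 := by positivity
    have := mul_right_cancel₀ this hij
    omega
  have hpsep : ∀ i j, i < j → p i + (2 * m + 1 : ℕ) ≤ p j := by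
    intro i j hij
    have h1 : (i + 1 + 1) * (2 * m + 1) ≤ (j + 1) * (2 * m + 1) := Nat.mul_le_mul_right _ (by omega)
    rw [Nat.succ_mul] at h1
    simp only [hp]
    have h2 : (((i + 1) * (2 * m + 1) + (2 * m + 1) : ℕ) : ℤ) ≤ ((j + 1) * (2 * m + 1) : ℕ) := by
      exact_mod_cast h1
    rw [Nat.cast_add, Nat.cast_mul, Nat.cast_mul] at h2
    linarith
  have hp0 : ∀ j, x + l + (2 * m + 1 : ℕ) ≤ p j := by
    intro j
    have h1 : 1 * (2 * m + 1) ≤ (j + 1) * (2 * m + 1) := Nat.mul_le_mul_right _ (by omega)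
    have h2 : ((1 * (2 * m + 1) : ℕ) : ℤ) ≤ ((j + 1) * (2 * m + 1) : ℕ) := by exact_mod_cast h1
    rw [Nat.cast_mul (j + 1), one_mul] at h2
    simp only [hp]
    linarith
  have hpL : ∀ j < n, p j ≤ L := by
    intro j hj
    have h1 : (j + 1) * (2 * m + 1) ≤ (n + 1) * (2 * m + 1) := Nat.mul_le_mul_right _ (by omega)
    have h2 : (((j + 1) * (2 * m + 1) : ℕ) : ℤ) ≤ ((n + 1) * (2 * m + 1) : ℕ) := by exact_mod_cast h1
    rw [Nat.cast_mul (j + 1)] at h2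
    simp only [hp, hL]
    rw [Nat.cast_add (2 * l + 1)]
    push_cast at h2 ⊢
    linarith
  have hL' : 2 * l + 1 + (2 * m + 1) ≤ L := by
    have h1 : 1 * (2 * m + 1) ≤ (n + 1) * (2 * m + 1) := Nat.mul_le_mul_right _ (by omega)
    omega
  have hAx : ∀ a ∈ A, 1 ≤ x + a ∧ x + a < x + l := by
    intro a ha
    have := abs_lt.1 (w.abs_mem_lt a ha)
    omega
  have hBx : ∀ b ∈ B₀, x + l ≤ x + l + m + b ∧ x + l + m + b ≤ L := by
    intro b hb
    have := abs_lt.1 (hm B₀ hB₀ b hb)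
    omega
  set T₀ := A.image fun a => x + a with hT₀
  set T := T₀ ∪ (Finset.range n).image p with hT
  set T' := T₀ ∪ B₀.image (fun b => x + l + m + b) with hT'
  have hT₀mem : ∀ z ∈ T₀, 1 ≤ z ∧ z < x + l := by
    intro z hz
    obtain ⟨a, ha, rfl⟩ := Finset.mem_image.1 hz
    exact hAx a ha
  have hright : ∀ z ∈ (Finset.range n).image p, x + l + (2 * m + 1 : ℕ) ≤ z ∧ z ≤ L := by
    intro z hz
    obtain ⟨j, hj, rfl⟩ := Finset.mem_image.1 hz
    exact ⟨hp0 j, hpL j (Finset.mem_range.1 hj)⟩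
  have hright' : ∀ z ∈ B₀.image (fun b => x + l + m + b), x + l ≤ z ∧ z ≤ L := by
    intro z hz
    obtain ⟨b, hb, rfl⟩ := Finset.mem_image.1 hz
    exact hBx b hb
  have hTL : T ⊆ Finset.Icc 1 (L : ℤ) := by
    intro z hz
    rw [Finset.mem_Icc]
    rcases Finset.mem_union.1 hz with h | h
    · have := hT₀mem z h; omega
    · have := hright z h; omega
  have hTL' : T' ⊆ Finset.Icc 1 (L : ℤ) := by
    intro z hz
    rw [Finset.mem_Icc]
    rcases Finset.mem_union.1 hz with h | h
    · have := hT₀mem z h; omega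
    · have := hright' z h; omega
  have hcardT : T.card = T₀.card + n := by
    rw [hT, Finset.card_union_of_disjoint, Finset.card_image_of_injective _ hpinj,
      Finset.card_range]
    refine Finset.disjoint_left.2 fun z h h' => ?_
    have := hT₀mem z h
    have := hright z h'
    omega
  have hcardT' : T'.card = T₀.card + n := by
    rw [hT', Finset.card_union_of_disjoint,
      Finset.card_image_of_injective B₀ (add_right_injective (x + l + m))]
    refine Finset.disjoint_left.2 fun z h h' => ?_
    have := hT₀mem z h
    have := hright' z h'
    omega
  have hreach : M.Reaches (ofVacancies L T) (ofVacancies L T') := by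
    refine w.reaches (x := x) (by omega) (by omega) ?_ ?_ ?_
    · rw [mem_clusterConfigs]
      intro a ha
      rw [extendOccupied_ofVacancies hTL]
      exact Finset.mem_union_left _ (Finset.mem_image_of_mem _ ha)
    · intro z hz
      rw [Bool.eq_iff_iff, ← not_iff_not, Bool.not_eq_true, Bool.not_eq_true,
        extendOccupied_ofVacancies hTL, extendOccupied_ofVacancies hTL', Finset.mem_union,
        Finset.mem_union]
      refine or_congr_right ⟨fun h => ?_, fun h => ?_⟩
      · have := hright z h; omega
      · have := hright' z h; omega
    · rw [numVacancies_ofVacancies hTL, numVacancies_ofVacancies hTL', hcardT, hcardT']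
  have hmem : ofVacancies L T ∈ M.ergodicConfigs F L (T₀.card + n) := by
    refine ⟨(numVacancies_ofVacancies hTL).trans hcardT, _, hreach, B₀, hB₀, x + l + m,
      (emptyAt_iff _ _ _).2 fun b hb => ?_⟩
    rw [extendOccupied_ofVacancies hTL']
    exact Finset.mem_union_right _ (Finset.mem_image_of_mem _ hb)
  rw [herg] at hmem
  obtain ⟨-, B, hB, y, hempty⟩ := hmem
  rw [emptyAt_iff] at hempty
  have hBT : ∀ b ∈ B, y + b ∈ T := fun b hb => (extendOccupied_ofVacancies hTL _).1 (hempty b hb)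
  refine ⟨B, hB, ?_⟩
  -- The translate of `B` present before the assembly either lies within the copy of `A`, or uses an
  -- isolated vacancy. In the latter case `B` is a single site and fits into the nonempty set `A`.
  by_cases hcase : ∀ b ∈ B, y + b ∈ T₀
  · refine ⟨y - x, fun b hb => ?_⟩
    obtain ⟨a, ha, h⟩ := Finset.mem_image.1 (hcase b hb)
    have : b + (y - x) = a := by linarith
    rwa [this]
  · push Not at hcase
    obtain ⟨b, hb, hbT⟩ := hcase
    obtain ⟨j, -, hj⟩ := Finset.mem_image.1 ((Finset.mem_union.1 (hBT b hb)).resolve_left hbT)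
    obtain ⟨a, ha⟩ := hA.nonempty
    refine ⟨a - b, fun b' hb' => ?_⟩
    have h1 := abs_lt.1 (hm B hB b hb)
    have h2 := abs_lt.1 (hm B hB b' hb')
    have hbb : b' = b := by
      rcases Finset.mem_union.1 (hBT b' hb') with h | h
      · have := hT₀mem _ h
        have := hp0 j
        omega
      · obtain ⟨i, -, hi⟩ := Finset.mem_image.1 h
        rcases lt_trichotomy i j with hij | rfl | hij
        · have := hpsep i j hij; omega
        · omega
        · have := hpsep j i hij; omega
    rw [hbb, add_sub_cancel]
    exact ha

theorem ContainsCluster.of_translate {F F' : Finset (Finset ℤ)}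
    (h : ∀ A ∈ F, ∃ B ∈ F', ∃ t : ℤ, ∀ b ∈ B, b + t ∈ A) {L : ℕ} {η : BoxConfig L}
    (hη : ContainsCluster F η) : ContainsCluster F' η := by
  obtain ⟨A, hA, x, hx⟩ := hη
  obtain ⟨B, hB, t, ht⟩ := h A hA
  rw [emptyAt_iff] at hx
  refine ⟨B, hB, x + t, (emptyAt_iff _ _ _).2 fun b hb => ?_⟩
  rw [add_assoc, add_comm t]
  exact hx _ (ht b hb)

/-- The ergodic configurations do not depend on the family of clusters. -/
theorem ergodicConfigs_eq {F F' : Finset (Finset ℤ)} (hne : F.Nonempty) (hne' : F'.Nonempty)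
    (hF : ∀ A ∈ F, M.IsMobileCluster A) (hF' : ∀ A ∈ F', M.IsMobileCluster A)
    (herg : M.ErgodicIffContains F) (herg' : M.ErgodicIffContains F') (L k : ℕ) :
    M.ergodicConfigs F L k = M.ergodicConfigs F' L k := by
  have h1 : ∀ A ∈ F, ∃ B ∈ F', ∃ t : ℤ, ∀ b ∈ B, b + t ∈ A :=
    fun A hA => (hF A hA).exists_translate_subset hne' hF' herg'
  have h2 : ∀ A ∈ F', ∃ B ∈ F, ∃ t : ℤ, ∀ b ∈ B, b + t ∈ A :=
    fun A hA => (hF' A hA).exists_translate_subset hne hF herg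
  rw [herg, herg']
  ext η
  exact and_congr_right fun _ => ⟨fun h => h.of_translate h1, fun h => h.of_translate h2⟩

end ChangeOfFamily

theorem mainTheorem2 (M : KCLatticeGas) (hM : M.IsNoncooperative) :
    ∃ C : ℝ, 0 < C ∧
      ∀ F : Finset (Finset ℤ), F.Nonempty → (∀ A ∈ F, M.IsMobileCluster A) →
        M.ErgodicIffContains F → M.ClustersNotTrapped F →
        ∀ q : ℝ, 0 < q → q < 1 →
          ∃ L₀ : ℕ, ∀ L : ℕ, L₀ ≤ L →
            (M.ergodicConfigs F L ⌊q * L⌋₊).Nonempty ∧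
            ∀ f : BoxConfig L → ℝ,
              variance f (M.equilibrium F L ⌊q * L⌋₊) ≤
                C * q ^ (-C) * (L : ℝ) ^ 2 *
                  M.dirichletForm (M.equilibrium F L ⌊q * L⌋₊) f := by
  -- The constant is taken from one admissible family, chosen from the model alone. If there is
  -- none, the claim is vacuous.
  by_cases h : ∃ F : Finset (Finset ℤ), F.Nonempty ∧ (∀ A ∈ F, M.IsMobileCluster A) ∧
      M.ErgodicIffContains F ∧ M.ClustersNotTrapped F
  · obtain ⟨F₀, hne₀, hF₀, herg₀, htrap₀⟩ := h
    obtain ⟨C, hC, hmain⟩ := exists_variance_le hne₀ hF₀ herg₀ htrap₀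
    refine ⟨C, hC, fun F hne hF herg _ q hq hq1 => ?_⟩
    have heq := ergodicConfigs_eq hne hne₀ hF hF₀ herg herg₀
    simp only [KCLatticeGas.equilibrium, heq] at hmain ⊢
    exact hmain q hq hq1
  · exact ⟨1, one_pos, fun F hne hF herg htrap => absurd ⟨F, hne, hF, herg, htrap⟩ h⟩
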